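/- Let $X$ be a finite non-empty set. A (unit) implicational base $(X,\Sigma)$ is a set $\Sigma$ of implications $A\to b$ with $A\subseteq X$, $b\in X$; a set $C\subseteq X$ is closed if $A\subseteq C$ implies $b\in C$ for all $A\to b\in\Sigma$, and $\mathcal C_\Sigma$ is the family of closed sets. The base is ranked if there is $\rho:X\to\mathbb N$ with $\rho(a)=\rho(b)+1$ whenever $A\to b\in\Sigma$ and $a\in A$. As usual, the closure space is assumed to be standard (for ranked bases: $\emptyset$ is closed). A set $M\in\mathcal C_\Sigma$, $M\neq X$, is meet-irreducible if $M=C_1\cap C_2$ with $C_1,C_2\in\mathcal C_\Sigma$ implies $C_1=M$ or $C_2=M$; $\mathcal M(\mathcal C_\Sigma)$ is the set of meet-irreducible elements, and $|\Sigma|$ is the number of implications. For a hypergraph $\mathcal H=(V,\mathcal E)$, $|\mathcal H|=|V|+|\mathcal E|$ and $MIS(\mathcal H)$ is the set of inclusion-wise maximal subsets of $V$ containing no edge. Algorithms are programs of a random access machine with unit-cost instructions, arithmetic $+,-,\times,\div$, a read-only input given by its incidence table, write-only output, and memory words whose length is logarithmic in the instance size and the space; space is counted in memory cells (input and output excluded).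 Enumerating means outputting every member exactly once and then halting; the delay bounds the times, after preprocessing, until the first output, between two consecutive outputs, and between the last output and halting. **Theorem.** (1) Let $f,g:\mathbb N\to\mathbb N$ be non-decreasing functions with $f(N),g(N)=\Omega(N)$ (i.e. $N\le c\,f(N)$ and $N\le c\,g(N)$ for some constant $c$ and all $N$). If there is an algorithm that enumerates $MIS(\mathcal H)$ with delay $f(|\mathcal H|)$ (without preprocessing) and space $g(|\mathcal H|)$ for every given hypergraph $\mathcal H$, then there is an algorithm that, given any ranked implicational base $(X,\Sigma)$ (without its rank function), enumerates $\mathcal M(\mathcal C_\Sigma)$ with delay $O(|X|\cdot f(|X|+|\Sigma|))$, space $O(|X|\cdot g(|X|+|\Sigma|))$, and after $O(|X|\cdot|\Sigma|)$ preprocessing time. (2) If there is an algorithm that enumerates $MIS(\mathcal H)$ in total time and space quasi-polynomial in $|\mathcal H|+|MIS(\mathcal H)|$ (as follows from the result of Fredman and Khachiyan on hypergraph dualization), then there is an algorithm that, given any ranked implicational base $(X,\Sigma)$, enumerates $\mathcal M(\mathcal C_\Sigma)$ in total time and space quasi-polynomial in $|X|+|\Sigma|+|\mathcal M(\mathcal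 C_\Sigma)|$. -/

import Mathlib

/-! ### Implicational bases, closed sets, meet-irreducible elements -/

/-- A unit implication `premise → conclusion` on the ground set `α`. -/
structure Implication (α : Type*) where
  premise : Finset α
  conclusion : α

/-- `C` is closed in `B`: every implication whose premise lies in `C` has its conclusion in `C`. -/
def IsClosedIn {α : Type*} (B : Set (Implication α)) (C : Finset α) : Prop :=
  ∀ r ∈ B, r.premise ⊆ C → r.conclusion ∈ C

/-- `B` is ranked: some `ρ` satisfies `ρ a = ρ b + 1` whenever `A → b` is in `B` and `a ∈ A`. -/
def IsRanked {α : Type*} (B : Set (Implication α)) : Prop :=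
  ∃ ρ : α → ℕ, ∀ r ∈ B, ∀ a ∈ r.premise, ρ a = ρ r.conclusion + 1

/-- The set of meet-irreducible elements of the closure system of `B`. -/
def meetIrreducibles {α : Type*} [Fintype α] [DecidableEq α] (B : Set (Implication α)) :
    Set (Finset α) :=
  {M | IsClosedIn B M ∧ M ≠ Finset.univ ∧
    ∀ C₁ C₂ : Finset α, IsClosedIn B C₁ → IsClosedIn B C₂ → M = C₁ ∩ C₂ → C₁ = M ∨ C₂ = M}

/-! ### Hypergraphs -/

/-- `S` contains no edge of the hypergraph on `α` with edge set `E`. -/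
def IsIndependentSet {α : Type*} (E : Set (Finset α)) (S : Finset α) : Prop :=
  ∀ A ∈ E, ¬ A ⊆ S

/-- The set of inclusion-wise maximal independent sets. -/
def maximalIndependentSets {α : Type*} (E : Set (Finset α)) : Set (Finset α) :=
  {S | Maximal (IsIndependentSet E) S}

/-! ### Random access machines

The input is a read-only table of natural numbers which can be queried entry by entry. The work
memory is a sequence of cells, initially `0`, and the output is write-only. Every instruction costs
one unit of time. -/

/-- A read-only input table. -/
structure InputTable where
  rows : ℕ
  cols : ℕ
  entry : ℕ → ℕ → ℕ

/-- Arithmetic operations (truncated subtraction, integer division). -/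
inductive ArithOp where
  | add | sub | mul | div

def ArithOp.eval : ArithOp → ℕ → ℕ → ℕ
  | .add, x, y => x + y
  | .sub, x, y => x - y
  | .mul, x, y => x * y
  | .div, x, y => x / y

/-- Instructions. The arguments `d`, `a`, `b` are addresses of memory cells, `c` is a constant and
`l` is a line of the program. -/
inductive Instr where
  /-- `mem[d] := c` -/
  | const (d c : ℕ)
  /-- `mem[d] := mem[a] ∘ mem[b]` -/
  | arith (o : ArithOp) (d a b : ℕ)
  /-- `mem[d] := mem[mem[a]]` -/
  | load (d a : ℕ)
  /-- `mem[mem[a]] := mem[b]` -/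
  | store (a b : ℕ)
  /-- `goto l` -/
  | jump (l : ℕ)
  /-- `if mem[a] = 0 then goto l` -/
  | jumpZero (a l : ℕ)
  /-- `mem[d] :=` number of rows of the input -/
  | rows (d : ℕ)
  /-- `mem[d] :=` number of columns of the input -/
  | cols (d : ℕ)
  /-- `mem[d] :=` input entry in row `mem[a]` and column `mem[b]` -/
  | entry (d a b : ℕ)
  /-- append the number `mem[a]` to the solution that is being written -/
  | write (a : ℕ)
  /-- the solution that is being written is complete; start a new, empty one -/
  | emit

/-- A program is a finite list of instructions, independent of the input. -/
abbrev Program := List Instr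

/-- A configuration: program counter, memory, the solution being written, the solutions output. -/
structure Configuration where
  pc : ℕ
  mem : ℕ → ℕ
  cur : List ℕ
  out : List (List ℕ)

def Configuration.initial : Configuration := ⟨0, fun _ => 0, [], []⟩

/-- Write `v` into cell `d` and proceed to the next line. -/
def Configuration.set (s : Configuration) (d v : ℕ) : Configuration :=
  { s with pc := s.pc + 1, mem := Function.update s.mem d v }

/-- The effect of a single instruction. -/
def Instr.exec (T : InputTable) (s : Configuration) : Instr → Configuration
  | .const d c => s.set d c
  | .arith o d a b => s.set d (o.eval (s.mem a) (s.mem b))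
  | .load d a => s.set d (s.mem (s.mem a))
  | .store a b => s.set (s.mem a) (s.mem b)
  | .jump l => { s with pc := l }
  | .jumpZero a l => { s with pc := if s.mem a = 0 then l else s.pc + 1 }
  | .rows d => s.set d T.rows
  | .cols d => s.set d T.cols
  | .entry d a b => s.set d (T.entry (s.mem a) (s.mem b))
  | .write a => { s with pc := s.pc + 1, cur := s.cur ++ [s.mem a] }
  | .emit => { s with pc := s.pc + 1, cur := [], out := s.out ++ [s.cur] }

namespace Program

/-- The program has halted when its program counter points outside of the program. -/
def Halted (P : Program) (s : Configuration) : Prop := P.length ≤ s.pc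

/-- One unit of time; a halted program stays as it is. -/
def step (P : Program) (T : InputTable) (s : Configuration) : Configuration :=
  match P[s.pc]? with
  | none => s
  | some i => i.exec T s

/-- The configuration of `P` on input `T` after `t` units of time. -/
def run (P : Program) (T : InputTable) (t : ℕ) : Configuration :=
  (P.step T)^[t] Configuration.initial

end Program

/-- The list `l` of numbers consists of the elements of `S`, each written once. -/
def IsListing {n : ℕ} (l : List ℕ) (S : Finset (Fin n)) : Prop :=
  l.Nodup ∧ ∀ v : ℕ, v ∈ l ↔ ∃ x ∈ S, (x : ℕ) = v

namespace Program

/-- `P` halts on input `T`, and its output is the list of the members of the family `F`, each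
output exactly once. -/
def Enumerates {n : ℕ} (P : Program) (T : InputTable) (F : Set (Finset (Fin n))) : Prop :=
  ∃ t, P.Halted (P.run T t) ∧ ∃ L : List (Finset (Fin n)),
    L.Nodup ∧ (∀ S, S ∈ L ↔ S ∈ F) ∧ List.Forall₂ IsListing (P.run T t).out L

/-- After a preprocessing phase of `p` units of time, in which nothing is output, the times until
the first output, between two consecutive outputs, and between the last output and the halting of
the program are at most `d`. -/
def HasDelay (P : Program) (T : InputTable) (p d : ℕ) : Prop :=
  (P.run T p).out = [] ∧ ∀ t, p ≤ t →
    P.Halted (P.run T (t + d)) ∨ (P.run T t).out.length < (P.run T (t + d)).out.length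

/-- On input `T` the program uses only the first `s` memory cells (all others keep their initial
value `0`), and these hold words of at most about `c * log₂ (N + s + 2)` bits. Here `N` stands for
the size of the instance, so that the word length is logarithmic in the instance size and the
size of the memory. -/
def HasSpace (P : Program) (T : InputTable) (N c s : ℕ) : Prop :=
  ∀ t a, (P.run T t).mem a ≤ (N + s + 2) ^ c ∧ ((P.run T t).mem a ≠ 0 → a < s)

end Program

/-! ### Instances as inputs -/

/-- The hypergraph with vertices `0, …, n - 1` and edges `e 0, …, e (m - 1)` as an input: the
incidence matrix with one row for each edge and one column for each vertex. -/
def hypergraphInput {n m : ℕ} (e : Fin m → Finset (Fin n)) : InputTable where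
  rows := m
  cols := n
  entry i x := if ∃ (i' : Fin m) (x' : Fin n), (i' : ℕ) = i ∧ (x' : ℕ) = x ∧ x' ∈ e i'
    then 1 else 0

/-- The implicational base on `0, …, n - 1` with implications `σ 0, …, σ (m - 1)` as an input: row
`i` holds the characteristic vector of the premise of `σ i` in columns `0, …, n - 1`, and the
conclusion of `σ i` in column `n`. -/
def baseInput {n m : ℕ} (σ : Fin m → Implication (Fin n)) : InputTable where
  rows := m
  cols := n + 1
  entry i x := if h : i < m then
      if x = n then ((σ ⟨i, h⟩).conclusion : ℕ)
      else if ∃ x' : Fin n, (x' : ℕ) = x ∧ x' ∈ (σ ⟨i, h⟩).premise then 1 else 0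
    else 0

/-! ### Complexity of the two enumeration problems -/

/-- `P` enumerates the maximal independent sets of every hypergraph `H` with delay `f |H|` (without
preprocessing) and space `g |H|`, where `|H|` is the number of vertices plus the number of edges. -/
def EnumeratesMIS (P : Program) (f g : ℕ → ℕ) : Prop :=
  ∃ c : ℕ, ∀ (n m : ℕ) (e : Fin m → Finset (Fin n)), Function.Injective e →
    P.Enumerates (hypergraphInput e) (maximalIndependentSets (Set.range e)) ∧
    P.HasDelay (hypergraphInput e) 0 (f (n + m)) ∧
    P.HasSpace (hypergraphInput e) (n + m) c (g (n + m))

/-- The instances: a listing without repetition of a ranked implicational base on a nonempty ground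
set in which the empty set is closed. This is the case of a standard closure space, as the other
condition `φ({x}) \ {x}` closed holds in every ranked implicational base. -/
structure IsRankedInstance {n m : ℕ} (σ : Fin m → Implication (Fin n)) : Prop where
  nonempty : 0 < n
  injective : Function.Injective σ
  ranked : IsRanked (Set.range σ)
  standard : IsClosedIn (Set.range σ) ∅

/-- `Q` enumerates the meet-irreducible elements of the closure system of every ranked implicational
base `(X, Σ)` with delay `O(|X| * f (|X| + |Σ|))`, space `O(|X| * g (|X| + |Σ|))` and after
`O(|X| * |Σ|)` preprocessing time. -/
def EnumeratesMeetIrreducibles (Q : Program) (f g : ℕ → ℕ) : Prop :=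
  ∃ C c : ℕ, ∀ (n m : ℕ) (σ : Fin m → Implication (Fin n)), IsRankedInstance σ →
    Q.Enumerates (baseInput σ) (meetIrreducibles (Set.range σ)) ∧
    (∃ p ≤ C * (n * m), Q.HasDelay (baseInput σ) p (C * (n * f (n + m)))) ∧
    Q.HasSpace (baseInput σ) (n + m) c (C * (n * g (n + m)))

/-- `F` is bounded by a quasi-polynomial `2 ^ polylog`. -/
def IsQuasiPolynomial (F : ℕ → ℕ) : Prop :=
  ∃ c : ℕ, ∀ N, F N ≤ 2 ^ (c * Nat.log 2 (N + 2) ^ c)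

/-- `P` enumerates the maximal independent sets of every hypergraph in total time and space
quasi-polynomial in the combined size `N` of the hypergraph and the family of solutions. -/
def EnumeratesMISInQuasiPolynomialTime (P : Program) : Prop :=
  ∃ F : ℕ → ℕ, IsQuasiPolynomial F ∧
    ∃ c : ℕ, ∀ (n m : ℕ) (e : Fin m → Finset (Fin n)), Function.Injective e →
      ∀ N, N = n + m + (maximalIndependentSets (Set.range e)).ncard →
        P.Enumerates (hypergraphInput e) (maximalIndependentSets (Set.range e)) ∧
        P.Halted (P.run (hypergraphInput e) (F N)) ∧
        P.HasSpace (hypergraphInput e) N c (F N)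

/-- `Q` enumerates the meet-irreducible elements of the closure system of every ranked implicational
base in total time and space quasi-polynomial in the combined size `N` of the base and the family
of solutions. -/
def EnumeratesMeetIrreduciblesInQuasiPolynomialTime (Q : Program) : Prop :=
  ∃ F : ℕ → ℕ, IsQuasiPolynomial F ∧
    ∃ c : ℕ, ∀ (n m : ℕ) (σ : Fin m → Implication (Fin n)), IsRankedInstance σ →
      ∀ N, N = n + m + (meetIrreducibles (Set.range σ)).ncard →
        Q.Enumerates (baseInput σ) (meetIrreducibles (Set.range σ)) ∧
        Q.Halted (Q.run (baseInput σ) (F N)) ∧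
        Q.HasSpace (baseInput σ) N c (F N)

/-! A closed set is meet-irreducible exactly when it is maximal among the closed sets avoiding some
element `x` (`mem_meetIrreducibles_iff`). In a ranked base the complement of such a set can be
chosen rank by rank. Start with `Y = {x}`. If `Y` is the part of the complement on one rank, a
closed set disjoint from `Y` contains no premise of an implication with conclusion in `Y`; so choose
a maximal independent set `S` of the hypergraph of these premises and continue with `Sᶜ`. Every
vertex outside `S` lies on an edge and therefore has the next rank, so the choices on different
levels do not interfere (`PartialComplement.step`). A nonempty `Y` always consists of new elements,
hence after `|X|` levels `Y` is empty, and what was never chosen is a maximal closed set avoiding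
`x` (`PartialComplement.maximal_compl`). Every such set arises (`mem_completions_of_maximal`), and
only once, since ranks allow the root and all the choices to be read off from it
(`eq_of_mem_completions`, `nodup_meetIrreducibleList`). There are no dead ends, because `∅` is
closed and so no edge is empty.

The enumeration is thus a depth-first search in a forest whose leaves all have depth `|X|`, the
children of each node being listed by a copy of the given program `P`, one copy per level. Between
two outputs there are `O(|X|)` events, each costing one delay of `P` and linear extra time;
`Pending` carries the remaining output together with a bound on the number of events before the next
output. The rank function occurs only in the correctness proof, never in the program.

On a random access machine this needs some care. A level is entered again and again, so the memory
of its copy of `P` has to be reset in constant time: this is done by lazy initialization (`BankOk`).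
The space needed is not known to the program, so the arrays of all levels are interleaved
(`arrCell`). `P` is only assumed to work for hypergraphs without repeated edges, so equal premises
are identified beforehand by partition refinement (`wp_refineCmd`), after which each hypergraph is
listed in linear time. Only row numbers of edges are stored, the entries being looked up in the
input (`subTable_of_edg`). All this is written in a small structured language with a clock, verified
by weakest preconditions and compiled (`Exec.reach`).

For the quasi-polynomial statement, distinct maximal independent sets met at one node have distinct
completions, so each hypergraph met has at most as many maximal independent sets as there are
meet-irreducible elements (`ncard_maximalIndependentSets_le`). Each single run is then
quasi-polynomial in the required size, and its total time serves as a delay. -/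

set_option linter.unusedSimpArgs false
set_option linter.unusedSectionVars false

/-! ### A structured language on top of random access machines -/

namespace Ram

/-- The registers of structured programs. -/
inductive Reg where
  | zero | num | rowNum | lev | nxt | vert | active | event | busy | pc | npc
  | r0 | r1 | r2 | r3 | r4 | r5 | r6 | r7 | r8 | r9
  deriving DecidableEq

/-- The arrays of structured programs. -/
inductive Arr where
  | val | idx | lst | out | acc | edg | pcs | cnt | siz | rep | tab | seen
  deriving DecidableEq

def Reg.index : Reg → ℕ
  | .zero => 0 | .num => 1 | .rowNum => 2 | .lev => 3 | .nxt => 4 | .vert => 5 | .active => 6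
  | .event => 7 | .busy => 8 | .pc => 9 | .npc => 10 | .r0 => 11 | .r1 => 12 | .r2 => 13
  | .r3 => 14 | .r4 => 15 | .r5 => 16 | .r6 => 17 | .r7 => 18 | .r8 => 19 | .r9 => 20

def Arr.index : Arr → ℕ
  | .val => 0 | .idx => 1 | .lst => 2 | .out => 3 | .acc => 4 | .edg => 5 | .pcs => 6
  | .cnt => 7 | .siz => 8 | .rep => 9 | .tab => 10 | .seen => 11

theorem Reg.index_lt (r : Reg) : r.index < 21 := by cases r <;> decide
theorem Arr.index_lt (A : Arr) : A.index < 12 := by cases A <;> decide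
theorem Reg.index_injective : Function.Injective Reg.index := by
  intro a b h
  cases a <;> cases b <;> first | rfl | exact absurd h (by decide)
theorem Arr.index_injective : Function.Injective Arr.index := by
  intro a b h
  cases a <;> cases b <;> first | rfl | exact absurd h (by decide)

/-- The cell of a register. Cells `0` and `1` are used for address computations. -/
def regCell (r : Reg) : ℕ := 2 + r.index

/-- The cell of entry `i` of the array `A` of level `k`, where there are `w` levels. -/
def arrCell (w : ℕ) (A : Arr) (k i : ℕ) : ℕ := (i * w + k) * 12 + (23 + A.index)

theorem regCell_injective : Function.Injective regCell := fun a b h =>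
  Reg.index_injective (by unfold regCell at h; omega)

/-- An address is a number in mixed radix with digits array, level and index; the first two digits
are bounded by `12` and `w`, and the index, as the leading digit, is unbounded. -/
theorem arrCell_inj {w : ℕ} {A B : Arr} {k l i j : ℕ} (hk : k < w) (hl : l < w) :
    arrCell w A k i = arrCell w B l j ↔ A = B ∧ k = l ∧ i = j := by
  constructor
  · intro h
    unfold arrCell at h
    have hA := A.index_lt
    have hB := B.index_lt
    have h1 : A.index = B.index := by omega
    have h2 : i * w + k = j * w + l := by omega
    have h3 : k = l := by
      have := congrArg (· % w) h2
      simpa [Nat.mod_eq_of_lt hk, Nat.mod_eq_of_lt hl] using this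
    subst h3
    have h4 : i * w = j * w := by omega
    exact ⟨Arr.index_injective h1, rfl, Nat.eq_of_mul_eq_mul_right (by omega) h4⟩
  · rintro ⟨rfl, rfl, rfl⟩; rfl

theorem regCell_ne_arrCell (r : Reg) (w : ℕ) (A : Arr) (k i : ℕ) :
    regCell r ≠ arrCell w A k i := by
  have := r.index_lt
  unfold regCell arrCell
  omega

/-- The states of structured programs, with a clock. -/
structure State where
  reg : Reg → ℕ
  arr : Arr → ℕ → ℕ → ℕ
  cur : List ℕ
  out : List (List ℕ)
  time : ℕ

namespace State

def initial : State := ⟨fun _ => 0, fun _ _ _ => 0, [], [], 0⟩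

def tick (s : State) (t : ℕ) : State := { s with time := s.time + t }

def setReg (s : State) (d : Reg) (v t : ℕ) : State :=
  { s with reg := Function.update s.reg d v, time := s.time + t }

def setArr (s : State) (A : Arr) (k i v t : ℕ) : State :=
  { s with
    arr := fun B l j => if B = A ∧ l = k ∧ j = i then v else s.arr B l j
    time := s.time + t }

end State

/-- Basic commands. -/
inductive Basic where
  | const (d : Reg) (c : ℕ)
  | arith (o : ArithOp) (d a b : Reg)
  | arithConst (o : ArithOp) (d a : Reg) (c : ℕ)
  | get (A : Arr) (d k i : Reg)
  | put (A : Arr) (k i v : Reg)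
  | rows (d : Reg)
  | cols (d : Reg)
  | entry (d a b : Reg)
  | write (a : Reg)
  | emit

namespace Basic

def exec (T : InputTable) (s : State) : Basic → State
  | const d c => s.setReg d c 1
  | arith o d a b => s.setReg d (o.eval (s.reg a) (s.reg b)) 1
  | arithConst o d a c => s.setReg d (o.eval (s.reg a) c) 2
  | get A d k i => s.setReg d (s.arr A (s.reg k) (s.reg i)) 8
  | put A k i v => s.setArr A (s.reg k) (s.reg i) (s.reg v) 8
  | rows d => s.setReg d T.rows 1
  | cols d => s.setReg d T.cols 1
  | entry d a b => s.setReg d (T.entry (s.reg a) (s.reg b)) 1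
  | write a => { s with cur := s.cur ++ [s.reg a], time := s.time + 1 }
  | emit => { s with cur := [], out := s.out ++ [s.cur], time := s.time + 1 }

/-- The command respects the bound `W` on words and the bound `R` on the lengths of arrays. -/
def Ok (T : InputTable) (W R : ℕ) (s : State) : Basic → Prop
  | const _ c => c ≤ W
  | arith o _ a b => o.eval (s.reg a) (s.reg b) ≤ s.reg a ∨ o.eval (s.reg a) (s.reg b) ≤ W
  | arithConst o _ a c => c ≤ W ∧ (o.eval (s.reg a) c ≤ s.reg a ∨ o.eval (s.reg a) c ≤ W)
  | get _ _ k _ => s.reg k < T.cols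
  | put _ k i v => s.reg k < T.cols ∧ (s.reg i < R ∨ s.reg v = 0)
  | rows _ => T.rows ≤ W
  | cols _ => T.cols ≤ W
  | entry _ a b => T.entry (s.reg a) (s.reg b) ≤ W
  | write _ => True
  | emit => True

/-- Compute the address of entry `i` of the array `A` of level `k` in cell `0`. -/
def addressCode (A : Arr) (k i : Reg) : List Instr :=
  [.cols 1, .arith .mul 0 (regCell i) 1, .arith .add 0 0 (regCell k), .const 1 12,
    .arith .mul 0 0 1, .const 1 (23 + A.index), .arith .add 0 0 1]

def code : Basic → List Instr
  | const d c => [.const (regCell d) c]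
  | arith o d a b => [.arith o (regCell d) (regCell a) (regCell b)]
  | arithConst o d a c => [.const 1 c, .arith o (regCell d) (regCell a) 1]
  | get A d k i => addressCode A k i ++ [.load (regCell d) 0]
  | put A k i v => addressCode A k i ++ [.store 0 (regCell v)]
  | rows d => [.rows (regCell d)]
  | cols d => [.cols (regCell d)]
  | entry d a b => [.entry (regCell d) (regCell a) (regCell b)]
  | write a => [.write (regCell a)]
  | emit => [.emit]

end Basic

/-- Structured commands. -/
inductive Cmd where
  | skip
  | basic (i : Basic)
  | seq (a b : Cmd)
  /-- run `a` if the register is `0`, otherwise run `b` -/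
  | ifZero (r : Reg) (a b : Cmd)
  /-- run `a` as long as the register is not `0` -/
  | loop (r : Reg) (a : Cmd)

namespace Cmd

def size : Cmd → ℕ
  | skip => 0
  | basic i => i.code.length
  | seq a b => a.size + b.size
  | ifZero _ a b => b.size + a.size + 2
  | loop _ a => a.size + 2

def compile : ℕ → Cmd → List Instr
  | _, skip => []
  | _, basic i => i.code
  | l, seq a b => compile l a ++ compile (l + a.size) b
  | l, ifZero r a b =>
    .jumpZero (regCell r) (l + b.size + 2) :: (compile (l + 1) b ++
      .jump (l + b.size + 2 + a.size) :: compile (l + b.size + 2) a)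
  | l, loop r a =>
    .jumpZero (regCell r) (l + a.size + 2) :: (compile (l + 1) a ++ [.jump l])

theorem length_compile (c : Cmd) : ∀ l, (c.compile l).length = c.size := by
  induction c with
  | skip => intro; rfl
  | basic i => intro; rfl
  | seq a b ha hb => intro l; simp [compile, size, ha, hb]
  | ifZero r a b ha hb => intro l; simp [compile, size, ha, hb]; omega
  | loop r a ha => intro l; simp [compile, size, ha]

end Cmd

/-- Big-step execution that respects the bounds `W` and `R`. -/
inductive Exec (T : InputTable) (W R : ℕ) : Cmd → State → State → Prop
  | skip (s) : Exec T W R .skip s s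
  | basic {i s} (h : i.Ok T W R s) : Exec T W R (.basic i) s (i.exec T s)
  | seq {a b s s' s''} (h : Exec T W R a s s') (h' : Exec T W R b s' s'') :
      Exec T W R (.seq a b) s s''
  | ifZero {r a b s s'} (hr : s.reg r = 0) (h : Exec T W R a (s.tick 1) s') :
      Exec T W R (.ifZero r a b) s s'
  | ifPos {r a b s s'} (hr : s.reg r ≠ 0) (h : Exec T W R b (s.tick 1) s') :
      Exec T W R (.ifZero r a b) s (s'.tick 1)
  | loopEnd {r a s} (hr : s.reg r = 0) : Exec T W R (.loop r a) s (s.tick 1)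
  | loopStep {r a s s' s''} (hr : s.reg r ≠ 0) (h : Exec T W R a (s.tick 1) s')
      (h' : Exec T W R (.loop r a) (s'.tick 1) s'') : Exec T W R (.loop r a) s s''

/-! ### Correctness of compilation -/

/-- The code `l` occurs in the program `Q` from line `p` on. -/
def CodeAt (Q : Program) (p : ℕ) (l : List Instr) : Prop :=
  ∀ j, j < l.length → Q[p + j]? = l[j]?

theorem CodeAt.left {Q : Program} {p : ℕ} {l l' : List Instr} (h : CodeAt Q p (l ++ l')) :
    CodeAt Q p l := by
  intro j hj
  rw [h j (by simp; omega), List.getElem?_append_left hj]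

theorem CodeAt.right {Q : Program} {p : ℕ} {l l' : List Instr} (h : CodeAt Q p (l ++ l')) :
    CodeAt Q (p + l.length) l' := by
  intro j hj
  rw [add_assoc, h (l.length + j) (by simp; omega), List.getElem?_append_right (by omega)]
  simp

theorem CodeAt.head {Q : Program} {p : ℕ} {i : Instr} {l : List Instr} (h : CodeAt Q p (i :: l)) :
    Q[p]? = some i := by
  simpa using h 0 (by simp)

theorem CodeAt.tail {Q : Program} {p : ℕ} {i : Instr} {l : List Instr} (h : CodeAt Q p (i :: l)) :
    CodeAt Q (p + 1) l :=
  CodeAt.right (l := [i]) h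

/-- The cells from `S` on are `0`, and no cell exceeds `V`. -/
def MemBound (V S : ℕ) (m : ℕ → ℕ) : Prop := ∀ a, m a ≤ V ∧ (m a ≠ 0 → a < S)

theorem MemBound.update {V S : ℕ} {m : ℕ → ℕ} (h : MemBound V S m) {d v : ℕ} (hv : v ≤ V)
    (hd : v ≠ 0 → d < S) : MemBound V S (Function.update m d v) := by
  intro a
  by_cases hda : a = d
  · subst hda; simpa using ⟨hv, hd⟩
  · simpa [hda] using h a

/-- `Q` gets from `c` to `c'` in `t` steps, and all configurations on the way are bounded. -/
def Reach (Q : Program) (T : InputTable) (V S : ℕ) (c c' : Configuration) (t : ℕ) : Prop :=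
  (Q.step T)^[t] c = c' ∧ ∀ u ≤ t, MemBound V S ((Q.step T)^[u] c).mem

section
variable {Q : Program} {T : InputTable} {V S : ℕ}

theorem Reach.refl {c : Configuration} (h : MemBound V S c.mem) : Reach Q T V S c c 0 :=
  ⟨rfl, fun u hu => by obtain rfl : u = 0 := by omega
                       exact h⟩

theorem Reach.trans {c c' c'' : Configuration} {t t' : ℕ} (h : Reach Q T V S c c' t)
    (h' : Reach Q T V S c' c'' t') : Reach Q T V S c c'' (t + t') := by
  refine ⟨by rw [add_comm, Function.iterate_add_apply, h.1, h'.1], fun u hu => ?_⟩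
  rcases le_total u t with hut | hut
  · exact h.2 u hut
  · obtain ⟨v, rfl⟩ := Nat.exists_eq_add_of_le' hut
    rw [Function.iterate_add_apply, h.1]
    exact h'.2 v (by omega)

theorem Reach.right {c c' : Configuration} {t : ℕ} (h : Reach Q T V S c c' t) :
    MemBound V S c'.mem := h.1 ▸ h.2 t le_rfl

theorem Reach.single {c : Configuration} {i : Instr} (hi : Q[c.pc]? = some i)
    (h : MemBound V S c.mem) (h' : MemBound V S (i.exec T c).mem) :
    Reach Q T V S c (i.exec T c) 1 := by
  have hs : (Q.step T)^[1] c = i.exec T c := by simp [Program.step, hi]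
  refine ⟨hs, fun u hu => ?_⟩
  rcases Nat.le_one_iff_eq_zero_or_eq_one.1 hu with rfl | rfl
  · exact h
  · rw [hs]; exact h'

end

/-- The configuration `c` represents the state `s`. -/
structure Represents (w : ℕ) (c : Configuration) (s : State) : Prop where
  reg : ∀ r, c.mem (regCell r) = s.reg r
  arr : ∀ A k i, k < w → c.mem (arrCell w A k i) = s.arr A k i
  cur : c.cur = s.cur
  out : c.out = s.out

/-- The words of a state are at most `W`, and its arrays have length at most `R`. -/
structure State.Bounded (w W R : ℕ) (s : State) : Prop where
  reg : ∀ r, s.reg r ≤ W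
  arr : ∀ A k i, k < w → s.arr A k i ≤ W
  len : ∀ A k i, k < w → s.arr A k i ≠ 0 → i < R

/-- The bound on the words of the compiled program. -/
def wordBound (w W : ℕ) : ℕ := 35 + 12 * ((W + 1) * w)

/-- The bound on the space of the compiled program. -/
def spaceBound (w R : ℕ) : ℕ := 23 + 12 * (R * w)

/-- As the index is the leading digit, arrays of length `R` occupy an initial segment of the memory.
The compiled program never has to know `R`, which will depend on the space function of the given
program. -/
theorem arrCell_lt {w : ℕ} (A : Arr) {k i R : ℕ} (hk : k < w) (hi : i < R) :
    arrCell w A k i < spaceBound w R := by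
  have hA := A.index_lt
  have h1 : (i + 1) * w ≤ R * w := Nat.mul_le_mul_right _ hi
  have h2 : (i + 1) * w = i * w + w := by ring
  unfold arrCell spaceBound
  omega

theorem regCell_lt (w R : ℕ) (r : Reg) : regCell r < spaceBound w R := by
  have := r.index_lt
  unfold regCell spaceBound
  omega

theorem le_wordBound {w W : ℕ} (hw : 0 < w) : W ≤ wordBound w W := by
  have : W + 1 ≤ (W + 1) * w := Nat.le_mul_of_pos_right _ hw
  unfold wordBound
  omega

section
variable {Q : Program} {T : InputTable} {W R : ℕ}

local notation "Bd" => MemBound (wordBound T.cols W) (spaceBound T.cols R)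
local notation "Rch" => Reach Q T (wordBound T.cols W) (spaceBound T.cols R)

theorem represents_setReg {c : Configuration} {s : State} (h : Represents T.cols c s)
    (hs : s.Bounded T.cols W R) (hb : Bd c.mem) {d : Reg} {v : ℕ} (t : ℕ) (hv : v ≤ W)
    (hw : 0 < T.cols) :
    Represents T.cols (c.set (regCell d) v) (s.setReg d v t) ∧
      (s.setReg d v t).Bounded T.cols W R ∧ Bd (c.set (regCell d) v).mem := by
  refine ⟨⟨fun r => ?_, fun A k i hk => ?_, h.cur, h.out⟩, ⟨fun r => ?_, hs.arr, hs.len⟩,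
    hb.update (hv.trans (le_wordBound hw)) fun _ => regCell_lt _ _ _⟩
  · by_cases hr : r = d
    · subst hr; simp [Configuration.set, State.setReg]
    · simp [Configuration.set, State.setReg, hr, regCell_injective.ne hr, h.reg]
  · simp [Configuration.set, State.setReg, (regCell_ne_arrCell d T.cols A k i).symm, h.arr _ _ _ hk]
  · by_cases hr : r = d
    · subst hr; simpa [State.setReg] using hv
    · simpa [State.setReg, hr] using hs.reg r

theorem represents_temp {c : Configuration} {s : State} (h : Represents T.cols c s)
    {d v : ℕ} (hd : d < 2) : Represents T.cols (c.set d v) s := by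
  refine ⟨fun r => ?_, fun A k i hk => ?_, h.cur, h.out⟩
  · have : regCell r ≠ d := by unfold regCell; omega
    simp [Configuration.set, this, h.reg]
  · have : arrCell T.cols A k i ≠ d := by unfold arrCell; omega
    simp [Configuration.set, this, h.arr _ _ _ hk]

theorem memBound_temp {c : Configuration} (hb : Bd c.mem) {d v : ℕ} (hd : d < 2)
    (hv : v ≤ wordBound T.cols W) : Bd (c.set d v).mem :=
  hb.update hv fun _ => by unfold spaceBound; omega

theorem reach_temp {c : Configuration} {s : State} (h : Represents T.cols c s) (hb : Bd c.mem)
    {i : Instr} {d v : ℕ} (hi : Q[c.pc]? = some i) (he : i.exec T c = c.set d v) (hd : d < 2)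
    (hv : v ≤ wordBound T.cols W) :
    Rch c (c.set d v) 1 ∧ Represents T.cols (c.set d v) s ∧ Bd (c.set d v).mem := by
  refine ⟨?_, represents_temp h hd, memBound_temp hb hd hv⟩
  rw [← he]
  exact Reach.single hi hb (he ▸ memBound_temp hb hd hv)

/-- The index is bounded by the word bound `W`, not by the array length `R`: an array may be read
anywhere. This is why `wordBound` is computed from `W` and `spaceBound` from `R`. -/
theorem reach_addressCode {c : Configuration} {s : State} (h : Represents T.cols c s)
    (hs : s.Bounded T.cols W R) (hb : Bd c.mem) {A : Arr} {k i : Reg}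
    (hc : CodeAt Q c.pc (Basic.addressCode A k i)) (hk : s.reg k < T.cols) :
    ∃ c', Rch c c' 7 ∧ Represents T.cols c' s ∧ Bd c'.mem ∧ c'.pc = c.pc + 7 ∧
      c'.mem 0 = arrCell T.cols A (s.reg k) (s.reg i) := by
  have hA := A.index_lt
  have hi := hs.reg i
  have h1 : s.reg i * T.cols ≤ W * T.cols := Nat.mul_le_mul_right _ hi
  have h2 : (W + 1) * T.cols = W * T.cols + T.cols := by ring
  have hV : wordBound T.cols W = 35 + 12 * (W * T.cols + T.cols) := by rw [← h2]; rfl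
  have reg1 : ∀ r, regCell r ≠ 1 := fun r => by unfold regCell; omega
  have reg0 : ∀ r, regCell r ≠ 0 := fun r => by unfold regCell; omega
  unfold Basic.addressCode at hc
  obtain ⟨a1, b1, d1⟩ := reach_temp (R := R) (W := W) h hb (d := 1) (v := T.cols) hc.head rfl
    (by omega) (by omega)
  obtain ⟨a2, b2, d2⟩ := reach_temp (R := R) (W := W) b1 d1 (d := 0) (v := s.reg i * T.cols)
    hc.tail.head
    (by simp [Instr.exec, ArithOp.eval, Configuration.set, h.reg, reg1]) (by omega) (by omega)
  obtain ⟨a3, b3, d3⟩ := reach_temp (R := R) (W := W) b2 d2 (d := 0)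
    (v := s.reg i * T.cols + s.reg k) hc.tail.tail.head
    (by simp [Instr.exec, ArithOp.eval, Configuration.set, h.reg, reg1, reg0])
    (by omega) (by omega)
  obtain ⟨a4, b4, d4⟩ := reach_temp (R := R) (W := W) b3 d3 (d := 1) (v := 12)
    hc.tail.tail.tail.head rfl (by omega) (by omega)
  obtain ⟨a5, b5, d5⟩ := reach_temp (R := R) (W := W) b4 d4 (d := 0)
    (v := (s.reg i * T.cols + s.reg k) * 12) hc.tail.tail.tail.tail.head
    (by simp [Instr.exec, ArithOp.eval, Configuration.set]) (by omega) (by omega)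
  obtain ⟨a6, b6, d6⟩ := reach_temp (R := R) (W := W) b5 d5 (d := 1) (v := 23 + A.index)
    hc.tail.tail.tail.tail.tail.head rfl (by omega) (by omega)
  obtain ⟨a7, b7, d7⟩ := reach_temp (R := R) (W := W) b6 d6 (d := 0)
    (v := (s.reg i * T.cols + s.reg k) * 12 + (23 + A.index)) hc.tail.tail.tail.tail.tail.tail.head
    (by simp [Instr.exec, ArithOp.eval, Configuration.set]) (by omega) (by omega)
  exact ⟨_, ((((((a1.trans a2).trans a3).trans a4).trans a5).trans a6).trans a7), b7, d7, rfl,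
    by simp [Configuration.set, arrCell]⟩

theorem reach_setReg {c : Configuration} {s : State} (h : Represents T.cols c s)
    (hs : s.Bounded T.cols W R) (hb : Bd c.mem) (hw : 0 < T.cols) {i : Instr} {d : Reg} {v : ℕ}
    (t : ℕ) (hi : Q[c.pc]? = some i) (he : i.exec T c = c.set (regCell d) v) (hv : v ≤ W) :
    Rch c (c.set (regCell d) v) 1 ∧ Represents T.cols (c.set (regCell d) v) (s.setReg d v t) ∧
      (s.setReg d v t).Bounded T.cols W R := by
  obtain ⟨h1, h2, h3⟩ := represents_setReg h hs hb t hv hw (d := d)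
  refine ⟨?_, h1, h2⟩
  rw [← he]
  exact Reach.single hi hb (he ▸ h3)

theorem arith_le {s : State} (hs : s.Bounded T.cols W R) {a : Reg} {v : ℕ}
    (h : v ≤ s.reg a ∨ v ≤ W) : v ≤ W :=
  h.elim (fun h => h.trans (hs.reg a)) id

theorem reach_basic {b : Basic} {s : State} {c : Configuration} (h : Represents T.cols c s)
    (hs : s.Bounded T.cols W R) (hb : Bd c.mem) (hw : 0 < T.cols) (hok : b.Ok T W R s)
    (hc : CodeAt Q c.pc b.code) :
    ∃ c', Rch c c' ((b.exec T s).time - s.time) ∧ Represents T.cols c' (b.exec T s) ∧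
      (b.exec T s).Bounded T.cols W R ∧ c'.pc = c.pc + b.code.length ∧
      s.time ≤ (b.exec T s).time := by
  cases b with
  | const d v =>
    obtain ⟨h1, h2, h3⟩ := reach_setReg h hs hb hw 1 hc.head rfl hok
    exact ⟨_, by simpa [Basic.exec, State.setReg] using h1, h2, h3, rfl, by
      simp [Basic.exec, State.setReg]⟩
  | arith o d x y =>
    obtain ⟨h1, h2, h3⟩ := reach_setReg h hs hb hw 1 hc.head (d := d)
      (v := o.eval (s.reg x) (s.reg y))
      (by simp [Instr.exec, h.reg]) (arith_le hs hok)
    exact ⟨_, by simpa [Basic.exec, State.setReg] using h1, h2, h3, rfl, by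
      simp [Basic.exec, State.setReg]⟩
  | arithConst o d x v =>
    obtain ⟨a1, b1, d1⟩ := reach_temp (R := R) (W := W) h hb (d := 1) (v := v) hc.head rfl
      (by omega) (hok.1.trans (le_wordBound hw))
    obtain ⟨h1, h2, h3⟩ := reach_setReg b1 hs d1 hw 2 hc.tail.head (d := d)
      (v := o.eval (s.reg x) v)
      (by
        have : regCell x ≠ 1 := by unfold regCell; omega
        simp [Instr.exec, h.reg, Configuration.set, this])
      (arith_le hs hok.2)
    exact ⟨_, by simpa [Basic.exec, State.setReg] using a1.trans h1, h2, h3, rfl, by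
      simp [Basic.exec, State.setReg]⟩
  | get A d k i =>
    obtain ⟨c', a1, b1, d1, e1, f1⟩ := reach_addressCode h hs hb hc.left hok
    obtain ⟨h1, h2, h3⟩ := reach_setReg b1 hs d1 hw 8 (i := .load (regCell d) 0)
      (by rw [e1]; exact hc.right.head) (d := d) (v := s.arr A (s.reg k) (s.reg i))
      (by simp [Instr.exec, f1, b1.arr _ _ _ hok]) (hs.arr _ _ _ hok)
    exact ⟨_, by simpa [Basic.exec, State.setReg] using a1.trans h1, h2, h3,
      by simp [Configuration.set, e1]; rfl, by simp [Basic.exec, State.setReg]⟩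
  | put A k i v =>
    obtain ⟨hok, hiv⟩ := hok
    obtain ⟨c', a1, b1, d1, e1, f1⟩ := reach_addressCode h hs hb hc.left hok
    have he : (Instr.store 0 (regCell v)).exec T c' =
        c'.set (arrCell T.cols A (s.reg k) (s.reg i)) (s.reg v) := by
      simp [Instr.exec, f1, b1.reg]
    -- Writing `0` is allowed at any index, as only nonzero cells count as used space.
    have hb' : Bd (c'.set (arrCell T.cols A (s.reg k) (s.reg i)) (s.reg v)).mem :=
      d1.update ((hs.reg v).trans (le_wordBound hw)) fun hv => arrCell_lt _ hok (by tauto)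
    have h1 := Reach.single (T := T) (i := .store 0 (regCell v))
      (by rw [e1]; exact hc.right.head) d1 (he ▸ hb')
    rw [he] at h1
    refine ⟨c'.set (arrCell T.cols A (s.reg k) (s.reg i)) (s.reg v),
      by simpa [Basic.exec, State.setArr] using a1.trans h1,
      ⟨fun r => ?_, fun B l j hl => ?_, b1.cur, b1.out⟩,
      ⟨hs.reg, fun B l j hl => ?_, fun B l j hl => ?_⟩,
      by simp [Configuration.set, e1]; rfl, by simp [Basic.exec, State.setArr]⟩
    · simp [Configuration.set, Basic.exec, State.setArr, regCell_ne_arrCell, b1.reg]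
    · simp only [Configuration.set, Basic.exec, State.setArr, Function.update_apply,
        arrCell_inj hl hok, b1.arr _ _ _ hl]
    · simp only [Basic.exec, State.setArr]
      split_ifs
      · exact hs.reg v
      · exact hs.arr _ _ _ hl
    · simp only [Basic.exec, State.setArr]
      split_ifs with hh
      · obtain ⟨rfl, rfl, rfl⟩ := hh
        intro hv
        tauto
      · exact hs.len _ _ _ hl
  | rows d =>
    obtain ⟨h1, h2, h3⟩ := reach_setReg h hs hb hw 1 hc.head rfl hok
    exact ⟨_, by simpa [Basic.exec, State.setReg] using h1, h2, h3, rfl, by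
      simp [Basic.exec, State.setReg]⟩
  | cols d =>
    obtain ⟨h1, h2, h3⟩ := reach_setReg h hs hb hw 1 hc.head rfl hok
    exact ⟨_, by simpa [Basic.exec, State.setReg] using h1, h2, h3, rfl, by
      simp [Basic.exec, State.setReg]⟩
  | entry d x y =>
    obtain ⟨h1, h2, h3⟩ := reach_setReg h hs hb hw 1 hc.head (d := d)
      (v := T.entry (s.reg x) (s.reg y)) (by simp [Instr.exec, h.reg]) hok
    exact ⟨_, by simpa [Basic.exec, State.setReg] using h1, h2, h3, rfl, by
      simp [Basic.exec, State.setReg]⟩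
  | write x =>
    exact ⟨(Instr.write (regCell x)).exec T c,
      by simpa [Basic.exec] using Reach.single (T := T) hc.head hb hb,
      ⟨h.reg, h.arr, by simp [Instr.exec, Basic.exec, h.reg, h.cur], h.out⟩,
      ⟨hs.reg, hs.arr, hs.len⟩, rfl, by simp [Basic.exec]⟩
  | emit =>
    exact ⟨Instr.emit.exec T c,
      by simpa [Basic.exec] using Reach.single (T := T) hc.head hb hb,
      ⟨h.reg, h.arr, rfl, by simp [Instr.exec, Basic.exec, h.out, h.cur]⟩,
      ⟨hs.reg, hs.arr, hs.len⟩, rfl, by simp [Basic.exec]⟩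

theorem Represents.tick {w : ℕ} {c : Configuration} {s : State} (h : Represents w c s) (t p : ℕ) :
    Represents w { c with pc := p } (s.tick t) := ⟨h.reg, h.arr, h.cur, h.out⟩

theorem State.Bounded.tick {w : ℕ} {s : State} (h : s.Bounded w W R) (t : ℕ) :
    (s.tick t).Bounded w W R := ⟨h.reg, h.arr, h.len⟩

/-- The clock of the structured language counts exactly the machine instructions, including the
jumps produced by conditionals and loops, so the difference of clocks is the number of steps. The
memory bound is carried through all intermediate configurations, since the space requirement refers
to every moment of the run. -/
theorem Exec.reach {a : Cmd} {s s' : State} (hex : Exec T W R a s s') (hw : 0 < T.cols) :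
    ∀ c : Configuration, Represents T.cols c s → s.Bounded T.cols W R → Bd c.mem →
      CodeAt Q c.pc (a.compile c.pc) →
      ∃ c', Rch c c' (s'.time - s.time) ∧ Represents T.cols c' s' ∧ s'.Bounded T.cols W R ∧
        c'.pc = c.pc + a.size ∧ s.time ≤ s'.time := by
  induction hex with
  | skip s => intro c h hs hb hc; exact ⟨c, by simpa using Reach.refl hb, h, hs, rfl, le_rfl⟩
  | basic hok => intro c h hs hb hc; exact reach_basic h hs hb hw hok hc
  | @seq a b s s' s'' _ _ ih1 ih2 =>
    intro c h hs hb hc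
    obtain ⟨c1, r1, h1, hs1, p1, t1⟩ := ih1 c h hs hb hc.left
    have hc2 := hc.right
    rw [Cmd.length_compile] at hc2
    obtain ⟨c2, r2, h2, hs2, p2, t2⟩ := ih2 c1 h1 hs1 r1.right (by rw [p1]; exact hc2)
    refine ⟨c2, ?_, h2, hs2, by rw [p2, p1, Cmd.size, add_assoc], t1.trans t2⟩
    have := r1.trans r2
    rwa [show s'.time - s.time + (s''.time - s'.time) = s''.time - s.time by omega] at this
  | @ifZero r a b s s' hr _ ih =>
    intro c h hs hb hc
    have e : (Instr.jumpZero (regCell r) (c.pc + b.size + 2)).exec T c =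
        { c with pc := c.pc + b.size + 2 } := by simp [Instr.exec, h.reg, hr]
    have r1 := Reach.single (T := T) hc.head hb (e ▸ hb)
    rw [e] at r1
    have hc2 := hc.tail.right.tail
    rw [Cmd.length_compile] at hc2
    obtain ⟨c2, r2, h2, hs2, p2, t2⟩ := ih { c with pc := c.pc + b.size + 2 }
      (h.tick 1 _) (hs.tick 1) hb
      (by rwa [show c.pc + 1 + b.size + 1 = c.pc + b.size + 2 by omega] at hc2)
    simp only [State.tick] at t2 r2
    refine ⟨c2, ?_, h2, hs2, by rw [p2, Cmd.size]; dsimp only; omega, by omega⟩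
    have := r1.trans r2
    rwa [show 1 + (s'.time - (s.time + 1)) = s'.time - s.time by omega] at this
  | @ifPos r a b s s' hr _ ih =>
    intro c h hs hb hc
    have e : (Instr.jumpZero (regCell r) (c.pc + b.size + 2)).exec T c =
        { c with pc := c.pc + 1 } := by simp [Instr.exec, h.reg, hr]
    have r1 := Reach.single (T := T) hc.head hb (e ▸ hb)
    rw [e] at r1
    obtain ⟨c2, r2, h2, hs2, p2, t2⟩ := ih { c with pc := c.pc + 1 }
      (h.tick 1 _) (hs.tick 1) hb hc.tail.left
    have hc3 := hc.tail.right.head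
    rw [Cmd.length_compile] at hc3
    have r3 := Reach.single (T := T) (c := c2) (i := .jump (c.pc + b.size + 2 + a.size))
      (by rw [p2]; exact hc3) r2.right r2.right
    simp only [State.tick] at t2 r2
    refine ⟨_, ?_, h2.tick 1 (c.pc + b.size + 2 + a.size), hs2.tick 1,
      by simp only [Cmd.size]; omega, by simp only [State.tick]; omega⟩
    have := r1.trans (r2.trans r3)
    rw [show 1 + (s'.time - (s.time + 1) + 1) = (s'.tick 1).time - s.time by
      simp only [State.tick]; omega] at this
    simpa [Instr.exec] using this
  | @loopEnd r a s hr =>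
    intro c h hs hb hc
    have e : (Instr.jumpZero (regCell r) (c.pc + a.size + 2)).exec T c =
        { c with pc := c.pc + a.size + 2 } := by simp [Instr.exec, h.reg, hr]
    have r1 := Reach.single (T := T) hc.head hb (e ▸ hb)
    rw [e] at r1
    exact ⟨{ c with pc := c.pc + a.size + 2 }, by simpa [State.tick] using r1, h.tick 1 _,
      hs.tick 1, rfl, by simp [State.tick]⟩
  | @loopStep r a s s' s'' hr _ _ ih1 ih2 =>
    intro c h hs hb hc
    have e : (Instr.jumpZero (regCell r) (c.pc + a.size + 2)).exec T c =
        { c with pc := c.pc + 1 } := by simp [Instr.exec, h.reg, hr]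
    have r1 := Reach.single (T := T) hc.head hb (e ▸ hb)
    rw [e] at r1
    obtain ⟨c2, r2, h2, hs2, p2, t2⟩ := ih1 { c with pc := c.pc + 1 }
      (h.tick 1 _) (hs.tick 1) hb hc.tail.left
    have hc3 := hc.tail.right.head
    rw [Cmd.length_compile] at hc3
    have r3 := Reach.single (T := T) (c := c2) (i := .jump c.pc)
      (by rw [p2]; exact hc3) r2.right r2.right
    obtain ⟨c4, r4, h4, hs4, p4, t4⟩ := ih2 { c2 with pc := c.pc }
      (h2.tick 1 _) (hs2.tick 1) r2.right hc
    simp only [State.tick] at t2 r2 t4 r4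
    refine ⟨c4, ?_, h4, hs4, p4, by omega⟩
    have := r1.trans (r2.trans (r3.trans r4))
    rwa [show 1 + (s'.time - (s.time + 1) + (1 + (s''.time - (s'.time + 1)))) =
      s''.time - s.time by omega] at this

end

/-! ### Weakest preconditions -/

/-- From `s` the command `a` terminates, respects the bounds, and establishes `K`. -/
def wp (T : InputTable) (W R : ℕ) (a : Cmd) (K : State → Prop) (s : State) : Prop :=
  ∃ s', Exec T W R a s s' ∧ K s'

section
variable {T : InputTable} {W R : ℕ} {K : State → Prop} {s : State}

theorem wp.mono {a : Cmd} {L : State → Prop} (h : wp T W R a K s) (hKL : ∀ s', K s' → L s') :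
    wp T W R a L s := let ⟨s', h1, h2⟩ := h; ⟨s', h1, hKL s' h2⟩

theorem wp_skip : wp T W R .skip K s ↔ K s :=
  ⟨fun ⟨_, h, hK⟩ => by cases h; exact hK, fun h => ⟨s, .skip s, h⟩⟩

theorem wp_basic {i : Basic} : wp T W R (.basic i) K s ↔ i.Ok T W R s ∧ K (i.exec T s) :=
  ⟨fun ⟨_, h, hK⟩ => by cases h with | basic h => exact ⟨h, hK⟩,
    fun h => ⟨_, .basic h.1, h.2⟩⟩

theorem wp_seq {a b : Cmd} : wp T W R (.seq a b) K s ↔ wp T W R a (wp T W R b K) s :=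
  ⟨fun ⟨_, h, hK⟩ => by cases h with | seq h h' => exact ⟨_, h, _, h', hK⟩,
    fun ⟨_, h, _, h', hK⟩ => ⟨_, .seq h h', hK⟩⟩

theorem wp_ifZero {r : Reg} {a b : Cmd} : wp T W R (.ifZero r a b) K s ↔
    (s.reg r = 0 → wp T W R a K (s.tick 1)) ∧
    (s.reg r ≠ 0 → wp T W R b (fun s' => K (s'.tick 1)) (s.tick 1)) := by
  constructor
  · rintro ⟨_, h, hK⟩
    cases h with
    | ifZero hr h => exact ⟨fun _ => ⟨_, h, hK⟩, fun h' => absurd hr h'⟩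
    | ifPos hr h => exact ⟨fun h' => absurd h' hr, fun _ => ⟨_, h, hK⟩⟩
  · rintro ⟨h1, h2⟩
    by_cases hr : s.reg r = 0
    · obtain ⟨_, h, hK⟩ := h1 hr; exact ⟨_, .ifZero hr h, hK⟩
    · obtain ⟨_, h, hK⟩ := h2 hr; exact ⟨_, .ifPos hr h, hK⟩

/-- The index of the invariant is a strictly decreasing variant, which gives termination; the two
ticks are the test and the jump back. -/
theorem wp_loop {r : Reg} {a : Cmd} {I : ℕ → State → Prop}
    (hI : ∀ j s, I j s → (s.reg r = 0 ∧ K (s.tick 1)) ∨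
      (s.reg r ≠ 0 ∧ wp T W R a (fun s' => ∃ j' < j, I j' (s'.tick 1)) (s.tick 1)))
    {j : ℕ} (h : I j s) : wp T W R (.loop r a) K s := by
  induction j using Nat.strong_induction_on generalizing s with
  | _ j ih =>
    rcases hI j s h with ⟨hr, hK⟩ | ⟨hr, s', hs', j', hj', h'⟩
    · exact ⟨_, .loopEnd hr, hK⟩
    · obtain ⟨s'', hs'', hK⟩ := ih j' hj' h'
      exact ⟨_, .loopStep hr hs' hs'', hK⟩

/-- `for i = 0, …, N - 1 do a`, where `N` is the content of the register `b`; `d` is an auxiliary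
register. -/
def Cmd.forUp (i b d : Reg) (a : Cmd) : Cmd :=
  .seq (.basic (.const i 0)) (.seq (.basic (.arith .sub d b i))
    (.loop d (.seq a (.seq (.basic (.arithConst .add i i 1)) (.basic (.arith .sub d b i))))))

/-- The invariant has to be insensitive to `i`, `d` and the clock, because the bookkeeping of the
loop changes them between two executions of the body. A round costs `5` on top of the body: test
`1`, increment `2`, subtraction `1`, jump back `1`. The final `3` accounts for the two initial
assignments and the last test. -/
theorem wp_forUp {i b d : Reg} {a : Cmd} {I : ℕ → State → Prop} {N c : ℕ}
    (hib : i ≠ b) (hid : i ≠ d) (hN : N ≤ W) (hW : 1 ≤ W)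
    (hb : ∀ j s, I j s → s.reg b = N)
    (hstable : ∀ j s v v' t, I j s →
      I j { s with reg := Function.update (Function.update s.reg i v) d v', time := t })
    (h0 : I 0 s)
    (hstep : ∀ j < N, ∀ s, I j s → s.reg i = j →
      wp T W R a (fun s' => I (j + 1) s' ∧ s'.reg i = j ∧ s'.time ≤ s.time + c) s)
    (hK : ∀ s', I N s' → s'.time ≤ s.time + N * (c + 5) + 3 → K s') :
    wp T W R (.forUp i b d a) K s := by
  unfold Cmd.forUp
  simp only [wp_seq, wp_basic, Basic.Ok, Basic.exec]
  refine ⟨by omega, Or.inr ?_, ?_⟩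
  · simp [State.setReg, ArithOp.eval, hib.symm, hb 0 s h0, hN]
  -- The variant `k` is the number of rounds left, which is also the content of `d`.
  refine wp_loop (I := fun k s' => k ≤ N ∧ I (N - k) s' ∧ s'.reg i = N - k ∧ s'.reg d = k ∧
      s'.time ≤ s.time + (N - k) * (c + 5) + 2) (j := N) ?_ ?_
  · rintro k u ⟨hkN, hu, hui, hud, hut⟩
    have hst : ∀ t, I (N - k) (u.tick t) := fun t => by
      have := hstable _ u (u.reg i) (u.reg d) (u.time + t) hu
      simpa [State.tick] using this
    by_cases hk : k = 0
    · subst hk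
      refine Or.inl ⟨hud, hK _ (by simpa using hst 1) ?_⟩
      simp only [State.tick]
      simp only [Nat.sub_zero] at hut
      omega
    · refine Or.inr ⟨by omega, ?_⟩
      rw [wp_seq]
      refine (hstep (N - k) (by omega) _ (hst 1) hui).mono ?_
      rintro s' ⟨hs', hsi, hst'⟩
      have hbs := hb _ _ hs'
      simp only [wp_seq, wp_basic, Basic.Ok, Basic.exec]
      refine ⟨⟨hW, Or.inr ?_⟩, Or.inl ?_, k - 1, by omega, by omega, ?_, ?_, ?_, ?_⟩
      · simp only [ArithOp.eval, hsi]; omega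
      · simp [ArithOp.eval]
      · rw [show N - (k - 1) = N - k + 1 by omega]
        exact hstable _ s' _ _ _ hs'
      · simp [State.tick, State.setReg, hid, ArithOp.eval, hsi]; omega
      · simp [State.tick, State.setReg, ArithOp.eval, hsi, hib.symm, hbs]; omega
      · simp only [State.tick, State.setReg] at hst' ⊢
        rw [show N - (k - 1) = N - k + 1 by omega, add_mul]
        omega
  · refine ⟨le_rfl, ?_, ?_, ?_, ?_⟩
    · simpa [State.setReg] using hstable 0 s _ _ _ h0
    · simp [State.setReg, hid]
    · simp [State.setReg, ArithOp.eval, hib.symm, hb 0 s h0]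
    · simp [State.setReg]

end

end Ram

/-! ### Meet-irreducible elements of ranked implicational bases -/

section
variable {α : Type*} [Fintype α] [DecidableEq α]

theorem isClosedIn_inter {B : Set (Implication α)} {C D : Finset α} (hC : IsClosedIn B C)
    (hD : IsClosedIn B D) : IsClosedIn B (C ∩ D) := fun r hr h =>
  Finset.mem_inter.2 ⟨hC r hr (h.trans Finset.inter_subset_left),
    hD r hr (h.trans Finset.inter_subset_right)⟩

theorem isClosedIn_univ (B : Set (Implication α)) : IsClosedIn B Finset.univ :=
  fun _ _ _ => Finset.mem_univ _

/-- `C` is closed and avoids `x`. -/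
def ClosedAvoiding (B : Set (Implication α)) (x : α) (C : Finset α) : Prop :=
  IsClosedIn B C ∧ x ∉ C

/-- If `M` is irreducible, the intersection of all closed sets strictly above `M` is still strictly
above `M` (the empty intersection is `univ`, which differs from `M`); any element of the difference
serves as `x`. Conversely, if `M = C ∩ D` avoids `x`, then so does one of `C` and `D`, and
maximality makes it equal to `M`. -/
theorem mem_meetIrreducibles_iff {B : Set (Implication α)} {M : Finset α} :
    M ∈ meetIrreducibles B ↔ ∃ x, Maximal (ClosedAvoiding B x) M := by
  classical
  constructor
  · rintro ⟨hM, hne, hirr⟩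
    have key : ∀ F : Finset (Finset α), (∀ C ∈ F, IsClosedIn B C ∧ M ⊂ C) →
        IsClosedIn B (F.inf id) ∧ M ⊂ F.inf id := by
      intro F
      induction F using Finset.induction_on with
      | empty =>
        exact fun _ => ⟨isClosedIn_univ B, Finset.ssubset_univ_iff.2 hne⟩
      | insert C F _ ih =>
        intro h
        obtain ⟨h1, h2⟩ := ih fun D hD => h D (Finset.mem_insert_of_mem hD)
        obtain ⟨h3, h4⟩ := h C (Finset.mem_insert_self _ _)
        rw [Finset.inf_insert]
        refine ⟨isClosedIn_inter h3 h1, ?_⟩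
        refine (Finset.subset_inter h4.subset h2.subset).ssubset_of_ne fun he => ?_
        rcases hirr _ _ h3 h1 he with h' | h'
        · exact h4.ne h'.symm
        · exact h2.ne h'.symm
    obtain ⟨-, h2⟩ := key (Finset.univ.filter fun C => IsClosedIn B C ∧ M ⊂ C) (by simp)
    obtain ⟨x, hx, hxM⟩ := Finset.exists_of_ssubset h2
    refine ⟨x, ⟨hM, hxM⟩, fun C hC hMC => ?_⟩
    by_contra hCM
    have : C ∈ Finset.univ.filter fun C => IsClosedIn B C ∧ M ⊂ C := by
      simpa using ⟨hC.1, hMC, hCM⟩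
    exact hC.2 (Finset.inf_le (f := id) this hx)
  · rintro ⟨x, hM⟩
    refine ⟨hM.1.1, fun h => hM.1.2 (h ▸ Finset.mem_univ x), fun C D hC hD h => ?_⟩
    have : x ∉ C ∨ x ∉ D := by
      by_contra hcon
      push Not at hcon
      exact hM.1.2 (h ▸ Finset.mem_inter.2 hcon)
    rcases this with hx | hx
    · exact Or.inl (hM.eq_of_ge ⟨hC, hx⟩ (h ▸ Finset.inter_subset_left))
    · exact Or.inr (hM.eq_of_ge ⟨hD, hx⟩ (h ▸ Finset.inter_subset_right))

/-- The premises of the implications with conclusion in `Y`. -/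
def edgesInto (B : Set (Implication α)) (Y : Finset α) : Set (Finset α) :=
  {A | ∃ r ∈ B, r.premise = A ∧ r.conclusion ∈ Y}

theorem exists_edge_of_notMem {E : Set (Finset α)} {S : Finset α}
    (hS : S ∈ maximalIndependentSets E) {z : α} (hz : z ∉ S) :
    ∃ A ∈ E, A ⊆ insert z S ∧ z ∈ A := by
  by_contra! hcon
  have : IsIndependentSet E (insert z S) := fun A hA hAS =>
    hS.1 A hA fun a ha => (Finset.mem_insert.1 (hAS ha)).resolve_left
      (by rintro rfl; exact hcon A hA hAS ha)
  exact hz (hS.2 this (Finset.subset_insert z S) (Finset.mem_insert_self z S))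

theorem exists_maximalIndependentSet {E : Set (Finset α)} {C : Finset α}
    (hC : IsIndependentSet E C) : ∃ S ∈ maximalIndependentSets E, C ⊆ S := by
  obtain ⟨S, hCS, hS⟩ := Set.Finite.exists_le_maximal (s := {S | IsIndependentSet E S})
    (Set.toFinite _) hC
  exact ⟨S, hS, hCS⟩

/-- A partial choice of the complement of a maximal closed set avoiding `x`: the elements of rank
at most `k` above that of `x` have been chosen, and `Y` holds those of rank exactly `k`. -/
structure PartialComplement (B : Set (Implication α)) (ρ : α → ℕ) (x : α) (k : ℕ)
    (acc Y : Finset α) : Prop where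
  subset : Y ⊆ acc
  rank_eq : ∀ z ∈ Y, ρ z = ρ x + k
  rank_lt : ∀ z ∈ acc, z ∉ Y → ρ z < ρ x + k
  root : x ∈ acc
  blocked : ∀ r ∈ B, r.conclusion ∈ acc → r.conclusion ∉ Y → ∃ a ∈ r.premise, a ∈ acc
  maximal : ∀ C, ClosedAvoiding B x C → (∀ z, ρ z ≤ ρ x + k → z ∉ acc → z ∈ C) →
    ∀ z ∈ acc, z ∉ C
  card : Y.Nonempty → k + 1 ≤ acc.card

namespace PartialComplement
variable {B : Set (Implication α)} {ρ : α → ℕ} {x : α} {k : ℕ} {acc Y S : Finset α}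

theorem singleton : PartialComplement B ρ x 0 {x} {x} where
  subset := subset_rfl
  rank_eq := by simp
  rank_lt := fun z hz hz' => absurd hz hz'
  root := by simp
  blocked := fun r _ h h' => absurd h h'
  maximal := fun C hC _ z hz => by rw [Finset.mem_singleton.1 hz]; exact hC.2
  card := by simp

theorem rank_le (h : PartialComplement B ρ x k acc Y) {z : α} (hz : z ∈ acc) :
    ρ z ≤ ρ x + k := by
  by_cases hY : z ∈ Y
  · exact (h.rank_eq z hY).le
  · exact (h.rank_lt z hz hY).le

/-- An element that cannot be added to `S` completes an edge inside `insert z S`. The edge is the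
premise of an implication into `Y`, so all its elements lie exactly one rank above `Y`. -/
theorem rank_succ (hρ : ∀ r ∈ B, ∀ a ∈ r.premise, ρ a = ρ r.conclusion + 1)
    (h : PartialComplement B ρ x k acc Y)
    (hS : S ∈ maximalIndependentSets (edgesInto B Y)) {z : α} (hz : z ∉ S) :
    ρ z = ρ x + (k + 1) ∧ ∃ r ∈ B, r.conclusion ∈ Y ∧ r.premise ⊆ insert z S ∧
      ∀ a ∈ r.premise, ρ a = ρ x + (k + 1) := by
  obtain ⟨A, ⟨r, hr, rfl, hrY⟩, hAS, hzA⟩ := exists_edge_of_notMem hS hz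
  have : ∀ a ∈ r.premise, ρ a = ρ x + (k + 1) := fun a ha => by
    rw [hρ r hr a ha, h.rank_eq _ hrY, add_assoc]
  exact ⟨this z hzA, r, hr, hrY, hAS, this⟩

/-- This is where the rank is essential: `Sᶜ` lies on a single new rank, so extending the choice
neither disturbs earlier levels nor is disturbed by later ones. -/
theorem step (hρ : ∀ r ∈ B, ∀ a ∈ r.premise, ρ a = ρ r.conclusion + 1)
    (h : PartialComplement B ρ x k acc Y) (hS : S ∈ maximalIndependentSets (edgesInto B Y)) :
    PartialComplement B ρ x (k + 1) (acc ∪ Sᶜ) Sᶜ where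
  subset := Finset.subset_union_right
  rank_eq := fun z hz => (h.rank_succ hρ hS (Finset.mem_compl.1 hz)).1
  rank_lt := fun z hz hz' => by
    have := h.rank_le ((Finset.mem_union.1 hz).resolve_right hz')
    omega
  root := Finset.mem_union_left _ h.root
  blocked := fun r hr hc hc' => by
    have hacc := (Finset.mem_union.1 hc).resolve_right hc'
    by_cases hY : r.conclusion ∈ Y
    · have := hS.1 r.premise ⟨r, hr, rfl, hY⟩
      obtain ⟨a, ha, haS⟩ := Finset.not_subset.1 this
      exact ⟨a, ha, Finset.mem_union_right _ (Finset.mem_compl.2 haS)⟩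
    · obtain ⟨a, ha, haS⟩ := h.blocked r hr hacc hY
      exact ⟨a, ha, Finset.mem_union_left _ haS⟩
  -- If `C` contained some `z ∉ S`, it would contain a whole edge through `z`: the other vertices of
  -- the edge are in `S` and lie on the new rank, hence were not chosen and belong to `C` by
  -- assumption. Closedness would then put an element of `Y` into `C`, against the previous level.
  maximal := fun C hC hCz => by
    have hacc : ∀ z ∈ acc, z ∉ C := h.maximal C hC fun z hz hza => hCz z (by omega) fun h' => by
      rcases Finset.mem_union.1 h' with h' | h'
      · exact hza h'
      · have := (h.rank_succ hρ hS (Finset.mem_compl.1 h')).1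
        omega
    intro z hz hzC
    rcases Finset.mem_union.1 hz with hz | hz
    · exact hacc z hz hzC
    · obtain ⟨-, r, hr, hrY, hrS, hrk⟩ := h.rank_succ hρ hS (Finset.mem_compl.1 hz)
      refine hacc _ (h.subset hrY) (hC.1 r hr fun a ha => ?_)
      rcases Finset.mem_insert.1 (hrS ha) with rfl | haS
      · exact hzC
      · refine hCz a (hrk a ha).le fun h' => ?_
        rcases Finset.mem_union.1 h' with h' | h'
        · have := h.rank_le h'
          have := hrk a ha
          omega
        · exact Finset.mem_compl.1 h' haS
  -- If `Sᶜ` is nonempty then so is `Y`, and `z` has higher rank than everything chosen before, so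
  -- the number of chosen elements grows.
  card := fun ⟨z, hz⟩ => by
    obtain ⟨hz1, r, hr, hrY, -⟩ := h.rank_succ hρ hS (Finset.mem_compl.1 hz)
    have h1 := h.card ⟨_, hrY⟩
    have h2 : acc ⊂ acc ∪ Sᶜ := by
      refine Finset.ssubset_iff_subset_ne.2 ⟨Finset.subset_union_left, fun he => ?_⟩
      have hza : z ∈ acc := by rw [he]; exact Finset.mem_union_right _ hz
      have := h.rank_le hza
      omega
    have := Finset.card_lt_card h2
    omega

/-- At level `|X|` the field `card` would require `|X| + 1` elements if `Y` were nonempty. With `Y`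
empty, `blocked` says that the complement is closed and `maximal` that it cannot be enlarged. -/
theorem maximal_compl (h : PartialComplement B ρ x (Fintype.card α) acc Y) :
    Maximal (ClosedAvoiding B x) accᶜ := by
  have hY : ∀ z, z ∉ Y := fun z hz => by
    have := h.card ⟨z, hz⟩
    have := Finset.card_le_univ acc
    omega
  refine ⟨⟨fun r hr hrM => ?_, by simpa using h.root⟩, fun C hC hMC z hz => ?_⟩
  · by_contra hc
    obtain ⟨a, ha, ha'⟩ := h.blocked r hr (by simpa using hc) (hY _)
    exact Finset.mem_compl.1 (hrM ha) ha'
  · refine Finset.mem_compl.2 fun hza => ?_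
    exact h.maximal C hC (fun z _ hz => hMC (Finset.mem_compl.2 hz)) z hza hz

end PartialComplement

/-! ### The search tree and its leaves. -/

/-- The complements of the completions of a partial choice by `d` further levels, when `L Y` lists
the maximal independent sets of the hypergraph of `Y`. -/
def completions (L : Finset α → List (Finset α)) : ℕ → Finset α → Finset α → List (Finset α)
  | 0, acc, _ => [accᶜ]
  | d + 1, acc, Y => (L Y).flatMap fun S => completions L d (acc ∪ Sᶜ) Sᶜ

section
variable {B : Set (Implication α)} {ρ : α → ℕ} {x : α} {L : Finset α → List (Finset α)}

theorem maximal_of_mem_completions (hρ : ∀ r ∈ B, ∀ a ∈ r.premise, ρ a = ρ r.conclusion + 1)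
    (hL : ∀ Y S, S ∈ L Y ↔ S ∈ maximalIndependentSets (edgesInto B Y)) {M : Finset α} {d : ℕ} :
    ∀ {k : ℕ} {acc Y : Finset α}, PartialComplement B ρ x k acc Y → k + d = Fintype.card α →
      M ∈ completions L d acc Y → Maximal (ClosedAvoiding B x) M := by
  induction d with
  | zero =>
    intro k acc Y h hk hM
    obtain rfl : M = accᶜ := by simpa [completions] using hM
    obtain rfl : k = Fintype.card α := by omega
    exact h.maximal_compl
  | succ d ih =>
    intro k acc Y h hk hM
    obtain ⟨S, hS, hM⟩ := List.mem_flatMap.1 hM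
    exact ih (h.step hρ ((hL _ _).1 hS)) (by omega) hM

/-- A closed set disjoint from `Y` is independent in the hypergraph of `Y`, so it extends to a
maximal independent set; following such extensions down the tree keeps `M` inside the complement of
the chosen elements. At the leaf the two sets are equal by maximality of `M`. -/
theorem mem_completions_of_maximal (hρ : ∀ r ∈ B, ∀ a ∈ r.premise, ρ a = ρ r.conclusion + 1)
    (hL : ∀ Y S, S ∈ L Y ↔ S ∈ maximalIndependentSets (edgesInto B Y)) {M : Finset α}
    (hM : Maximal (ClosedAvoiding B x) M) {d : ℕ} :
    ∀ {k : ℕ} {acc Y : Finset α}, PartialComplement B ρ x k acc Y → k + d = Fintype.card α →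
      M ⊆ accᶜ → M ∈ completions L d acc Y := by
  induction d with
  | zero =>
    intro k acc Y h hk hMa
    obtain rfl : k = Fintype.card α := by omega
    have := hM.eq_of_ge h.maximal_compl.1 hMa
    simp [completions, this]
  | succ d ih =>
    intro k acc Y h hk hMa
    have hind : IsIndependentSet (edgesInto B Y) M := by
      rintro _ ⟨r, hr, rfl, hrY⟩ hrM
      exact Finset.mem_compl.1 (hMa (hM.1.1 r hr hrM)) (h.subset hrY)
    obtain ⟨S, hS, hMS⟩ := exists_maximalIndependentSet hind
    refine List.mem_flatMap.2 ⟨S, (hL _ _).2 hS, ih (h.step hρ hS) (by omega) ?_⟩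
    intro z hz
    have := Finset.mem_compl.1 (hMa hz)
    simp [this, hMS hz]

/-- Later choices only remove elements of higher rank, so up to rank `ρ x + k` the final set is
already determined. -/
theorem mem_iff_of_mem_completions (hρ : ∀ r ∈ B, ∀ a ∈ r.premise, ρ a = ρ r.conclusion + 1)
    (hL : ∀ Y S, S ∈ L Y ↔ S ∈ maximalIndependentSets (edgesInto B Y)) {M : Finset α} {d : ℕ} :
    ∀ {k : ℕ} {acc Y : Finset α}, PartialComplement B ρ x k acc Y → M ∈ completions L d acc Y →
      ∀ z, ρ z ≤ ρ x + k → (z ∈ M ↔ z ∉ acc) := by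
  induction d with
  | zero =>
    intro k acc Y h hM z _
    obtain rfl : M = accᶜ := by simpa [completions] using hM
    exact Finset.mem_compl
  | succ d ih =>
    intro k acc Y h hM z hz
    obtain ⟨S, hS, hM⟩ := List.mem_flatMap.1 hM
    have hS' := (hL _ _).1 hS
    rw [ih (h.step hρ hS') hM z (by omega), Finset.mem_union, not_or, Finset.mem_compl, not_not,
      and_iff_left_iff_imp]
    intro _
    by_contra hzS
    have := (h.rank_succ hρ hS' hzS).1
    omega

/-- The set `Sᶜ` can be recovered from any completion: it consists of the elements of rank `ρ x + (k
+ 1)` that are missing. Hence different branches have no common leaf. -/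
theorem eq_of_mem_completions (hρ : ∀ r ∈ B, ∀ a ∈ r.premise, ρ a = ρ r.conclusion + 1)
    (hL : ∀ Y S, S ∈ L Y ↔ S ∈ maximalIndependentSets (edgesInto B Y)) {M : Finset α} {d k : ℕ}
    {acc Y S S' : Finset α} (h : PartialComplement B ρ x k acc Y) (hS : S ∈ L Y) (hS' : S' ∈ L Y)
    (hM : M ∈ completions L d (acc ∪ Sᶜ) Sᶜ) (hM' : M ∈ completions L d (acc ∪ S'ᶜ) S'ᶜ) :
    S = S' := by
  have key : ∀ {S S' : Finset α}, S ∈ L Y → S' ∈ L Y → M ∈ completions L d (acc ∪ Sᶜ) Sᶜ →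
      M ∈ completions L d (acc ∪ S'ᶜ) S'ᶜ → S' ⊆ S := by
    intro S S' hS hS' hM hM' z hz
    by_contra hzS
    have hr := (h.rank_succ hρ ((hL _ _).1 hS) hzS).1
    have h1 := mem_iff_of_mem_completions hρ hL (h.step hρ ((hL _ _).1 hS)) hM z (by omega)
    have h2 := mem_iff_of_mem_completions hρ hL (h.step hρ ((hL _ _).1 hS')) hM' z (by omega)
    have hza : z ∉ acc := fun hza => by have := h.rank_le hza; omega
    have h3 : z ∈ M := h2.2 (by simp [hza, hz])
    exact h1.1 h3 (by simp [hzS])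
  exact (key hS' hS hM' hM).antisymm (key hS hS' hM hM')

theorem nodup_completions (hρ : ∀ r ∈ B, ∀ a ∈ r.premise, ρ a = ρ r.conclusion + 1)
    (hL : ∀ Y S, S ∈ L Y ↔ S ∈ maximalIndependentSets (edgesInto B Y)) (hnd : ∀ Y, (L Y).Nodup)
    {d : ℕ} : ∀ {k : ℕ} {acc Y : Finset α}, PartialComplement B ρ x k acc Y →
      (completions L d acc Y).Nodup := by
  induction d with
  | zero => intro k acc Y _; simp [completions]
  | succ d ih =>
    intro k acc Y h
    rw [completions, List.nodup_flatMap]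
    refine ⟨fun S hS => ih (h.step hρ ((hL _ _).1 hS)), ?_⟩
    refine (hnd Y).imp_of_mem fun hS hS' hne M hM hM' => hne ?_
    exact eq_of_mem_completions hρ hL h hS hS' hM hM'

theorem completions_ne_nil (hne : ∀ Y, L Y ≠ []) {d : ℕ} :
    ∀ {acc Y : Finset α}, completions L d acc Y ≠ [] := by
  induction d with
  | zero => simp [completions]
  | succ d ih =>
    intro acc Y
    obtain ⟨S, hS⟩ := List.exists_mem_of_ne_nil _ (hne Y)
    simp only [completions, ne_eq, List.flatMap_eq_nil_iff, not_forall]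
    exact ⟨S, hS, ih⟩

/-- Closedness of `∅` means that no premise is empty, so `∅` is independent. This keeps the search
free of dead ends. -/
theorem maximalIndependentSets_edgesInto_nonempty (h0 : IsClosedIn B ∅) (Y : Finset α) :
    (maximalIndependentSets (edgesInto B Y)).Nonempty := by
  have : IsIndependentSet (edgesInto B Y) ∅ := by
    rintro _ ⟨r, hr, rfl, _⟩ hr0
    simpa using h0 r hr hr0
  obtain ⟨S, hS, -⟩ := exists_maximalIndependentSet this
  exact ⟨S, hS⟩

/-- The partial choices met by the enumeration. -/
inductive Stage (B : Set (Implication α)) : ℕ → Finset α → Finset α → Prop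
  | root (x : α) : Stage B 0 {x} {x}
  | step {k acc Y S} (h : Stage B k acc Y)
      (hS : S ∈ maximalIndependentSets (edgesInto B Y)) : Stage B (k + 1) (acc ∪ Sᶜ) Sᶜ

theorem Stage.partialComplement (hρ : ∀ r ∈ B, ∀ a ∈ r.premise, ρ a = ρ r.conclusion + 1)
    {k : ℕ} {acc Y : Finset α} (h : Stage B k acc Y) :
    ∃ x, PartialComplement B ρ x k acc Y := by
  induction h with
  | root x => exact ⟨x, .singleton⟩
  | step _ hS ih => obtain ⟨x, h⟩ := ih; exact ⟨x, h.step hρ hS⟩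

/-- Choosing one completion below each `S` is an injection into the meet-irreducible elements. It
bounds the number of solutions of every subproblem by the size of the final output, as
output-sensitive time requires. -/
theorem ncard_maximalIndependentSets_le (hB : IsRanked B) (h0 : IsClosedIn B ∅) {k : ℕ}
    {acc Y : Finset α} (h : Stage B k acc Y) (hk : k < Fintype.card α) :
    (maximalIndependentSets (edgesInto B Y)).ncard ≤ (meetIrreducibles B).ncard := by
  classical
  obtain ⟨ρ, hρ⟩ := hB
  obtain ⟨x, hx⟩ := h.partialComplement hρ
  let L : Finset α → List (Finset α) := fun Y =>
    (maximalIndependentSets (edgesInto B Y)).toFinite.toFinset.toList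
  have hL : ∀ Y S, S ∈ L Y ↔ S ∈ maximalIndependentSets (edgesInto B Y) := by simp [L]
  have hne : ∀ Y, L Y ≠ [] := fun Y => by
    obtain ⟨S, hS⟩ := maximalIndependentSets_edgesInto_nonempty h0 Y
    exact List.ne_nil_of_mem ((hL _ _).2 hS)
  have hex : ∀ S, ∃ M, M ∈ completions L (Fintype.card α - (k + 1)) (acc ∪ Sᶜ) Sᶜ := fun S =>
    List.exists_mem_of_ne_nil _ (completions_ne_nil hne)
  choose F hF using hex
  refine Set.ncard_le_ncard_of_injOn F (fun S hS => ?_) (fun S hS S' hS' he => ?_)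
    (Set.toFinite _)
  · exact mem_meetIrreducibles_iff.2 ⟨x, maximal_of_mem_completions hρ hL (hx.step hρ hS)
      (by omega) (hF S)⟩
  · exact eq_of_mem_completions hρ hL hx ((hL _ _).2 hS) ((hL _ _).2 hS') (hF S) (he ▸ hF S')

end

end

section
variable {n : ℕ} {B : Set (Implication (Fin n))} {L : Finset (Fin n) → List (Finset (Fin n))}

/-- The list of meet-irreducible elements in the order of their enumeration. -/
def meetIrreducibleList (L : Finset (Fin n) → List (Finset (Fin n))) : List (Finset (Fin n)) :=
  ((List.finRange n).map fun x => {x}ᶜ).flatMap fun S => completions L n (∅ ∪ Sᶜ) Sᶜ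

theorem mem_meetIrreducibleList (hB : IsRanked B)
    (hL : ∀ Y S, S ∈ L Y ↔ S ∈ maximalIndependentSets (edgesInto B Y)) {M : Finset (Fin n)} :
    M ∈ meetIrreducibleList L ↔ M ∈ meetIrreducibles B := by
  obtain ⟨ρ, hρ⟩ := hB
  simp only [meetIrreducibleList, List.flatMap_map, List.mem_flatMap, List.mem_finRange, true_and,
    compl_compl, Finset.empty_union, mem_meetIrreducibles_iff]
  refine exists_congr fun x => ⟨fun h => ?_, fun h => ?_⟩
  · exact maximal_of_mem_completions hρ hL .singleton (by simp) h
  · exact mem_completions_of_maximal hρ hL h .singleton (by simp) (by simpa using h.1.2)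

theorem nodup_meetIrreducibleList (hB : IsRanked B)
    (hL : ∀ Y S, S ∈ L Y ↔ S ∈ maximalIndependentSets (edgesInto B Y)) (hnd : ∀ Y, (L Y).Nodup) :
    (meetIrreducibleList L).Nodup := by
  obtain ⟨ρ, hρ⟩ := hB
  simp only [meetIrreducibleList, List.flatMap_map, compl_compl, Finset.empty_union]
  rw [List.nodup_flatMap]
  refine ⟨fun x _ => nodup_completions hρ hL hnd .singleton, ?_⟩
  -- A set found from the root `x` misses `x` but contains every other element of rank at most `ρ
  -- x`. So the root of smaller rank would belong to a set found from both.
  refine (List.nodup_finRange n).imp fun {x y} hne M hM hM' => hne ?_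
  have hx := mem_iff_of_mem_completions hρ hL .singleton hM
  have hy := mem_iff_of_mem_completions hρ hL .singleton hM'
  have hxM : x ∉ M := fun h => (hx x le_rfl).1 h (by simp)
  have hyM : y ∉ M := fun h => (hy y le_rfl).1 h (by simp)
  rcases le_total (ρ x) (ρ y) with h | h
  · by_contra hne
    exact hxM ((hy x h).2 (by simpa using hne))
  · by_contra hne
    exact hyM ((hx y h).2 (by simpa using fun h => hne h.symm))

end

namespace Ram

infixr:60 " ;; " => Cmd.seq

/-! ### A memory that can be reset in constant time

The cell `a` of the memory of level `k` is initialized if its number `idx k a` is less than the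
number `cnt k 0` of initialized cells and `lst k` lists it under this number. -/

/-- From `s` to `s'` only the registers in `D` and the arrays in `E` of level `k` have changed, and
at most `t` units of time have passed. -/
structure Frame (D : List Reg) (E : List Arr) (k t : ℕ) (s s' : State) : Prop where
  reg : ∀ r, r ∉ D → s'.reg r = s.reg r
  arr : ∀ A l i, ¬ (A ∈ E ∧ l = k) → s'.arr A l i = s.arr A l i
  cur : s'.cur = s.cur
  out : s'.out = s.out
  time : s'.time ≤ s.time + t

theorem Frame.trans {D E k t t' s s' s''} (h : Frame D E k t s s') (h' : Frame D E k t' s' s'') :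
    Frame D E k (t + t') s s'' where
  reg := fun r hr => (h'.reg r hr).trans (h.reg r hr)
  arr := fun A l i hA => (h'.arr A l i hA).trans (h.arr A l i hA)
  cur := h'.cur.trans h.cur
  out := h'.out.trans h.out
  time := by have := h.time; have := h'.time; omega

theorem Frame.weaken {D D' E E' k t t' s s'} (h : Frame D E k t s s') (hD : D ⊆ D') (hE : E ⊆ E')
    (ht : t ≤ t') : Frame D' E' k t' s s' where
  reg := fun r hr => h.reg r fun h' => hr (hD h')
  arr := fun A l i hA => h.arr A l i fun h' => hA ⟨hE h'.1, h'.2⟩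
  cur := h.cur
  out := h.out
  time := by have := h.time; omega

section
variable (f : Arr → ℕ → ℕ → ℕ) (k : ℕ)

/-- The cell `a` of level `k` is initialized. -/
abbrev Initialized (a : ℕ) : Prop := f .idx k a < f .cnt k 0 ∧ f .lst k (f .idx k a) = a

/-- The content of the cell `a` of level `k`. -/
def cell (a : ℕ) : ℕ := if Initialized f k a then f .val k a else 0

/-- The list of initialized cells has no repetition, and these cells are less than `S`. -/
def BankOk (S : ℕ) : Prop := ∀ j < f .cnt k 0, f .idx k (f .lst k j) = j ∧ f .lst k j < S

end

/-- The list enumerates, without repetition, cells below `S` other than `a`; so there is room for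
one more entry within the same bound `S`. -/
theorem BankOk.cnt_lt {f : Arr → ℕ → ℕ → ℕ} {k S a : ℕ} (h : BankOk f k S) (ha : a < S)
    (hn : ¬ Initialized f k a) : f .cnt k 0 < S := by
  have h1 : ((Finset.range (f .cnt k 0)).image (f .lst k)).card = f .cnt k 0 := by
    rw [Finset.card_image_of_injOn, Finset.card_range]
    intro i hi j hj hij
    have := (h i (by simpa using hi)).1
    rw [hij, (h j (by simpa using hj)).1] at this
    exact this.symm
  have h2 : (Finset.range (f .cnt k 0)).image (f .lst k) ⊆ (Finset.range S).erase a := by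
    intro b hb
    obtain ⟨j, hj, rfl⟩ := Finset.mem_image.1 hb
    have := h j (by simpa using hj)
    refine Finset.mem_erase.2 ⟨?_, by simpa using this.2⟩
    intro hja
    exact hn ⟨by rw [← hja, this.1]; simpa using hj, by rw [← hja, this.1]⟩
  have h3 := Finset.card_le_card h2
  rw [h1, Finset.card_erase_of_mem (by simpa using ha), Finset.card_range] at h3
  omega

theorem cell_congr {f f' : Arr → ℕ → ℕ → ℕ} {k : ℕ}
    (h : ∀ A ∈ [Arr.val, .idx, .lst, .cnt], ∀ i, f' A k i = f A k i) : cell f' k = cell f k := by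
  funext a
  have hI : Initialized f' k a ↔ Initialized f k a := by
    unfold Initialized
    rw [h .idx (by simp), h .lst (by simp), h .cnt (by simp)]
  simp only [cell, hI, h .val (by simp)]

theorem bankOk_congr {f f' : Arr → ℕ → ℕ → ℕ} {k S : ℕ}
    (h : ∀ A ∈ [Arr.val, .idx, .lst, .cnt], ∀ i, f' A k i = f A k i) (hf : BankOk f k S) :
    BankOk f' k S := by
  intro j hj
  rw [h .lst (by simp), h .idx (by simp)]
  exact hf j (by rwa [h .cnt (by simp)] at hj)

theorem BankOk.insert {f f' : Arr → ℕ → ℕ → ℕ} {k S a v : ℕ} (h : BankOk f k S) (ha : a < S)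
    (hn : ¬ Initialized f k a) (hcnt : f' .cnt k 0 = f .cnt k 0 + 1)
    (hlst : ∀ j, f' .lst k j = if j = f .cnt k 0 then a else f .lst k j)
    (hidx : ∀ b, f' .idx k b = if b = a then f .cnt k 0 else f .idx k b)
    (hval : ∀ b, f' .val k b = if b = a then v else f .val k b) :
    BankOk f' k S ∧ cell f' k = Function.update (cell f k) a v := by
  have hla : ∀ j < f .cnt k 0, f .lst k j ≠ a := fun j hj he =>
    hn ⟨by rw [← he, (h j hj).1]; exact hj, by rw [← he, (h j hj).1]⟩
  refine ⟨fun j hj => ?_, funext fun b => ?_⟩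
  · rw [hcnt] at hj
    rw [hlst]
    split_ifs with hjc
    · rw [hidx, if_pos rfl]; exact ⟨hjc.symm, ha⟩
    · rw [hidx, if_neg (hla j (by omega))]
      exact h j (by omega)
  · have hI : Initialized f' k b ↔ b = a ∨ Initialized f k b := by
      unfold Initialized
      rw [hidx, hcnt, hlst]
      by_cases hb : b = a
      · simp [hb]
      · simp only [hb, if_false, false_or]
        constructor
        · rintro ⟨h1, h2⟩
          split_ifs at h2 with h3
          · exact absurd h2.symm hb
          · exact ⟨by omega, h2⟩
        · rintro ⟨h1, h2⟩
          rw [if_neg (by omega)]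
          exact ⟨by omega, h2⟩
    by_cases hb : b = a
    · have := hI.2 (Or.inl hb)
      subst hb
      simp only [cell, if_pos this, hval, if_true, Function.update_self]
    · simp only [cell, hI, hval, hb, if_false, false_or, ne_eq, not_false_eq_true,
        Function.update_of_ne]

theorem BankOk.overwrite {f f' : Arr → ℕ → ℕ → ℕ} {k S a v : ℕ} (h : BankOk f k S)
    (hi : Initialized f k a) (hcnt : f' .cnt k 0 = f .cnt k 0)
    (hlst : ∀ j, f' .lst k j = f .lst k j) (hidx : ∀ b, f' .idx k b = f .idx k b)
    (hval : ∀ b, f' .val k b = if b = a then v else f .val k b) :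
    BankOk f' k S ∧ cell f' k = Function.update (cell f k) a v := by
  refine ⟨fun j hj => ?_, funext fun b => ?_⟩
  · rw [hlst, hidx]; exact h j (hcnt ▸ hj)
  · have hI : Initialized f' k b ↔ Initialized f k b := by
      unfold Initialized
      rw [hidx, hcnt, hlst]
    by_cases hb : b = a
    · subst hb
      simp only [cell, if_pos (hI.2 hi), hval, if_true, Function.update_self]
    · simp only [cell, hI, hval, hb, if_false, ne_eq, not_false_eq_true,
        Function.update_of_ne]

/-- Set `r0` to `1` if the cell `a` of the current level is initialized and to `0` otherwise. -/
def checkCell (a : Reg) : Cmd :=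
  .basic (.const .r0 0) ;; .basic (.get .idx .r1 .lev a) ;; .basic (.get .cnt .r2 .lev .zero) ;;
  .basic (.arith .sub .r2 .r2 .r1) ;;
  .ifZero .r2 .skip
    (.basic (.get .lst .r2 .lev .r1) ;; .basic (.arith .sub .r3 .r2 a) ;;
      .ifZero .r3 (.basic (.arith .sub .r3 a .r2) ;; .ifZero .r3 (.basic (.const .r0 1)) .skip)
        .skip)

/-- `d := cell a` -/
def readCell (d a : Reg) : Cmd :=
  checkCell a ;; .ifZero .r0 (.basic (.const d 0)) (.basic (.get .val d .lev a))

/-- `cell a := v` -/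
def writeCell (a v : Reg) : Cmd :=
  checkCell a ;;
  .ifZero .r0
    (.ifZero v .skip
      (.basic (.get .cnt .r2 .lev .zero) ;; .basic (.put .lst .lev .r2 a) ;;
        .basic (.put .idx .lev a .r2) ;; .basic (.put .val .lev a v) ;;
        .basic (.arithConst .add .r2 .r2 1) ;; .basic (.put .cnt .lev .zero .r2)))
    (.basic (.put .val .lev a v))

section
variable {T : InputTable} {W R : ℕ} {K : State → Prop} {s : State}

/-- The arrays may contain remnants of an earlier use of the level; the test is correct whatever
they hold. Equality of two numbers is tested by two truncated subtractions. -/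
theorem wp_checkCell {a : Reg} (ha : a ∉ [Reg.r0, .r1, .r2, .r3]) (hk : s.reg .lev < T.cols)
    (h0 : s.reg .zero = 0) (hW : 1 ≤ W)
    (hK : ∀ s', Frame [.r0, .r1, .r2, .r3] [] 0 40 s s' →
      s'.reg .r0 = (if Initialized s.arr (s.reg .lev) (s.reg a) then 1 else 0) → K s') :
    wp T W R (checkCell a) K s := by
  simp only [List.mem_cons, List.not_mem_nil, or_false, not_or] at ha
  obtain ⟨ha0, ha1, ha2, ha3⟩ := ha
  simp only [checkCell, wp_seq, wp_basic, wp_ifZero, wp_skip, Basic.Ok, Basic.exec, State.setReg,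
    State.tick, ArithOp.eval]
  simp [Function.update_apply, hk, h0, ha0, ha1, ha2, ha3, hW]
  refine ⟨fun h => ?_, fun h => ⟨fun h' => ⟨fun h'' => ?_, fun h'' => ?_⟩, fun h' => ?_⟩⟩
  all_goals
    refine hK _ ⟨fun r hr => ?_, fun _ _ _ _ => rfl, rfl, rfl, ?_⟩ ?_
    · simp only [List.mem_cons, List.not_mem_nil, or_false, not_or] at hr
      simp [hr]
    · simp [add_assoc]
    · simp only [Initialized]
      simp only [Function.update_self, ne_eq, reduceCtorEq, not_false_eq_true,
        Function.update_of_ne]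
      first
      | rw [if_neg (by rintro ⟨p, q⟩; omega)]
      | rw [if_pos ⟨by omega, by omega⟩]

theorem wp_readCell {d a : Reg} (ha : a ∉ [Reg.r0, .r1, .r2, .r3])
    (hk : s.reg .lev < T.cols) (h0 : s.reg .zero = 0) (hW : 1 ≤ W)
    (hK : ∀ s', Frame [.r0, .r1, .r2, .r3, d] [] 0 60 s s' →
      s'.reg d = cell s.arr (s.reg .lev) (s.reg a) → K s') :
    wp T W R (readCell d a) K s := by
  rw [readCell, wp_seq]
  refine wp_checkCell ha hk h0 hW fun s1 f1 h1 => ?_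
  have e1 := f1.reg .lev (by simp)
  have e2 := f1.reg a ha
  have e3 : s1.arr = s.arr := by funext A l i; exact f1.arr A l i (by simp)
  simp only [wp_seq, wp_basic, wp_ifZero, wp_skip, Basic.Ok, Basic.exec, State.setReg,
    State.tick, h1, e1, e2, e3]
  have ht := f1.time
  refine ⟨fun h => ⟨by omega, ?_⟩, fun h => ⟨hk, ?_⟩⟩
  all_goals
    refine hK _ ⟨fun r hr => ?_, fun A l i _ => ?_, f1.cur, f1.out, ?_⟩ ?_
    · simp only [List.mem_cons, List.not_mem_nil, or_false, not_or] at hr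
      simp [hr, f1.reg]
    · simp [e3]
    · dsimp only; omega
    · rw [cell]
      by_cases hi : Initialized s.arr (s.reg .lev) (s.reg a)
      · rw [if_pos hi] at h ⊢
        first
        | exact absurd h one_ne_zero
        | simp
      · rw [if_neg hi] at h ⊢
        first
        | exact absurd rfl h
        | simp

/-- A zero written to an uninitialized cell is dropped. This is forced by the notion of space: the
simulated program may write `0` to an address beyond `S`, where registering the cell would leave the
arrays. -/
theorem wp_writeCell {a v : Reg} (ha : a ∉ [Reg.r0, .r1, .r2, .r3])
    (hv : v ∉ [Reg.r0, .r1, .r2, .r3]) (hk : s.reg .lev < T.cols) (h0 : s.reg .zero = 0)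
    (hW : 1 ≤ W) {S : ℕ} (hb : BankOk s.arr (s.reg .lev) S) (hS : S < R)
    (haS : s.reg v ≠ 0 → s.reg a < S) (hSW : S ≤ W)
    (hK : ∀ s', Frame [.r0, .r1, .r2, .r3] [.val, .idx, .lst, .cnt] (s.reg .lev) 100 s s' →
      BankOk s'.arr (s.reg .lev) S →
      cell s'.arr (s.reg .lev) = Function.update (cell s.arr (s.reg .lev)) (s.reg a) (s.reg v) →
      K s') :
    wp T W R (writeCell a v) K s := by
  rw [writeCell, wp_seq]
  refine wp_checkCell ha hk h0 hW fun s1 f1 h1 => ?_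
  have e1 := f1.reg .lev (by simp)
  have e2 := f1.reg a ha
  have e3 : s1.arr = s.arr := by funext A l i; exact f1.arr A l i (by simp)
  have e4 := f1.reg v hv
  have e5 := f1.reg .zero (by simp)
  have ht := f1.time
  simp only [List.mem_cons, List.not_mem_nil, or_false, not_or] at ha hv
  obtain ⟨ha0, ha1, ha2, ha3⟩ := ha
  obtain ⟨hv0, hv1, hv2, hv3⟩ := hv
  simp only [wp_seq, wp_basic, wp_ifZero, wp_skip, Basic.Ok, Basic.exec, State.setReg,
    State.setArr, State.tick, h1, e1, e2, e3, e4, e5, ArithOp.eval]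
  simp only [ite_eq_right_iff, one_ne_zero, imp_false, ne_eq, ite_eq_left_iff, not_not]
  refine ⟨fun hn => ⟨fun hv => ?_, fun hv => ?_⟩, fun hi => ?_⟩
  · refine hK _ ⟨fun r hr => ?_, fun A l i _ => ?_, f1.cur, f1.out, ?_⟩ ?_ ?_
    · simpa using f1.reg r hr
    · simp [e3]
    · dsimp only; omega
    · simpa [e3] using hb
    · simp only [e3, hv]
      rw [eq_comm, Function.update_eq_self_iff]
      simp [cell, hn]
  · have haS' := haS hv
    have hc := hb.cnt_lt haS' hn
    have hlev : (Reg.r2 = Reg.lev) = False := by simp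
    refine ⟨hk, ⟨?_, ?_⟩, ⟨?_, ?_⟩, ⟨?_, ?_⟩, ⟨hW, ?_⟩, ⟨?_, ?_⟩, ?_⟩
    · simpa [e1] using hk
    · left; simp [h0]; omega
    · simpa [e1] using hk
    · left; simp [ha2, e2]; omega
    · simpa [e1] using hk
    · left; simp [ha2, e2]; omega
    · right; simp [h0]; omega
    · simpa [e1] using hk
    · left; simp [e5, h0]; omega
    · refine hK _ ⟨fun r hr => ?_, fun A l i hA => ?_, f1.cur, f1.out, ?_⟩ ?_ ?_
      · simp only [List.mem_cons, List.not_mem_nil, or_false, not_or] at hr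
        simp [hr, f1.reg]
      · simp [e1]
        simp at hA
        split_ifs <;> first | rfl | (exfalso; simp_all)
      · dsimp only; omega
      · exact (hb.insert (v := s.reg v) haS' hn (by simp [e1, e5, h0])
          (by simp [e1, e2, ha2, h0]) (by simp [e1, e2, ha2, h0])
          (by simp [e1, e2, e4, ha2, hv2])).1
      · exact (hb.insert (v := s.reg v) haS' hn (by simp [e1, e5, h0])
          (by simp [e1, e2, ha2, h0]) (by simp [e1, e2, ha2, h0])
          (by simp [e1, e2, e4, ha2, hv2])).2
  · have hi' : Initialized s.arr (s.reg .lev) (s.reg a) := by simpa using hi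
    have haS' : s.reg a < S := by
      have := (hb _ hi'.1).2
      rwa [hi'.2] at this
    refine ⟨⟨hk, Or.inl (by omega)⟩, hK _ ⟨fun r hr => ?_, fun A l i hA => ?_, f1.cur, f1.out, ?_⟩
      ?_ ?_⟩
    · exact f1.reg r hr
    · simp at hA
      dsimp only
      split_ifs with hh
      · exact absurd hh.2.1 (by tauto)
      · rfl
    · dsimp only; omega
    · exact (hb.overwrite (v := s.reg v) hi' (by simp) (by simp) (by simp) (by simp)).1
    · exact (hb.overwrite (v := s.reg v) hi' (by simp) (by simp) (by simp) (by simp)).2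

end

/-! ### Simulation of a program on a level -/

/-- The effect of an instruction of the simulated program on the memory of the current level. -/
def instrCmd : Instr → Cmd
  | .const d c => .basic (.const .r5 d) ;; .basic (.const .r6 c) ;; writeCell .r5 .r6
  | .arith o d a b => .basic (.const .r5 a) ;; readCell .r6 .r5 ;; .basic (.const .r5 b) ;;
      readCell .r7 .r5 ;; .basic (.arith o .r6 .r6 .r7) ;; .basic (.const .r5 d) ;;
      writeCell .r5 .r6
  | .load d a => .basic (.const .r5 a) ;; readCell .r6 .r5 ;; readCell .r7 .r6 ;;
      .basic (.const .r5 d) ;; writeCell .r5 .r7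
  | .store a b => .basic (.const .r5 a) ;; readCell .r6 .r5 ;; .basic (.const .r5 b) ;;
      readCell .r7 .r5 ;; writeCell .r6 .r7
  | .jump l => .basic (.const .npc l)
  | .jumpZero a l => .basic (.const .r5 a) ;; readCell .r6 .r5 ;;
      .ifZero .r6 (.basic (.const .npc l)) .skip
  | .rows d => .basic (.get .siz .r6 .lev .zero) ;; .basic (.const .r5 d) ;; writeCell .r5 .r6
  | .cols d => .basic (.arithConst .add .r6 .num 0) ;; .basic (.const .r5 d) ;;
      writeCell .r5 .r6
  | .entry d a b => .basic (.const .r5 a) ;; readCell .r6 .r5 ;; .basic (.const .r5 b) ;;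
      readCell .r7 .r5 ;; .basic (.get .siz .r8 .lev .zero) ;;
      .basic (.arith .sub .r8 .r8 .r6) ;; .basic (.arith .sub .r9 .num .r7) ;;
      .ifZero .r8 (.basic (.const .r6 0)) (.ifZero .r9 (.basic (.const .r6 0))
        (.basic (.get .edg .r6 .lev .r6) ;; .basic (.entry .r6 .r6 .r7))) ;;
      .basic (.const .r5 d) ;; writeCell .r5 .r6
  | .write a => .basic (.const .r5 a) ;; readCell .r6 .r5 ;;
      .basic (.arith .sub .r9 .num .r6) ;;
      .ifZero .r9 .skip (.basic (.put .out .lev .r6 .zero))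
  | .emit => .basic (.const .busy 0) ;; .basic (.const .event 1)

/-- The constants of an instruction are at most `W`. -/
def Instr.Small (W : ℕ) : Instr → Prop
  | .const d c => d ≤ W ∧ c ≤ W
  | .arith _ d a b => d ≤ W ∧ a ≤ W ∧ b ≤ W
  | .load d a => d ≤ W ∧ a ≤ W
  | .store a b => a ≤ W ∧ b ≤ W
  | .jump l => l ≤ W
  | .jumpZero a l => a ≤ W ∧ l ≤ W
  | .rows d => d ≤ W
  | .cols d => d ≤ W
  | .entry d a b => d ≤ W ∧ a ≤ W ∧ b ≤ W
  | .write a => a ≤ W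
  | .emit => True

/-- The marks of the level `k`: the vertices in the list `l` are marked by `0`. -/
def Marks (f : Arr → ℕ → ℕ → ℕ) (k n : ℕ) (l : List ℕ) : Prop :=
  ∀ v < n, f .out k v = if v ∈ l then 0 else 1

/-- The table `H` is what the simulated program of level `k` sees of the table `T`. -/
structure SubTable (T H : InputTable) (f : Arr → ℕ → ℕ → ℕ) (k : ℕ) : Prop where
  rows : f .siz k 0 = H.rows
  entry : ∀ i x, H.entry i x = if i < H.rows ∧ x < H.cols then T.entry (f .edg k i) x else 0

/-- The registers that the simulation may change. -/
def simRegs : List Reg :=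
  [.r0, .r1, .r2, .r3, .r5, .r6, .r7, .r8, .r9, .npc, .busy, .event]

/-- The arrays that the simulation may change. -/
def simArrs : List Arr := [.val, .idx, .lst, .cnt, .out, .pcs]

/-- What holds after the simulation of one step from `c` to `c'`. -/
structure StepPost (n S k : ℕ) (c c' : Configuration) (s s' : State) : Prop where
  frame : Frame simRegs simArrs k 500 s s'
  bank : BankOk s'.arr k S
  cell : cell s'.arr k = c'.mem
  pc : s'.reg .npc = c'.pc
  event : (c'.out = c.out ∧ s'.reg .busy = s.reg .busy ∧ Marks s'.arr k n c'.cur) ∨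
    (c'.out = c.out ++ [c.cur] ∧ c'.cur = [] ∧ s'.reg .busy = 0 ∧ s'.reg .event = 1 ∧
      Marks s'.arr k n c.cur)

namespace State
variable (s : State) (d : Reg) (v t : ℕ)
@[simp] theorem setReg_reg : (s.setReg d v t).reg = Function.update s.reg d v := rfl
@[simp] theorem setReg_arr : (s.setReg d v t).arr = s.arr := rfl
@[simp] theorem setReg_cur : (s.setReg d v t).cur = s.cur := rfl
@[simp] theorem setReg_out : (s.setReg d v t).out = s.out := rfl
@[simp] theorem setReg_time : (s.setReg d v t).time = s.time + t := rfl
@[simp] theorem tick_reg : (s.tick t).reg = s.reg := rfl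
@[simp] theorem tick_arr : (s.tick t).arr = s.arr := rfl
@[simp] theorem tick_cur : (s.tick t).cur = s.cur := rfl
@[simp] theorem tick_out : (s.tick t).out = s.out := rfl
@[simp] theorem tick_time : (s.tick t).time = s.time + t := rfl
end State

theorem Frame.refl (D E k) (s : State) : Frame D E k 0 s s :=
  ⟨fun _ _ => rfl, fun _ _ _ _ => rfl, rfl, rfl, le_rfl⟩

theorem Frame.setReg {D E k t s0 s d} (h : Frame D E k t s0 s) (hd : d ∈ D) (v u : ℕ) :
    Frame D E k (t + u) s0 (s.setReg d v u) where
  reg := fun r hr => by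
    have : r ≠ d := fun h => hr (h ▸ hd)
    simp [this, h.reg r hr]
  arr := h.arr
  cur := h.cur
  out := h.out
  time := by have := h.time; simp only [State.setReg_time]; omega

theorem Frame.le {D E k t t' s0 s} (h : Frame D E k t s0 s) (ht : t ≤ t') :
    Frame D E k t' s0 s := ⟨h.reg, h.arr, h.cur, h.out, h.time.trans (by omega)⟩

theorem Frame.tick {D E k t s0 s} (h : Frame D E k t s0 s) (u : ℕ) :
    Frame D E k (t + u) s0 (s.tick u) where
  reg := h.reg
  arr := h.arr
  cur := h.cur
  out := h.out
  time := by have := h.time; simp only [State.tick_time]; omega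

theorem Frame.arr_eq {D k t s0 s} (h : Frame D [] k t s0 s) : s.arr = s0.arr := by
  funext A l i; exact h.arr A l i (by simp)

theorem Frame.marks {D E k t s s' n l} (h : Frame D E k t s s') (hE : Arr.out ∉ E)
    (hm : Marks s.arr k n l) : Marks s'.arr k n l := fun v hv => by
  rw [h.arr _ _ _ (by simp [hE]), hm v hv]

/-- The auxiliary registers of the simulation. -/
def tmpRegs : List Reg := [.r0, .r1, .r2, .r3, .r5, .r6, .r7, .r8, .r9]

/-- What is needed to simulate one instruction in the configuration `c`. -/
structure StepPre (T H : InputTable) (W R S k : ℕ) (c : Configuration) (s : State) : Prop where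
  lev : s.reg .lev = k
  lt : k < T.cols
  zero : s.reg .zero = 0
  num : s.reg .num = H.cols
  word : 1 ≤ W
  space : S < R
  word_space : S ≤ W
  len : H.cols ≤ R
  entry : ∀ i x, T.entry i x ≤ W
  table : SubTable T H s.arr k
  bank : BankOk s.arr k S
  cell : cell s.arr k = c.mem
  marks : Marks s.arr k H.cols c.cur
  pc : s.reg .npc = c.pc + 1

section
variable {T H : InputTable} {W R S k t : ℕ} {s0 s : State} {c : Configuration}
  {K : State → Prop}

namespace StepPre

theorem wp_read (p : StepPre T H W R S k c s0) (f : Frame tmpRegs [] k t s0 s) {d a : Reg}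
    (ha : a ∉ [Reg.r0, .r1, .r2, .r3]) (hd : d ∈ tmpRegs)
    (hK : ∀ s', Frame tmpRegs [] k (t + 60) s0 s' → s'.reg d = c.mem (s.reg a) →
      (∀ r, r ∉ [Reg.r0, .r1, .r2, .r3, d] → s'.reg r = s.reg r) → K s') :
    wp T W R (readCell d a) K s := by
  have hl : s.reg .lev = k := (f.reg .lev (by simp [tmpRegs])).trans p.lev
  have hz : s.reg .zero = 0 := (f.reg .zero (by simp [tmpRegs])).trans p.zero
  refine wp_readCell ha (hl ▸ p.lt) hz p.word fun s' f' h' => ?_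
  refine hK s' (f.trans ⟨fun r hr => f'.reg r fun h => hr ?_, fun A l i _ => f'.arr A l i (by simp),
    f'.cur, f'.out, f'.time⟩) ?_ f'.reg
  · simp only [List.mem_cons, List.not_mem_nil, or_false] at h
    rcases h with rfl | rfl | rfl | rfl | rfl
    all_goals first | exact hd | simp [tmpRegs]
  · rw [h', f.arr_eq, hl, p.cell]

theorem wp_write (p : StepPre T H W R S k c s0) (f : Frame tmpRegs [] k t s0 s) (ht : t ≤ 390)
    {a v : Reg} (ha : a ∉ [Reg.r0, .r1, .r2, .r3]) (hv : v ∉ [Reg.r0, .r1, .r2, .r3])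
    (hmem : s.reg v ≠ 0 → s.reg a < S)
    (hK : ∀ s', StepPost H.cols S k c (c.set (s.reg a) (s.reg v)) s0 s' → K s') :
    wp T W R (writeCell a v) K s := by
  have hl : s.reg .lev = k := (f.reg .lev (by simp [tmpRegs])).trans p.lev
  have hz : s.reg .zero = 0 := (f.reg .zero (by simp [tmpRegs])).trans p.zero
  refine wp_writeCell (S := S) ha hv (hl ▸ p.lt) hz p.word
    (by simpa [hl, f.arr_eq] using p.bank) p.space hmem p.word_space fun s' f1 hb1 hc1 => ?_
  rw [hl] at f1 hb1
  rw [hl, f.arr_eq] at hc1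
  have ft := f1.time
  have ft0 := f.time
  refine hK _ ⟨⟨fun r hr => ?_, fun A l i hA => ?_, f1.cur.trans f.cur, f1.out.trans f.out,
    by omega⟩, hb1, ?_, ?_, Or.inl ⟨rfl, ?_, ?_⟩⟩
  · rw [f1.reg r (fun h => hr (by simp [simRegs] at h ⊢; tauto)),
      f.reg r (fun h => hr (by simp [simRegs, tmpRegs] at h ⊢; tauto))]
  · rw [f1.arr A l i (fun h => hA ⟨by have := h.1; simp [simArrs] at this ⊢; tauto, h.2⟩),
      f.arr_eq]
  · rw [hc1, p.cell]; rfl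
  · rw [f1.reg _ (by simp), f.reg _ (by simp [tmpRegs]), p.pc]; rfl
  · rw [f1.reg _ (by simp), f.reg _ (by simp [tmpRegs])]
  · exact f1.marks (by simp) (f.marks (by simp) p.marks)

/-- Every instruction is simulated in constant time. The assumption `hmem` concerns the memory after
the instruction; read at the target cell, it bounds both the value to be written and, if that value
is not `0`, the address. -/
theorem wp_instrCmd (p : StepPre T H W R S k c s) (i : Instr) (hi : Instr.Small W i)
    (hmem : ∀ a, (i.exec H c).mem a ≤ W ∧ ((i.exec H c).mem a ≠ 0 → a < S))
    (hK : ∀ s', StepPost H.cols S k c (i.exec H c) s s' → K s') :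
    wp T W R (instrCmd i) K s := by
  have f0 := Frame.refl tmpRegs [] k s
  cases i with
  | const d v =>
    simp only [instrCmd, wp_seq, wp_basic, Basic.Ok, Basic.exec]
    have h := hmem d
    simp only [Instr.exec, Configuration.set, Function.update_self] at h
    refine ⟨hi.1, hi.2, p.wp_write ((f0.setReg (by simp [tmpRegs]) _ _).setReg
      (by simp [tmpRegs]) _ _) (by omega) (by simp) (by simp) (by simpa using h.2) ?_⟩
    simpa [Instr.exec] using hK
  | arith o d a b =>
    have h := hmem d
    simp only [Instr.exec, Configuration.set, Function.update_self] at h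
    simp only [instrCmd, wp_seq, wp_basic, Basic.Ok, Basic.exec]
    refine ⟨hi.2.1, p.wp_read (f0.setReg (by simp [tmpRegs]) _ _) (by simp) (by simp [tmpRegs])
      fun s1 f1 h1 g1 => ?_⟩
    simp only [wp_seq, wp_basic, Basic.Ok, Basic.exec]
    refine ⟨hi.2.2, p.wp_read (f1.setReg (by simp [tmpRegs]) _ _) (by simp) (by simp [tmpRegs])
      fun s2 f2 h2 g2 => ?_⟩
    simp only [State.setReg_reg, Function.update_self] at h1 h2
    have e6 : s2.reg .r6 = c.mem a := by rw [g2 _ (by simp)]; simpa using h1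
    simp only [wp_seq, wp_basic, Basic.Ok, Basic.exec, e6, h2]
    refine ⟨Or.inr h.1, hi.1, p.wp_write ((f2.setReg (by simp [tmpRegs]) _ _).setReg
      (by simp [tmpRegs]) _ _) (by omega) (by simp) (by simp) (by simpa using h.2) ?_⟩
    simpa [Instr.exec] using hK
  | load d a =>
    have h := hmem d
    simp only [Instr.exec, Configuration.set, Function.update_self] at h
    simp only [instrCmd, wp_seq, wp_basic, Basic.Ok, Basic.exec]
    refine ⟨hi.2, p.wp_read (f0.setReg (by simp [tmpRegs]) _ _) (by simp) (by simp [tmpRegs])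
      fun s1 f1 h1 g1 => ?_⟩
    simp only [wp_seq, wp_basic, Basic.Ok, Basic.exec]
    refine p.wp_read f1 (by simp) (by simp [tmpRegs]) fun s2 f2 h2 g2 => ?_
    simp only [State.setReg_reg, Function.update_self] at h1 h2
    rw [h1] at h2
    simp only [wp_seq, wp_basic, Basic.Ok, Basic.exec]
    refine ⟨hi.1, p.wp_write (f2.setReg (by simp [tmpRegs]) _ _) (by omega) (by simp) (by simp)
      (by simpa [h2] using h.2) ?_⟩
    simpa [Instr.exec, h2] using hK
  | store a b =>
    have h := hmem (c.mem a)
    simp only [Instr.exec, Configuration.set, Function.update_self] at h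
    simp only [instrCmd, wp_seq, wp_basic, Basic.Ok, Basic.exec]
    refine ⟨hi.1, p.wp_read (f0.setReg (by simp [tmpRegs]) _ _) (by simp) (by simp [tmpRegs])
      fun s1 f1 h1 g1 => ?_⟩
    simp only [wp_seq, wp_basic, Basic.Ok, Basic.exec]
    refine ⟨hi.2, p.wp_read (f1.setReg (by simp [tmpRegs]) _ _) (by simp) (by simp [tmpRegs])
      fun s2 f2 h2 g2 => ?_⟩
    simp only [State.setReg_reg, Function.update_self] at h1 h2
    have e6 : s2.reg .r6 = c.mem a := by rw [g2 _ (by simp)]; simpa using h1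
    refine p.wp_write f2 (by omega) (by simp) (by simp) (by simpa [h2, e6] using h.2) ?_
    simpa [Instr.exec, h2, e6] using hK
  | jump l =>
    simp only [instrCmd, wp_seq, wp_basic, Basic.Ok, Basic.exec]
    refine ⟨hi, hK _ ⟨((Frame.refl simRegs simArrs k s).setReg (by simp [simRegs]) _ _).le (by omega), p.bank, p.cell, by simp [Instr.exec],
      Or.inl ⟨rfl, by simp, p.marks⟩⟩⟩
  | jumpZero a l =>
    simp only [instrCmd, wp_seq, wp_basic, Basic.Ok, Basic.exec]
    refine ⟨hi.1, p.wp_read (f0.setReg (by simp [tmpRegs]) _ _) (by simp) (by simp [tmpRegs])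
      fun s1 f1 h1 g1 => ?_⟩
    simp only [State.setReg_reg, Function.update_self] at h1
    have f2 : Frame simRegs simArrs k 100 s s1 := f1.weaken (by simp [tmpRegs, simRegs])
      (by simp) (by omega)
    simp only [wp_ifZero, wp_basic, wp_skip, Basic.Ok, Basic.exec, h1]
    refine ⟨fun h0 => ⟨hi.2, hK _ ⟨((f2.tick 1).setReg (by simp [simRegs]) _ _).le (by omega), by simpa [f1.arr_eq] using p.bank,
      by simpa [f1.arr_eq, Instr.exec] using p.cell, by simp [Instr.exec, h0],
      Or.inl ⟨rfl, by simpa using f1.reg _ (by simp [tmpRegs]), f1.marks (by simp) p.marks⟩⟩⟩,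
      fun h0 => hK _ ⟨((f2.tick 1).tick 1).le (by omega), by simpa [f1.arr_eq] using p.bank,
      by simpa [f1.arr_eq, Instr.exec] using p.cell, ?_,
      Or.inl ⟨rfl, by simpa using f1.reg _ (by simp [tmpRegs]), f1.marks (by simp) p.marks⟩⟩⟩
    simp [Instr.exec, h0, f1.reg .npc (by simp [tmpRegs]), p.pc]
  | rows d =>
    have h := hmem d
    simp only [Instr.exec, Configuration.set, Function.update_self] at h
    simp only [instrCmd, wp_seq, wp_basic, Basic.Ok, Basic.exec, p.lev, p.zero, p.table.rows]
    refine ⟨p.lt, hi, p.wp_write ((f0.setReg (by simp [tmpRegs]) _ _).setReg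
      (by simp [tmpRegs]) _ _) (by omega) (by simp) (by simp) (by simpa using h.2) ?_⟩
    simpa [Instr.exec] using hK
  | cols d =>
    have h := hmem d
    simp only [Instr.exec, Configuration.set, Function.update_self] at h
    simp only [instrCmd, wp_seq, wp_basic, Basic.Ok, Basic.exec, p.num, ArithOp.eval, add_zero]
    refine ⟨⟨Nat.zero_le _, Or.inl le_rfl⟩, hi, p.wp_write ((f0.setReg (by simp [tmpRegs]) _ _).setReg
      (by simp [tmpRegs]) _ _) (by omega) (by simp) (by simp) (by simpa using h.2) ?_⟩
    simpa [Instr.exec] using hK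
  | entry d a b =>
    have h := hmem d
    simp only [Instr.exec, Configuration.set, Function.update_self] at h
    simp only [instrCmd, wp_seq, wp_basic, Basic.Ok, Basic.exec]
    refine ⟨hi.2.1, p.wp_read (f0.setReg (by simp [tmpRegs]) _ _) (by simp) (by simp [tmpRegs])
      fun s1 f1 h1 g1 => ?_⟩
    simp only [wp_seq, wp_basic, Basic.Ok, Basic.exec]
    refine ⟨hi.2.2, p.wp_read (f1.setReg (by simp [tmpRegs]) _ _) (by simp) (by simp [tmpRegs])
      fun s2 f2 h2 g2 => ?_⟩
    simp only [State.setReg_reg, Function.update_self] at h1 h2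
    have e6 : s2.reg .r6 = c.mem a := by rw [g2 _ (by simp)]; simpa using h1
    have el : s2.reg .lev = k := (f2.reg _ (by simp [tmpRegs])).trans p.lev
    have ez : s2.reg .zero = 0 := (f2.reg _ (by simp [tmpRegs])).trans p.zero
    have en : s2.reg .num = H.cols := (f2.reg _ (by simp [tmpRegs])).trans p.num
    have he := p.table.entry (c.mem a) (c.mem b)
    have f3 := ((f2.setReg (d := .r8) (by simp [tmpRegs]) (H.rows) 8).setReg (d := .r8)
      (by simp [tmpRegs]) (H.rows - c.mem a) 1).setReg (d := .r9) (by simp [tmpRegs])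
      (H.cols - c.mem b) 1
    -- The common tail of three branches: row out of range, column out of range, and a genuine
    -- lookup. The range has to be checked because the table of the hypergraph is `0` outside,
    -- whereas the input that is consulted need not be.
    have key : ∀ s3 t', Frame tmpRegs [] k t' s s3 → t' ≤ 300 →
        s3.reg .r6 = H.entry (c.mem a) (c.mem b) →
        wp T W R (.basic (.const .r5 d) ;; writeCell .r5 .r6) K s3 := fun s3 t' f3 ht h3 => by
      simp only [wp_seq, wp_basic, Basic.Ok, Basic.exec]
      refine ⟨hi.1, p.wp_write (f3.setReg (by simp [tmpRegs]) _ _) (by omega) (by simp)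
        (by simp) (by simpa [h3] using h.2) ?_⟩
      simpa [Instr.exec, h3] using hK
    simp only [wp_seq, wp_basic, wp_ifZero, Basic.Ok, Basic.exec, el, ez, f2.arr_eq,
      p.table.rows, en, State.setReg_reg, Function.update_self, ne_eq, reduceCtorEq,
      not_false_eq_true, Function.update_of_ne, e6, h2, ArithOp.eval, State.tick_reg,
      State.setReg_arr, State.tick_arr]
    refine ⟨p.lt, Or.inl (by simp), Or.inl (by simp), fun hr => ⟨by omega, ?_⟩,
      fun hr => ⟨fun hx => ⟨by omega, ?_⟩, fun hx => ⟨p.lt, p.entry _ _, ?_⟩⟩⟩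
    · simp only [wp_seq, wp_basic] at key
      refine key _ _ ((f3.tick 1).setReg (by simp [tmpRegs]) _ _) (by omega) ?_
      rw [he, if_neg (by omega)]
      simp
    · simp only [wp_seq, wp_basic] at key
      refine key _ _ ((((f3.tick 1).tick 1).setReg (d := .r6) (by simp [tmpRegs]) 0 1).tick 1)
        (by omega) ?_
      rw [he, if_neg (by omega)]
      simp
    · simp only [wp_seq, wp_basic] at key
      refine key _ _ ((((((f3.tick 1).tick 1).setReg (d := .r6) (by simp [tmpRegs]) _ 8).setReg
        (d := .r6) (by simp [tmpRegs]) _ 1).tick 1).tick 1) (by omega) ?_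
      rw [he, if_pos (by omega)]
      simp
  | write a =>
    simp only [instrCmd, wp_seq, wp_basic, Basic.Ok, Basic.exec]
    refine ⟨hi, p.wp_read (f0.setReg (by simp [tmpRegs]) _ _) (by simp) (by simp [tmpRegs])
      fun s1 f1 h1 g1 => ?_⟩
    simp only [State.setReg_reg, Function.update_self] at h1
    have el : s1.reg .lev = k := (f1.reg _ (by simp [tmpRegs])).trans p.lev
    have ez : s1.reg .zero = 0 := (f1.reg _ (by simp [tmpRegs])).trans p.zero
    have en : s1.reg .num = H.cols := (f1.reg _ (by simp [tmpRegs])).trans p.num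
    have f2 : Frame simRegs simArrs k 100 s s1 := f1.weaken (by simp [tmpRegs, simRegs])
      (by simp) (by omega)
    simp only [wp_seq, wp_ifZero, wp_basic, wp_skip, Basic.Ok, Basic.exec, h1, en, el, ez,
      State.setReg_reg, Function.update_self, ne_eq, reduceCtorEq,
      not_false_eq_true, Function.update_of_ne, State.tick_reg, ArithOp.eval]
    refine ⟨Or.inl (by simp), fun h0 => hK _ ⟨((f2.setReg (by simp [simRegs]) _ _).tick 1).le (by omega), by simpa [f1.arr_eq] using p.bank,
      by simpa [f1.arr_eq, Instr.exec] using p.cell, ?_, Or.inl ⟨rfl,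
        by simpa using f1.reg _ (by simp [tmpRegs]), fun v hv => ?_⟩⟩,
      fun h0 => ⟨⟨p.lt, by simp⟩,
        hK _ ⟨⟨fun r hr => ?_, fun A l i hA => ?_, f2.cur, f2.out, ?_⟩, ?_, ?_, ?_,
          Or.inl ⟨rfl, ?_, fun v hv => ?_⟩⟩⟩⟩
    · simp [Instr.exec, f1.reg .npc (by simp [tmpRegs]), p.pc]
    · have := p.marks v hv
      simp only [State.tick_arr, State.setReg_arr, f1.arr_eq, this, Instr.exec, List.mem_append,
        List.mem_singleton]
      have : v ≠ c.mem a := by omega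
      simp [this]
    · have : r ≠ .r9 := fun h => hr (by simp [simRegs, h])
      simp [State.setArr, this, f2.reg r hr]
    · simp only [State.setArr, State.tick, State.tick_arr, State.setReg_arr]
      rw [if_neg (fun h => hA ⟨by simp [simArrs, h.1], h.2.1⟩), f1.arr_eq]
    · have := f1.time
      simp only [State.setArr, State.tick, State.setReg]
      omega
    · simpa [State.setArr, BankOk, f1.arr_eq] using p.bank
    · refine (cell_congr fun A hA i => ?_).trans p.cell
      have : A ≠ .out := by rintro rfl; simp at hA
      simp [State.setArr, f1.arr_eq, this]
    · simp [Instr.exec, f1.reg .npc (by simp [tmpRegs]), p.pc, State.setArr]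
    · simpa [State.setArr] using f1.reg _ (by simp [tmpRegs])
    · have := p.marks v hv
      simp only [State.setArr, State.tick, State.setReg_arr, f1.arr_eq, this,
        Instr.exec, List.mem_append, List.mem_singleton]
      by_cases hva : v = c.mem a <;> simp [hva]
  | emit =>
    simp only [instrCmd, wp_seq, wp_basic, Basic.Ok, Basic.exec]
    refine ⟨by omega, p.word, hK _ ⟨(((Frame.refl simRegs simArrs k s).setReg
      (by simp [simRegs]) _ _).setReg (by simp [simRegs]) _ _).le (by omega), p.bank, p.cell, by simp [Instr.exec, p.pc],
      Or.inr ⟨rfl, rfl, by simp, by simp, p.marks⟩⟩⟩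

end StepPre

end

/-- Simulate the instruction number `pc` of the list, whose first instruction is in line `p`. -/
def dispatch : List Instr → ℕ → Cmd
  | [], _ => .basic (.const .busy 0) ;; .basic (.const .event 0)
  | i :: l, p => .ifZero .pc
      (.basic (.const .npc (p + 1)) ;; instrCmd i ;; .basic (.put .pcs .lev .zero .npc))
      (.basic (.arithConst .sub .pc .pc 1) ;; dispatch l (p + 1))

/-- Simulate one step of `P` on the current level. -/
def stepCmd (P : Program) : Cmd := .basic (.get .pcs .pc .lev .zero) ;; dispatch P 0

/-- Simulate `P` on the current level until it halts or completes a solution. Set `event` to `0`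
or `1`, respectively. -/
def simulate (P : Program) : Cmd :=
  .basic (.const .busy 1) ;; .loop .busy (stepCmd P)

/-- The context of the simulation of a program on the level `k`. -/
structure SimContext (T H : InputTable) (W R S k : ℕ) (s : State) : Prop where
  lev : s.reg .lev = k
  lt : k < T.cols
  zero : s.reg .zero = 0
  num : s.reg .num = H.cols
  word : 1 ≤ W
  space : S < R
  word_space : S ≤ W
  len : H.cols ≤ R
  entry : ∀ i x, T.entry i x ≤ W
  table : SubTable T H s.arr k

/-- The arrays of the level `k` represent the configuration `c` of a simulated program. -/
structure SimState (S k : ℕ) (c : Configuration) (f : Arr → ℕ → ℕ → ℕ) : Prop where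
  bank : BankOk f k S
  cell : cell f k = c.mem
  pc : f .pcs k 0 = c.pc

section
variable {T H : InputTable} {W R S k t : ℕ} {s s' : State} {c : Configuration} {P : Program}
  {K : State → Prop}

theorem SimContext.frame (h : SimContext T H W R S k s)
    (f : Frame (.pc :: simRegs) simArrs k t s s') : SimContext T H W R S k s' where
  lev := (f.reg _ (by simp [simRegs])).trans h.lev
  lt := h.lt
  zero := (f.reg _ (by simp [simRegs])).trans h.zero
  num := (f.reg _ (by simp [simRegs])).trans h.num
  word := h.word
  space := h.space
  word_space := h.word_space
  len := h.len
  entry := h.entry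
  table := ⟨(f.arr _ _ _ (by simp [simArrs])).trans h.table.rows, fun i x => by
    rw [h.table.entry, f.arr _ _ _ (by simp [simArrs])]⟩

/-- What holds after the simulation of one step from `c`. -/
def StepResult (P : Program) (H : InputTable) (S k : ℕ) (c : Configuration) (s' : State) : Prop :=
  (P.Halted c ∧ SimState S k c s'.arr ∧ s'.reg .busy = 0 ∧ s'.reg .event = 0) ∨
  (¬ P.Halted c ∧ SimState S k (P.step H c) s'.arr ∧
    (((P.step H c).out = c.out ∧ s'.reg .busy = 1 ∧ Marks s'.arr k H.cols (P.step H c).cur) ∨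
    ((P.step H c).out = c.out ++ [c.cur] ∧ (P.step H c).cur = [] ∧ s'.reg .busy = 0 ∧
      s'.reg .event = 1 ∧ Marks s'.arr k H.cols c.cur)))

/-- The simulated program is fixed, so its current instruction can be found by counting the program
counter down along the list; the cost is linear in the length of the program, hence constant for
every input. Reaching the end of the list means that the simulated program has halted. -/
theorem wp_dispatch (hP : ∀ i ∈ P, Instr.Small W i) (hPW : P.length ≤ W)
    (hmem : ∀ a, (P.step H c).mem a ≤ W ∧ ((P.step H c).mem a ≠ 0 → a < S))
    {l : List Instr} : ∀ {p : ℕ} {s : State}, l = P.drop p → SimContext T H W R S k s →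
      SimState S k c s.arr → Marks s.arr k H.cols c.cur → s.reg .pc + p = c.pc →
      s.reg .busy = 1 →
      (∀ s', Frame (.pc :: simRegs) simArrs k (600 + 4 * l.length) s s' →
        StepResult P H S k c s' → K s') →
      wp T W R (dispatch l p) K s := by
  induction l generalizing K with
  | nil =>
    intro p s hl h hs hm hpc hb hK
    have hlen : P.length ≤ p := by simpa using hl.symm
    simp only [dispatch, wp_seq, wp_basic, Basic.Ok, Basic.exec]
    refine ⟨by omega, by omega, hK _ (((Frame.refl (.pc :: simRegs) simArrs k s).setReg
      (by simp [simRegs]) _ _).setReg (by simp [simRegs]) _ _ |>.le (by omega)) (Or.inl ⟨?_, hs,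
        by simp, by simp⟩)⟩
    simp only [Program.Halted]; omega
  | cons i l ih =>
    intro p s hl h hs hm hpc hb hK
    have hlen : p < P.length := by
      by_contra hcon
      rw [List.drop_eq_nil_of_le (by omega)] at hl
      simp at hl
    have hi : P[p]? = some i := by
      have := congrArg (·[0]?) hl
      simpa using this.symm
    have hl' : l = P.drop (p + 1) := by
      have := congrArg List.tail hl
      simpa using this
    rw [dispatch, wp_ifZero]
    constructor
    · intro h0
      have hcp : c.pc = p := by omega
      have hstep : P.step H c = i.exec H c := by simp [Program.step, hcp, hi]
      rw [hstep] at hmem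
      simp only [wp_seq, wp_basic, Basic.Ok, Basic.exec]
      refine ⟨by omega, StepPre.wp_instrCmd (S := S) (k := k) (c := c) (H := H)
        (s := (s.tick 1).setReg .npc (p + 1) 1) ⟨?_, h.lt, ?_, ?_,
        h.word, h.space, h.word_space, h.len, h.entry, h.table, hs.bank, hs.cell, hm, ?_⟩ i
        (hP i (List.mem_of_getElem? hi)) hmem ?_⟩
      · simpa using h.lev
      · simpa using h.zero
      · simpa using h.num
      · simp [hcp]
      intro s1 p1
      have f1 := (((Frame.refl simRegs simArrs k s).tick 1).setReg (d := .npc)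
        (by simp [simRegs]) (p + 1) 1).trans p1.frame
      have e1 := f1.reg .lev (by simp [simRegs])
      have e2 := f1.reg .zero (by simp [simRegs])
      rw [h.lev] at e1
      rw [h.zero] at e2
      simp only [wp_seq, wp_basic, Basic.Ok, Basic.exec, e1, e2, p1.pc]
      refine ⟨⟨h.lt, Or.inl (by have := h.space; omega)⟩,
        hK _ ⟨fun r hr => ?_, fun A l j hA => ?_, f1.cur, f1.out, ?_⟩ ?_⟩
      · exact f1.reg r (fun h => hr (List.mem_cons_of_mem _ h))
      · simp only [State.setArr]
        rw [if_neg (fun h => hA ⟨by simp [simArrs, h.1], h.2.1⟩), f1.arr _ _ _ hA]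
      · have := f1.time
        simp only [State.setArr, List.length_cons]
        omega
      · have hbusy : s1.reg .busy = 0 ∨ s1.reg .busy = 1 := by
          rcases p1.event with ⟨-, h, -⟩ | ⟨-, -, h, -⟩
          · simp [h, hb]
          · simp [h]
        refine Or.inr ⟨?_, ?_, ?_⟩
        · simp only [Program.Halted]; omega
        · rw [hstep]
          refine ⟨?_, ?_, ?_⟩
          · simpa [State.setArr, BankOk] using p1.bank
          · refine (cell_congr fun A hA i => ?_).trans p1.cell
            have : A ≠ .pcs := by rintro rfl; simp at hA
            simp [State.setArr, this]
          · simp [State.setArr]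
        · have hmk : ∀ l, Marks s1.arr k H.cols l →
              Marks (s1.setArr Arr.pcs k 0 (i.exec H c).pc 8).arr k H.cols l := fun l hl v hv => by
            simpa [State.setArr] using hl v hv
          rw [hstep]
          rcases p1.event with ⟨h1, h2, h3⟩ | ⟨h1, h2, h3, h4, h5⟩
          · exact Or.inl ⟨h1, by simpa [State.setArr, hb] using h2, hmk _ h3⟩
          · exact Or.inr ⟨h1, h2, h3, h4, hmk _ h5⟩
    · intro h0
      simp only [wp_seq, wp_basic, Basic.Ok, Basic.exec, State.tick_reg, ArithOp.eval]
      have f1 := ((Frame.refl (.pc :: simRegs) simArrs k s).tick 1).setReg (d := .pc)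
        (by simp) (s.reg .pc - 1) 2
      refine ⟨⟨h.word, Or.inl (by omega)⟩, ih hl' (h.frame f1) (by simpa using hs)
        (by simpa using hm) (by simp; omega) (by simpa using hb) fun s' f2 hs' => ?_⟩
      have f3 := (f1.trans f2).tick 1
      refine hK _ (f3.le (by simp only [List.length_cons]; omega)) ?_
      simpa [StepResult] using hs'

theorem wp_stepCmd (hP : ∀ i ∈ P, Instr.Small W i) (hPW : P.length ≤ W)
    (hmem : ∀ a, (P.step H c).mem a ≤ W ∧ ((P.step H c).mem a ≠ 0 → a < S))
    (h : SimContext T H W R S k s) (hs : SimState S k c s.arr) (hm : Marks s.arr k H.cols c.cur)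
    (hb : s.reg .busy = 1)
    (hK : ∀ s', Frame (.pc :: simRegs) simArrs k (610 + 4 * P.length) s s' →
        StepResult P H S k c s' → K s') :
    wp T W R (stepCmd P) K s := by
  simp only [stepCmd, wp_seq, wp_basic, Basic.Ok, Basic.exec, h.lev, h.zero, hs.pc]
  have f1 := (Frame.refl (.pc :: simRegs) simArrs k s).setReg (d := .pc)
        (by simp) c.pc 8
  exact ⟨h.lt, wp_dispatch hP hPW hmem (by simp) (h.frame f1) (by simpa using hs)
    (by simpa using hm) (by simp) (by simpa using hb)
    fun s' f2 => hK s' ((f1.trans f2).le (by omega))⟩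

/-- What holds when the simulation, started in the configuration after `t₀` steps, stops. -/
def SimResult (P : Program) (H : InputTable) (S k t₀ : ℕ) (s' : State) : Prop :=
  ∃ t, t₀ ≤ t ∧ (P.run H t).out = (P.run H t₀).out ∧
  ((P.Halted (P.run H t) ∧ SimState S k (P.run H t) s'.arr ∧ s'.reg .event = 0) ∨
  ((P.run H (t + 1)).out = (P.run H t).out ++ [(P.run H t).cur] ∧ (P.run H (t + 1)).cur = [] ∧
      SimState S k (P.run H (t + 1)) s'.arr ∧
      s'.reg .event = 1 ∧ Marks s'.arr k H.cols (P.run H t).cur))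

theorem run_succ (P : Program) (H : InputTable) (t : ℕ) :
    P.run H (t + 1) = P.step H (P.run H t) := by
  simp only [Program.run, Function.iterate_succ_apply']

/-- The delay assumption bounds the number of rounds. There are `τ + 1` of them rather than `τ`,
because halting is only noticed by trying one more step. -/
theorem wp_simulate {t₀ τ : ℕ} (hP : ∀ i ∈ P, Instr.Small W i) (hPW : P.length ≤ W)
    (hmem : ∀ t a, (P.run H t).mem a ≤ W ∧ ((P.run H t).mem a ≠ 0 → a < S))
    (hdelay : P.Halted (P.run H (t₀ + τ)) ∨
      (P.run H t₀).out.length < (P.run H (t₀ + τ)).out.length)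
    (h : SimContext T H W R S k s) (hs : SimState S k (P.run H t₀) s.arr)
    (hm : Marks s.arr k H.cols (P.run H t₀).cur)
    (hK : ∀ s', Frame (.pc :: simRegs) simArrs k ((τ + 1) * (612 + 4 * P.length) + 2) s s' →
        SimResult P H S k t₀ s' → K s') :
    wp T W R (simulate P) K s := by
  simp only [simulate, wp_seq, wp_basic, Basic.Ok, Basic.exec]
  refine ⟨h.word, ?_⟩
  set C := 612 + 4 * P.length with hC
  refine wp_loop (j := τ + 1) (I := fun j u =>
    (∃ t, t₀ ≤ t ∧ t + j = t₀ + τ + 1 ∧ 1 ≤ j ∧ u.reg .busy = 1 ∧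
      Frame (.pc :: simRegs) simArrs k ((t - t₀) * C + 1) s u ∧
      (P.run H t).out = (P.run H t₀).out ∧ SimState S k (P.run H t) u.arr ∧
      Marks u.arr k H.cols (P.run H t).cur) ∨
    (j = 0 ∧ u.reg .busy = 0 ∧ Frame (.pc :: simRegs) simArrs k ((τ + 1) * C + 1) s u ∧
      SimResult P H S k t₀ u)) ?_ ?_
  · rintro j u (⟨t, ht0, htj, hj, hb, f, ho, hu, hmu⟩ | ⟨rfl, hb, f, hr⟩)
    · refine Or.inr ⟨by omega, wp_stepCmd hP hPW (c := P.run H t) (H := H)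
        (fun a => by rw [← run_succ]; exact hmem _ a) ((h.frame f).frame ((Frame.refl _ _ k u).tick 1))
        (by simpa using hu) (by simpa using hmu) (by simpa using hb) fun u' f' hr => ?_⟩
      have f2 : Frame (.pc :: simRegs) simArrs k ((t + 1 - t₀) * C + 1) s (u'.tick 1) := by
        refine (((f.tick 1).trans f').tick 1).le ?_
        rw [show t + 1 - t₀ = t - t₀ + 1 by omega, add_mul]
        omega
      have hle : (t + 1 - t₀) * C ≤ (τ + 1) * C := Nat.mul_le_mul_right _ (by omega)
      rcases hr with ⟨hh, hs', hb', he'⟩ | ⟨hh, hs', hr⟩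
      · exact ⟨0, by omega, Or.inr ⟨rfl, by simpa using hb', f2.le (by omega),
          t, ht0, ho, Or.inl ⟨hh, by simpa using hs', by simpa using he'⟩⟩⟩
      · rw [← run_succ] at hs' hr
        rcases hr with ⟨ho', hb', hm'⟩ | ⟨ho', hcur, hb', he', hm'⟩
        · have hlt : t ≠ t₀ + τ := by
            rintro rfl
            rcases hdelay with hd | hd
            · exact hh hd
            · rw [ho] at hd; omega
          exact ⟨j - 1, by omega, Or.inl ⟨t + 1, by omega, by omega, by omega,
            by simpa using hb', f2, ho'.trans ho, by simpa using hs', by simpa using hm'⟩⟩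
        · exact ⟨0, by omega, Or.inr ⟨rfl, by simpa using hb', f2.le (by omega),
            t, ht0, ho, Or.inr ⟨ho', hcur, by simpa using hs', by simpa using he',
              by simpa using hm'⟩⟩⟩
    · exact Or.inl ⟨hb, hK _ (f.tick 1) (by simpa [SimResult] using hr)⟩
  · refine Or.inl ⟨t₀, le_rfl, by omega, by omega, by simp, ?_, rfl, by simpa using hs,
      by simpa using hm⟩
    exact ((Frame.refl _ _ k s).setReg (by simp [simRegs]) _ _).le (by omega)

end

/-! ### Frame conditions across levels and counted loops. -/

/-- From `s` to `s'` only the registers in `D` and the arrays in `E` have changed. -/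
structure Agree (D : List Reg) (E : Arr → ℕ → Prop) (s s' : State) : Prop where
  reg : ∀ r, r ∉ D → s'.reg r = s.reg r
  arr : ∀ A l i, ¬ E A l → s'.arr A l i = s.arr A l i
  cur : s'.cur = s.cur
  out : s'.out = s.out

namespace State
variable (s : State) (A : Arr) (k i v t : ℕ)
@[simp] theorem setArr_reg : (s.setArr A k i v t).reg = s.reg := rfl
theorem setArr_arr (B : Arr) (l j : ℕ) : (s.setArr A k i v t).arr B l j =
    if B = A ∧ l = k ∧ j = i then v else s.arr B l j := rfl
@[simp] theorem setArr_cur : (s.setArr A k i v t).cur = s.cur := rfl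
@[simp] theorem setArr_out : (s.setArr A k i v t).out = s.out := rfl
@[simp] theorem setArr_time : (s.setArr A k i v t).time = s.time + t := rfl
end State

section
variable {D : List Reg} {E : Arr → ℕ → Prop} {s0 s s' : State}

theorem Agree.refl (D E) (s : State) : Agree D E s s :=
  ⟨fun _ _ => rfl, fun _ _ _ _ => rfl, rfl, rfl⟩

theorem Agree.trans (h : Agree D E s0 s) (h' : Agree D E s s') : Agree D E s0 s' :=
  ⟨fun r hr => (h'.reg r hr).trans (h.reg r hr), fun A l i hA => (h'.arr A l i hA).trans
    (h.arr A l i hA), h'.cur.trans h.cur, h'.out.trans h.out⟩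

theorem Agree.weaken {D' E'} (h : Agree D E s0 s) (hD : D ⊆ D') (hE : ∀ A l, E A l → E' A l) :
    Agree D' E' s0 s :=
  ⟨fun r hr => h.reg r fun h' => hr (hD h'), fun A l i hA => h.arr A l i fun h' => hA (hE A l h'),
    h.cur, h.out⟩

theorem Agree.setReg (h : Agree D E s0 s) {d : Reg} (hd : d ∈ D) (v u : ℕ) :
    Agree D E s0 (s.setReg d v u) where
  reg := fun r hr => by
    have : r ≠ d := fun h => hr (h ▸ hd)
    simp [this, h.reg r hr]
  arr := h.arr
  cur := h.cur
  out := h.out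

theorem Agree.tick (h : Agree D E s0 s) (u : ℕ) : Agree D E s0 (s.tick u) :=
  ⟨h.reg, h.arr, h.cur, h.out⟩

theorem Agree.setArr (h : Agree D E s0 s) {A : Arr} {k : ℕ} (hA : E A k) (i v u : ℕ) :
    Agree D E s0 (s.setArr A k i v u) where
  reg := h.reg
  arr := fun B l j hB => by
    rw [State.setArr_arr, if_neg (by rintro ⟨rfl, rfl, -⟩; exact hB hA), h.arr _ _ _ hB]
  cur := h.cur
  out := h.out

variable {T : InputTable} {W R : ℕ} {K : State → Prop}

theorem wp_forUp_agree {i b d : Reg} {a : Cmd} {J : ℕ → State → Prop} {N c : ℕ}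
    (hi : i ∈ D) (hd : d ∈ D) (hb : b ∉ D) (hid : i ≠ d) (hN : N ≤ W) (hW : 1 ≤ W)
    (hbN : s.reg b = N)
    (hJ : ∀ j s s', s'.arr = s.arr → (∀ r, r ≠ i → r ≠ d → s'.reg r = s.reg r) → J j s → J j s')
    (h0 : J 0 s)
    (hstep : ∀ j < N, ∀ u, Agree D E s u → J j u → u.reg i = j →
      wp T W R a (fun u' => Agree D E s u' ∧ J (j + 1) u' ∧ u'.reg i = j ∧
        u'.time ≤ u.time + c) u)
    (hK : ∀ u, Agree D E s u → J N u → u.time ≤ s.time + N * (c + 5) + 3 → K u) :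
    wp T W R (.forUp i b d a) K s := by
  refine wp_forUp (I := fun j u => Agree D E s u ∧ J j u) (N := N) (c := c)
    (fun h => hb (h ▸ hi)) hid hN hW (fun j u h => (h.1.reg b hb).trans hbN) ?_
    ⟨Agree.refl _ _ _, h0⟩ (fun j hj u hu hui => (hstep j hj u hu.1 hu.2 hui).mono
      fun u' h => ⟨⟨h.1, h.2.1⟩, h.2.2⟩) (fun u hu ht => hK u hu.1 hu.2 ht)
  intro j u v v' t h
  refine ⟨⟨fun r hr => ?_, h.1.arr, h.1.cur, h.1.out⟩, hJ j u _ rfl (fun r h1 h2 => ?_) h.2⟩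
  · have h1 : r ≠ i := fun h => hr (h ▸ hi)
    have h2 : r ≠ d := fun h => hr (h ▸ hd)
    simp [h1, h2, h.1.reg r hr]
  · simp [h1, h2]

end

/-! ### Marks -/

/-- Mark all vertices of the current level by `v`. -/
def fillMarks (v : Reg) : Cmd := .forUp .r0 .num .r1 (.basic (.put .out .lev .r0 v))

section
variable {T : InputTable} {W R n k : ℕ} {K : State → Prop} {s : State}

theorem wp_fillMarks {v : Reg} (hv : v ∉ [Reg.r0, .r1]) (hl : s.reg .lev = k) (hk : k < T.cols)
    (hn : s.reg .num = n) (hnW : n ≤ W) (hnR : n ≤ R) (hW : 1 ≤ W)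
    (hK : ∀ s', Agree [.r0, .r1] (fun A l => A = .out ∧ l = k) s s' →
      (∀ i < n, s'.arr .out k i = s.reg v) → s'.time ≤ s.time + n * 13 + 3 → K s') :
    wp T W R (fillMarks v) K s := by
  refine wp_forUp_agree (D := [.r0, .r1]) (E := fun A l => A = .out ∧ l = k) (N := n) (c := 8)
    (J := fun j u => ∀ i < j, u.arr .out k i = s.reg v) (by simp) (by simp) (by simp) (by simp)
    hnW hW hn (fun j s s' h _ hJ => by simpa [h] using hJ) (by simp) ?_ hK
  intro j hj u hu hJ huj
  have e1 : u.reg .lev = k := (hu.reg _ (by simp)).trans hl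
  have e2 : u.reg v = s.reg v := hu.reg _ hv
  simp only [wp_basic, Basic.Ok, Basic.exec, e1, e2, huj]
  refine ⟨⟨hk, Or.inl (by omega)⟩, hu.setArr (by simp) _ _ _, fun i hi => ?_, by simpa using huj,
    le_rfl⟩
  rw [State.setArr_arr]
  by_cases hij : i = j
  · simp [hij]
  · simpa [hij] using hJ i (by omega)

/-- The next root: set the marks of level `0` to the next vertex and `event` to `1`, or `event` to
`0` if there is none. -/
def rootEvent : Cmd :=
  .basic (.arith .sub .r5 .num .vert) ;;
  .ifZero .r5 (.basic (.const .event 0))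
    (fillMarks .zero ;; .basic (.const .r5 1) ;; .basic (.put .out .lev .vert .r5) ;;
      .basic (.arithConst .add .vert .vert 1) ;; .basic (.const .event 1))

/-- The roots are treated like solutions reported on level `0`: the vertex `x` corresponds to the
set `{x}ᶜ`, whose complement is what the marks describe. -/
theorem wp_rootEvent (hl : s.reg .lev = 0) (hk : 0 < T.cols) (hz : s.reg .zero = 0)
    (hn : s.reg .num = n) (hnW : n ≤ W) (hnR : n ≤ R) (hW : 1 ≤ W)
    (hK : ∀ s', Agree [.r0, .r1, .r5, .vert, .event] (fun A l => A = .out ∧ l = 0) s s' →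
      s'.time ≤ s.time + n * 13 + 20 →
      ((n ≤ s.reg .vert ∧ s'.reg .event = 0 ∧ s'.reg .vert = s.reg .vert) ∨
        (s.reg .vert < n ∧ s'.reg .event = 1 ∧ s'.reg .vert = s.reg .vert + 1 ∧
          ∀ i < n, s'.arr .out 0 i = if i = s.reg .vert then 1 else 0)) → K s') :
    wp T W R rootEvent K s := by
  simp only [rootEvent, wp_seq, wp_ifZero, wp_basic, Basic.Ok, Basic.exec, hn, ArithOp.eval]
  have a0 := (Agree.refl [.r0, .r1, .r5, .vert, .event] (fun A l => A = .out ∧ l = 0) s).setReg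
    (d := .r5) (by simp) (n - s.reg .vert) 1
  refine ⟨Or.inl (by omega), fun h0 => ⟨by omega, hK _ ((a0.tick 1).setReg (by simp) _ _)
    (by simp; omega) (Or.inl ⟨by simp at h0; omega, by simp, by simp⟩)⟩, fun h0 => ?_⟩
  refine wp_fillMarks (k := 0) (n := n) (by simp) (by simpa using hl) hk (by simpa using hn) hnW
    hnR hW fun s1 a1 h1 t1 => ?_
  have a2 := (a0.tick 1).trans (a1.weaken (by simp) (by simp))
  have e1 : s1.reg .lev = 0 := (a2.reg _ (by simp)).trans hl
  have e2 : s1.reg .vert = s.reg .vert := by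
    rw [a1.reg _ (by simp)]; simp
  have e3 : s.reg .vert < n := by simp at h0; omega
  simp only [wp_seq, wp_ifZero, wp_basic, Basic.Ok, Basic.exec, State.setReg_reg, ne_eq,
    reduceCtorEq, not_false_eq_true, Function.update_of_ne, Function.update_self, e1, e2,
    ArithOp.eval, State.setArr_reg]
  refine ⟨hW, ⟨hk, Or.inl (by omega)⟩, ⟨hW, Or.inr (by omega)⟩, hW,
    hK _ (((((a2.setReg (d := .r5) (by simp) 1 1).setArr (by simp) _ _ _).setReg (by simp)
      _ _).setReg (by simp) _ _).tick 1) ?_ (Or.inr ⟨e3, by simp, by simp, ?_⟩)⟩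
  · simp at t1 ⊢; omega
  · intro i hi
    simp only [State.setReg_arr, State.tick_arr, State.setArr_arr, h1 i hi]
    simp [hz]

end

end Ram

/-! ### The hypergraph of a set of conclusions -/

section
variable {n m : ℕ} (σ : Fin m → Implication (Fin n)) (Y : Finset (Fin n))

/-- Rows of the first `i` implications with conclusion in `Y`, without repetition of premises. -/
def edgeRows : ℕ → List (Fin m)
  | 0 => []
  | i + 1 =>
    if h : i < m then
      if (σ ⟨i, h⟩).conclusion ∈ Y ∧
          ∀ j ∈ edgeRows i, (σ j).premise ≠ (σ ⟨i, h⟩).premise then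
        edgeRows i ++ [⟨i, h⟩]
      else edgeRows i
    else edgeRows i

theorem edgeRows_succ_of_pos {i : ℕ} (h : i < m) (h1 : (σ ⟨i, h⟩).conclusion ∈ Y)
    (h2 : ∀ j ∈ edgeRows σ Y i, (σ j).premise ≠ (σ ⟨i, h⟩).premise) :
    edgeRows σ Y (i + 1) = edgeRows σ Y i ++ [⟨i, h⟩] := by
  rw [edgeRows, dif_pos h, if_pos ⟨h1, h2⟩]

theorem edgeRows_succ_of_neg {i : ℕ} (h : i < m) (h1 : ¬ ((σ ⟨i, h⟩).conclusion ∈ Y ∧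
    ∀ j ∈ edgeRows σ Y i, (σ j).premise ≠ (σ ⟨i, h⟩).premise)) :
    edgeRows σ Y (i + 1) = edgeRows σ Y i := by
  rw [edgeRows, dif_pos h, if_neg h1]

theorem length_edgeRows_le (i : ℕ) : (edgeRows σ Y i).length ≤ i := by
  induction i with
  | zero => simp [edgeRows]
  | succ i ih =>
    rw [edgeRows]
    split_ifs
    · simp; omega
    · omega
    · omega

theorem pairwise_edgeRows (i : ℕ) :
    (edgeRows σ Y i).Pairwise fun a b => (σ a).premise ≠ (σ b).premise := by
  induction i with
  | zero => simp [edgeRows]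
  | succ i ih =>
    rw [edgeRows]
    split_ifs with h h1
    · rw [List.pairwise_append]
      exact ⟨ih, by simp, by simpa using h1.2⟩
    · exact ih
    · exact ih

theorem exists_mem_edgeRows (i : ℕ) (r : Fin m) (hr : r.1 < i) (hY : (σ r).conclusion ∈ Y) :
    ∃ j ∈ edgeRows σ Y i, (σ j).premise = (σ r).premise := by
  induction i with
  | zero => omega
  | succ i ih =>
    by_cases hi : i < m
    swap
    · rw [edgeRows, dif_neg hi]
      exact ih (by omega)
    by_cases h1 : (σ ⟨i, hi⟩).conclusion ∈ Y ∧
      ∀ j ∈ edgeRows σ Y i, (σ j).premise ≠ (σ ⟨i, hi⟩).premise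
    · rw [edgeRows_succ_of_pos σ Y hi h1.1 h1.2]
      rcases Nat.lt_succ_iff_lt_or_eq.1 hr with h | h
      · obtain ⟨j, hj, hj'⟩ := ih h
        exact ⟨j, by simp [hj], hj'⟩
      · exact ⟨⟨i, hi⟩, by simp, by congr 2; exact Fin.ext h.symm⟩
    · rw [edgeRows_succ_of_neg σ Y hi h1]
      rcases Nat.lt_succ_iff_lt_or_eq.1 hr with h | h
      · exact ih h
      · obtain rfl : r = ⟨i, hi⟩ := Fin.ext h
        push Not at h1
        exact h1 hY

theorem conclusion_mem_of_mem_edgeRows {i : ℕ} {r : Fin m} (hr : r ∈ edgeRows σ Y i) :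
    (σ r).conclusion ∈ Y := by
  induction i with
  | zero => simp [edgeRows] at hr
  | succ i ih =>
    rw [edgeRows] at hr
    split_ifs at hr with h h1
    · rcases List.mem_append.1 hr with hr | hr
      · exact ih hr
      · rw [List.mem_singleton.1 hr]; exact h1.1
    · exact ih hr
    · exact ih hr

/-- The number of edges of the hypergraph of `Y`. -/
def edgeCount : ℕ := (edgeRows σ Y m).length

/-- The edges of the hypergraph of `Y`. -/
def edgeOf (j : Fin (edgeCount σ Y)) : Finset (Fin n) := (σ ((edgeRows σ Y m)[j.1]'j.2)).premise

theorem edgeCount_le : edgeCount σ Y ≤ m := length_edgeRows_le σ Y m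

/-- The given program is only assumed to handle hypergraphs without repeated edges, while different
implications into `Y` may share a premise. -/
theorem edgeOf_injective : Function.Injective (edgeOf σ Y) := by
  have key : ∀ i j : Fin (edgeCount σ Y), i < j → edgeOf σ Y i ≠ edgeOf σ Y j := fun i j hij =>
    List.pairwise_iff_getElem.1 (pairwise_edgeRows σ Y m) i j i.2 j.2 hij
  intro i j hij
  rcases lt_trichotomy i j with h | h | h
  · exact absurd hij (key _ _ h)
  · exact h
  · exact absurd hij.symm (key _ _ h)

theorem range_edgeOf : Set.range (edgeOf σ Y) = edgesInto (Set.range σ) Y := by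
  ext A
  constructor
  · rintro ⟨j, rfl⟩
    exact ⟨_, ⟨_, rfl⟩, rfl, conclusion_mem_of_mem_edgeRows σ Y (List.getElem_mem j.2)⟩
  · rintro ⟨_, ⟨r, rfl⟩, rfl, hr⟩
    obtain ⟨j, hj, hj'⟩ := exists_mem_edgeRows σ Y m r r.2 hr
    obtain ⟨i, hi, rfl⟩ := List.getElem_of_mem hj
    exact ⟨⟨i, hi⟩, hj'⟩

/-- The input table of the hypergraph of `Y`. -/
def subInput : InputTable := hypergraphInput (edgeOf σ Y)

end

theorem baseInput_entry_conclusion {n m : ℕ} (σ : Fin m → Implication (Fin n)) (i : Fin m) :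
    (baseInput σ).entry i n = (σ i).conclusion := by
  simp [baseInput]

theorem baseInput_entry_premise {n m : ℕ} (σ : Fin m → Implication (Fin n)) (i : Fin m)
    (x : Fin n) : (baseInput σ).entry i x = if x ∈ (σ i).premise then 1 else 0 := by
  have h1 : (x : ℕ) ≠ n := by omega
  have h2 : (∃ x' : Fin n, (x' : ℕ) = x ∧ x' ∈ (σ i).premise) ↔ x ∈ (σ i).premise :=
    ⟨fun ⟨x', h, h'⟩ => Fin.ext h ▸ h', fun h => ⟨x, rfl, h⟩⟩
  simp only [baseInput, Fin.is_lt, dif_pos, h1, if_false, Fin.eta, h2]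

theorem baseInput_entry_le {n m : ℕ} (σ : Fin m → Implication (Fin n)) (hn : 0 < n) (i x : ℕ) :
    (baseInput σ).entry i x ≤ n := by
  simp only [baseInput]
  split_ifs <;> omega

/-! ### Building the hypergraph of the next level in linear time. -/

namespace Ram

/-- The array `A` of level `k` holds the characteristic vector of `Y`. -/
def Holds {n : ℕ} (f : Arr → ℕ → ℕ → ℕ) (A : Arr) (k : ℕ) (Y : Finset (Fin n)) : Prop :=
  ∀ v : Fin n, f A k v = if v ∈ Y then 1 else 0

/-- The array `rep` identifies the implications with the same premise. -/
structure RepOk {n m : ℕ} (σ : Fin m → Implication (Fin n)) (f : Arr → ℕ → ℕ → ℕ) : Prop where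
  lt : ∀ i : Fin m, f .rep 0 i < m
  iff : ∀ i j : Fin m, f .rep 0 i = f .rep 0 j ↔ (σ i).premise = (σ j).premise

/-- List the edges of the hypergraph of the marked vertices in the next level. -/
def collectEdges : Cmd :=
  .basic (.const .r2 0) ;; .basic (.const .r9 1) ;; .forUp .r0 .rowNum .r1
    (.basic (.entry .r5 .r0 .num) ;; .basic (.get .out .r6 .lev .r5) ;;
      .ifZero .r6 .skip (.basic (.get .rep .r7 .zero .r0) ;; .basic (.get .seen .r8 .zero .r7) ;;
        .ifZero .r8 (.basic (.put .seen .zero .r7 .r9) ;; .basic (.put .edg .nxt .r2 .r0) ;;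
          .basic (.arithConst .add .r2 .r2 1)) .skip))

/-- Prepare the next level and go to it. -/
def pushLevel : Cmd :=
  .basic (.arithConst .add .nxt .lev 1) ;;
  .forUp .r0 .rowNum .r1 (.basic (.put .seen .zero .r0 .zero)) ;;
  .forUp .r0 .num .r1 (.basic (.get .acc .r6 .lev .r0) ;; .basic (.get .out .r5 .lev .r0) ;;
    .ifZero .r5 .skip (.basic (.const .r6 1)) ;; .basic (.put .acc .nxt .r0 .r6)) ;;
  collectEdges ;;
  .basic (.put .siz .nxt .zero .r2) ;; .basic (.put .cnt .nxt .zero .zero) ;;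
  .basic (.put .pcs .nxt .zero .zero) ;; .basic (.arithConst .add .lev .nxt 0)

/-- The registers that `pushLevel` may change. -/
def pushRegs : List Reg := [.r0, .r1, .r2, .r5, .r6, .r7, .r8, .r9, .nxt, .lev]

section
variable {W R n m k : ℕ} {K : State → Prop} {s : State} {σ : Fin m → Implication (Fin n)}
  {Y : Finset (Fin n)}

/-- Comparing premises directly would take too long. Since `rep` numbers the classes of equal
premises, one flag in `seen` per class decides in constant time whether a premise has been listed
already. -/
theorem wp_collectEdges (hl : s.reg .lev = k) (hnx : s.reg .nxt = k + 1) (hk : k < n)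
    (hz : s.reg .zero = 0) (hn : s.reg .num = n) (hm : s.reg .rowNum = m) (hnW : n ≤ W)
    (hmW : m + 1 ≤ W) (hmR : m ≤ R) (hrep : RepOk σ s.arr) (hY : Holds s.arr .out k Y)
    (hseen : ∀ r < m, s.arr .seen 0 r = 0)
    (hK : ∀ u, Agree [.r0, .r1, .r2, .r5, .r6, .r7, .r8, .r9]
        (fun A l => A = .seen ∨ A = .edg ∧ l = k + 1) s u →
      u.reg .r2 = edgeCount σ Y → (∀ j : Fin (edgeCount σ Y),
        u.arr .edg (k + 1) j = ((edgeRows σ Y m)[j.1]'j.2).1) →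
      u.time ≤ s.time + m * 60 + 10 → K u) :
    wp (baseInput σ) W R collectEdges K s := by
  have hcols : (baseInput σ).cols = n + 1 := rfl
  simp only [collectEdges, wp_seq, wp_basic, Basic.Ok, Basic.exec]
  set D : List Reg := [.r0, .r1, .r2, .r5, .r6, .r7, .r8, .r9]
  set E : Arr → ℕ → Prop := fun A l => A = .seen ∨ A = .edg ∧ l = k + 1
  have a0 : Agree D E s ((s.setReg .r2 0 1).setReg .r9 1 1) :=
    ((Agree.refl D E s).setReg (by simp [D]) 0 1).setReg (by simp [D]) 1 1
  -- The last part of the invariant says that the flag of a class is set exactly when the class is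
  -- represented among the rows listed so far.
  refine ⟨by omega, by omega, wp_forUp_agree (D := D) (E := E) (N := m) (c := 50)
    (J := fun i u => u.reg .r9 = 1 ∧ u.reg .r2 = (edgeRows σ Y i).length ∧
      (∀ (j : ℕ) (hj : j < (edgeRows σ Y i).length),
        u.arr .edg (k + 1) j = ((edgeRows σ Y i)[j]'hj).1) ∧
      ∀ r < m, u.arr .seen 0 r ≠ 0 ↔ ∃ j ∈ edgeRows σ Y i, s.arr .rep 0 j = r)
    (by simp [D]) (by simp [D]) (by simp [D]) (by simp) (by omega) (by omega) (by simpa using hm)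
    ?_ ?_ ?_ ?_⟩
  · rintro j u u' ha hr ⟨h1, h2, h3, h4⟩
    refine ⟨(hr _ (by simp) (by simp)).trans h1, (hr _ (by simp) (by simp)).trans h2, ?_, ?_⟩
    · simpa only [ha] using h3
    · simpa only [ha] using h4
  · refine ⟨by simp, by simp [edgeRows], by simp [edgeRows], ?_⟩
    simpa [edgeRows] using hseen
  · rintro i hi u hu ⟨h1, h2, h3, h4⟩ hui
    have a1 := a0.trans hu
    have el : u.reg .lev = k := (a1.reg _ (by simp [D])).trans hl
    have en : u.reg .num = n := (a1.reg _ (by simp [D])).trans hn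
    have ez : u.reg .zero = 0 := (a1.reg _ (by simp [D])).trans hz
    have ex : u.reg .nxt = k + 1 := (a1.reg _ (by simp [D])).trans hnx
    have hent := baseInput_entry_conclusion σ ⟨i, hi⟩
    dsimp only at hent
    have hout : u.arr .out k (σ ⟨i, hi⟩).conclusion =
        if (σ ⟨i, hi⟩).conclusion ∈ Y then 1 else 0 := by
      rw [a1.arr _ _ _ (by simp [E])]; exact hY _
    have hrp : ∀ j, u.arr .rep 0 j = s.arr .rep 0 j := fun j => a1.arr _ _ _ (by simp [E])
    have hconc := (σ ⟨i, hi⟩).conclusion.2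
    simp only [wp_seq, wp_basic, wp_ifZero, wp_skip, Basic.Ok, Basic.exec, hui, en, hent, el,
      State.setReg_reg, ne_eq, reduceCtorEq, not_false_eq_true, Function.update_of_ne,
      Function.update_self, State.setReg_arr, State.tick_reg, State.tick_arr, ez, hrp,
      State.setArr_reg, h1, h2, ex, hout, ArithOp.eval, hcols]
    have f0 : Agree D E ((s.setReg .r2 0 1).setReg .r9 1 1) ((u.setReg .r5
        (σ ⟨i, hi⟩).conclusion 1).setReg .r6 (if (σ ⟨i, hi⟩).conclusion ∈ Y then 1 else 0) 8) :=
      (hu.setReg (by simp [D]) _ _).setReg (by simp [D]) _ _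
    refine ⟨by omega, by omega, fun h0 => ?_, fun h0 => ⟨by omega, by omega, fun hs => ?_,
      fun hs => ?_⟩⟩
    · have hc : (σ ⟨i, hi⟩).conclusion ∉ Y := by simpa using h0
      rw [edgeRows_succ_of_neg σ Y hi (fun h => hc h.1)]
      exact ⟨f0.tick 1, ⟨by simp, by simp, by simpa using h3, by
        simpa using h4⟩, by simp, by simp⟩
    · have hc : (σ ⟨i, hi⟩).conclusion ∈ Y := by simpa using h0
      have hrl := hrep.lt ⟨i, hi⟩
      dsimp only at hrl
      have hnew : ∀ j ∈ edgeRows σ Y i, (σ j).premise ≠ (σ ⟨i, hi⟩).premise := fun j hj he =>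
        (h4 _ hrl).2 ⟨j, hj, (hrep.iff _ _).2 he⟩ hs
      have hlen := length_edgeRows_le σ Y i
      rw [edgeRows_succ_of_pos σ Y hi hc hnew]
      refine ⟨⟨by omega, Or.inl (by omega)⟩, ⟨by omega, Or.inl (by omega)⟩,
        ⟨by omega, Or.inr (by omega)⟩, ?_, ⟨?_, ?_, ?_, ?_⟩, ?_, ?_⟩
      · exact ((((((((f0.tick 1).setReg (d := .r7) (by simp [D]) _ 8).setReg (d := .r8)
          (by simp [D]) _ 8).tick 1).setArr (A := .seen) (by simp [E]) _ _ _).setArr (A := .edg)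
          (by simp [E]) _ _ _).setReg (by simp [D]) _ _).tick 1)
      · simp
      · simp
      · intro j hj
        simp only [State.tick_arr, State.setReg_arr, State.setArr_arr]
        simp only [List.length_append, List.length_singleton] at hj
        by_cases hjl : j = (edgeRows σ Y i).length
        · subst hjl
          simp
        · have hjl' : j < (edgeRows σ Y i).length := by omega
          simp [hjl, h3 j hjl', List.getElem_append_left hjl']
      · intro r hr
        simp only [State.tick_arr, State.setReg_arr, State.setArr_arr]
        simp only [reduceCtorEq, false_and, if_false, true_and]
        by_cases hrr : r = s.arr .rep 0 i
        · simp only [hrr, if_true]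
          exact ⟨fun _ => ⟨⟨i, hi⟩, by simp, rfl⟩, fun _ => by omega⟩
        · rw [if_neg hrr, ← ne_eq, h4 r hr]
          constructor
          · rintro ⟨j, hj, hj'⟩
            exact ⟨j, by simp [hj], hj'⟩
          · rintro ⟨j, hj, hj'⟩
            rcases List.mem_append.1 hj with hj | hj
            · exact ⟨j, hj, hj'⟩
            · rw [List.mem_singleton.1 hj] at hj'
              exact absurd hj'.symm hrr
      · simp
      · simp
    · have hrl := hrep.lt ⟨i, hi⟩
      dsimp only at hrl
      obtain ⟨j, hj, hj'⟩ := (h4 _ hrl).1 hs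
      rw [edgeRows_succ_of_neg σ Y hi (fun h => h.2 j hj ((hrep.iff _ ⟨i, hi⟩).1 hj'))]
      exact ⟨((((((f0.tick 1).setReg (d := .r7) (by simp [D]) _ 8).setReg (d := .r8)
        (by simp [D]) _ 8).tick 1).tick 1).tick 1), ⟨by simp, by simp,
        by simpa using h3, by simpa using h4⟩, by simp, by simp⟩
  · rintro u hu ⟨-, h2, h3, -⟩ ht
    refine hK u (a0.trans hu) h2 (fun j => h3 j.1 j.2) ?_
    simp at ht; omega

end

/-- Output the complement of the marked vertices. -/
def outputCmd : Cmd :=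
  .forUp .r0 .num .r1 (.basic (.get .acc .r5 .lev .r0) ;;
    .ifZero .r5 (.basic (.get .out .r5 .lev .r0) ;; .ifZero .r5 (.basic (.write .r0)) .skip)
      .skip) ;;
  .basic .emit

section
variable {W R S n m k : ℕ} {K : State → Prop} {s : State} {σ : Fin m → Implication (Fin n)}
  {A Y : Finset (Fin n)}

/-- A level stores one row number per edge instead of an incidence matrix, and the entries come from
the read-only input. So the table of a level costs linear rather than quadratic space. -/
theorem subTable_of_edg {f : Arr → ℕ → ℕ → ℕ} (hs : f .siz k 0 = edgeCount σ Y)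
    (he : ∀ j : Fin (edgeCount σ Y), f .edg k j = ((edgeRows σ Y m)[j.1]'j.2).1) :
    SubTable (baseInput σ) (subInput σ Y) f k := by
  refine ⟨hs, fun i x => ?_⟩
  have hr : (subInput σ Y).rows = edgeCount σ Y := rfl
  have hc : (subInput σ Y).cols = n := rfl
  rw [hr, hc]
  by_cases h : i < edgeCount σ Y ∧ x < n
  · rw [if_pos h]
    have h1 := he ⟨i, h.1⟩
    have h2 := baseInput_entry_premise σ ((edgeRows σ Y m)[i]'h.1) ⟨x, h.2⟩
    dsimp only at h1 h2
    rw [h1, h2]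
    simp only [subInput, hypergraphInput]
    refine if_congr ⟨?_, fun h' => ⟨⟨i, h.1⟩, ⟨x, h.2⟩, rfl, rfl, h'⟩⟩ rfl rfl
    rintro ⟨i', x', rfl, rfl, h'⟩
    exact h'
  · rw [if_neg h]
    simp only [subInput, hypergraphInput]
    refine if_neg ?_
    rintro ⟨i', x', rfl, rfl, h'⟩
    exact h ⟨i'.2, x'.2⟩

/-- With counter `0` no cell is initialized, so the whole simulated memory reads as `0` regardless
of the other arrays: two assignments restart the program. -/
theorem simState_initial {f : Arr → ℕ → ℕ → ℕ} (h1 : f .cnt k 0 = 0) (h2 : f .pcs k 0 = 0) :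
    SimState S k Configuration.initial f := by
  refine ⟨fun j hj => by omega, funext fun a => ?_, h2⟩
  rw [cell, if_neg (fun h => by have := h.1; omega)]
  rfl

theorem wp_pushLevel (hl : s.reg .lev = k) (hk : k < n)
    (hz : s.reg .zero = 0) (hn : s.reg .num = n) (hm : s.reg .rowNum = m) (hnW : n + 1 ≤ W)
    (hmW : m + 1 ≤ W) (hmR : m ≤ R) (hnR : n ≤ R) (hrep : RepOk σ s.arr)
    (hY : Holds s.arr .out k Y) (hA : Holds s.arr .acc k A)
    (hK : ∀ u, Agree pushRegs (fun A l => A = .seen ∨ l = k + 1) s u → u.reg .lev = k + 1 →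
      Holds u.arr .acc (k + 1) (A ∪ Y) →
      SubTable (baseInput σ) (subInput σ Y) u.arr (k + 1) →
      SimState S (k + 1) Configuration.initial u.arr →
      u.time ≤ s.time + (n + m) * 80 + 60 → K u) :
    wp (baseInput σ) W R pushLevel K s := by
  have hcols : (baseInput σ).cols = n + 1 := rfl
  set D := pushRegs with hD
  set E : Arr → ℕ → Prop := fun A l => A = .seen ∨ l = k + 1 with hE
  simp only [pushLevel, wp_seq, wp_basic, Basic.Ok, Basic.exec, hl, ArithOp.eval]
  have a0 : Agree D E s (s.setReg .nxt (k + 1) 2) :=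
    (Agree.refl D E s).setReg (by simp [D, pushRegs]) _ _
  refine ⟨⟨by omega, Or.inr (by omega)⟩, ?_⟩
  refine wp_forUp_agree (D := [.r0, .r1]) (E := fun A _ => A = .seen) (N := m) (c := 8)
    (J := fun i u => ∀ r < i, u.arr .seen 0 r = 0)
    (by simp) (by simp) (by simp) (by simp) (by omega) (by omega)
    (by simpa using hm) (fun j u u' h _ hJ => by simpa [h] using hJ) (by simp) ?_ ?_
  · intro i hi u hu hJ hui
    have ez : u.reg .zero = 0 := (hu.reg _ (by simp)).trans (by simpa using hz)
    simp only [wp_basic, Basic.Ok, Basic.exec, ez, hui, hcols]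
    refine ⟨⟨by omega, by simp⟩, hu.setArr (by simp) _ _ _, fun r hr => ?_, by simpa using hui,
      by simp⟩
    rw [State.setArr_arr]
    split_ifs with h
    · rfl
    · exact hJ r (by
        have : r ≠ i := fun h' => h ⟨rfl, rfl, h'⟩
        omega)
  intro s1 g1 hseen t1
  have a1 := a0.trans (g1.weaken (D' := D) (E' := E) (by simp [D, pushRegs]) (by simp +contextual [E]))
  simp only [wp_seq, wp_basic, Basic.Ok, Basic.exec]
  refine wp_forUp_agree (D := [.r0, .r1, .r5, .r6]) (E := fun A l => A = .acc ∧ l = k + 1) (N := n)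
    (c := 40) (J := fun i u => ∀ v : Fin n, v.1 < i → u.arr .acc (k + 1) v = if v ∈ A ∪ Y then 1 else 0)
    (by simp) (by simp) (by simp) (by simp) (by omega) (by omega)
    ((a1.reg _ (by simp [D, pushRegs])).trans hn)
    (fun j u u' h _ hJ => by simpa [h] using hJ) (by simp) ?_ ?_
  · intro i hi u hu hJ hui
    have hu1 := g1.weaken (D' := [.r0, .r1, .r5, .r6])
      (E' := fun A l => A = .seen ∨ A = .acc ∧ l = k + 1) (by simp) (by simp +contextual)
    have hu2 := hu1.trans (hu.weaken (by simp) (by simp +contextual))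
    have el : u.reg .lev = k := (hu2.reg _ (by simp)).trans (by simpa using hl)
    have ex : u.reg .nxt = k + 1 := (hu2.reg _ (by simp)).trans (by simp)
    have e1 : u.arr .acc k i = if (⟨i, hi⟩ : Fin n) ∈ A then 1 else 0 := by
      rw [hu2.arr _ _ _ (by simp)]
      exact hA ⟨i, hi⟩
    have e2 : u.arr .out k i = if (⟨i, hi⟩ : Fin n) ∈ Y then 1 else 0 := by
      rw [hu2.arr _ _ _ (by simp)]
      exact hY ⟨i, hi⟩
    simp only [wp_seq, wp_basic, wp_ifZero, wp_skip, Basic.Ok, Basic.exec, hui, el, ex,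
      State.setReg_reg, ne_eq, reduceCtorEq, not_false_eq_true, Function.update_of_ne,
      Function.update_self, State.setReg_arr, State.tick_reg, State.tick_arr, e1, e2, hcols]
    have hacc : ∀ (w t : ℕ) (u' : State), u'.arr = u.arr →
        w = (if (⟨i, hi⟩ : Fin n) ∈ A ∪ Y then 1 else 0) →
        ∀ v : Fin n, v.1 < i + 1 → (u'.setArr .acc (k + 1) i w t).arr .acc (k + 1) v =
          if v ∈ A ∪ Y then 1 else 0 := by
      intro w t u' hu' hw v hv
      rw [State.setArr_arr, hu']
      by_cases hvi : v.1 = i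
      · subst hvi
        simpa using hw
      · simpa [hvi] using hJ v (by omega)
    have f0 := (hu.setReg (d := .r6) (by simp) (if (⟨i, hi⟩ : Fin n) ∈ A then 1 else 0) 8).setReg
      (d := .r5) (by simp) (if (⟨i, hi⟩ : Fin n) ∈ Y then 1 else 0) 8
    refine ⟨by omega, by omega, fun h0 => ⟨⟨by omega, Or.inl (by omega)⟩,
      (f0.tick 1).setArr (by simp) _ _ _, hacc _ _ _ rfl ?_, by simpa using hui, by simp⟩,
      fun h0 => ⟨by omega, ⟨by omega, Or.inl (by omega)⟩,
      (((f0.tick 1).setReg (d := .r6) (by simp) 1 1).tick 1).setArr (by simp) _ _ _,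
      hacc _ _ _ rfl ?_, by simpa using hui, by simp⟩⟩
    · have : (⟨i, hi⟩ : Fin n) ∉ Y := by simpa using h0
      simp [this]
    · have : (⟨i, hi⟩ : Fin n) ∈ Y := by simpa using h0
      simp [this]
  intro s2 g2 hacc t2
  have a2 := a1.trans (g2.weaken (D' := D) (E' := E) (by simp [D, pushRegs]) (by simp +contextual [E]))
  have x2 : s2.reg .nxt = k + 1 := by
    rw [g2.reg _ (by simp), g1.reg _ (by simp)]; simp
  have l2 : s2.reg .lev = k := by
    rw [g2.reg _ (by simp), g1.reg _ (by simp)]; simpa using hl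
  have r2 : RepOk σ s2.arr := ⟨fun i => by rw [a2.arr _ _ _ (by simp [E])]; exact hrep.lt i,
    fun i j => by rw [a2.arr _ _ _ (by simp [E]), a2.arr _ _ _ (by simp [E])]; exact hrep.iff i j⟩
  simp only [wp_seq, wp_basic, Basic.Ok, Basic.exec]
  refine wp_collectEdges (k := k) (Y := Y) l2 x2 hk ((a2.reg _ (by simp [D, pushRegs])).trans hz)
    ((a2.reg _ (by simp [D, pushRegs])).trans hn) ((a2.reg _ (by simp [D, pushRegs])).trans hm)
    (by omega) hmW hmR r2
    (fun v => by rw [a2.arr _ _ _ (by simp [E])]; exact hY v)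
    (fun r hr => by rw [g2.arr _ _ _ (by simp)]; exact hseen r hr) fun s3 g3 c3 e3 t3 => ?_
  have a3 := a2.trans (g3.weaken (D' := D) (E' := E) (by simp [D, pushRegs])
    (by rintro A l (h | h) <;> simp [E, h]))
  have x3 : s3.reg .nxt = k + 1 := (g3.reg _ (by simp)).trans x2
  have z3 : s3.reg .zero = 0 := (a3.reg _ (by simp [D, pushRegs])).trans hz
  simp only [wp_seq, wp_basic, Basic.Ok, Basic.exec, x3, z3, c3, State.setArr_reg, hcols,
    ArithOp.eval]
  refine ⟨⟨by omega, Or.inl (by omega)⟩, ⟨by omega, by simp⟩, ⟨by omega, by simp⟩,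
    ⟨by omega, Or.inl le_rfl⟩, hK _ ((((a3.setArr (by simp [E]) _ _ _).setArr (by simp [E]) _ _
      _).setArr (by simp [E]) _ _ _).setReg (by simp [D, pushRegs]) _ _) (by simp) ?_
      (subTable_of_edg ?_ ?_) (simState_initial ?_ ?_) ?_⟩
  · intro v
    simp [State.setArr_arr]
    rw [g3.arr _ _ _ (by simp), hacc v v.2]
    simp
  · simp [State.setArr_arr]
  · simpa [State.setArr_arr] using e3
  · simp [State.setArr_arr]
  · simp [State.setArr_arr]
  · simp at t1 t2 t3 ⊢
    omega

theorem isListing_filter_range {M : Finset (Fin n)} {p : ℕ → Bool}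
    (hp : ∀ v : Fin n, p v = true ↔ v ∈ M) : IsListing ((List.range n).filter p) M := by
  refine ⟨List.nodup_range.filter _, fun v => ?_⟩
  simp only [List.mem_filter, List.mem_range]
  constructor
  · rintro ⟨h, h'⟩
    exact ⟨⟨v, h⟩, (hp ⟨v, h⟩).1 h', rfl⟩
  · rintro ⟨x, hx, rfl⟩
    exact ⟨x.2, (hp x).2 hx⟩

theorem wp_outputCmd {T : InputTable} (hl : s.reg .lev = k) (hk : k < T.cols)
    (hn : s.reg .num = n) (hnW : n ≤ W) (hW : 1 ≤ W) (hc : s.cur = [])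
    (hY : Holds s.arr .out k Y) (hA : Holds s.arr .acc k A)
    (hK : ∀ u, (∀ r, r ∉ [Reg.r0, .r1, .r5] → u.reg r = s.reg r) → u.arr = s.arr → u.cur = [] →
      (∃ l, u.out = s.out ++ [l] ∧ IsListing l (A ∪ Y)ᶜ) →
      u.time ≤ s.time + n * 40 + 10 → K u) :
    wp T W R outputCmd K s := by
  set p : ℕ → Bool := fun v => decide (s.arr .acc k v = 0 ∧ s.arr .out k v = 0) with hp
  simp only [outputCmd, wp_seq]
  refine wp_forUp (I := fun j u => (∀ r, r ∉ [Reg.r0, .r1, .r5] → u.reg r = s.reg r) ∧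
    u.arr = s.arr ∧ u.out = s.out ∧ u.cur = (List.range j).filter p) (N := n) (c := 30)
    (by simp) (by simp) hnW hW ?_ ?_ ?_ ?_ ?_
  · exact fun j u h => (h.1 _ (by simp)).trans hn
  · rintro j u v v' t ⟨h1, h2, h3, h4⟩
    refine ⟨fun r hr => ?_, h2, h3, h4⟩
    have h5 := h1 r hr
    simp at hr
    simp [hr, h5]
  · exact ⟨fun _ _ => rfl, rfl, rfl, by simpa using hc⟩
  · rintro j hj u ⟨h1, h2, h3, h4⟩ huj
    have el : u.reg .lev = k := (h1 _ (by simp)).trans hl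
    simp only [wp_seq, wp_basic, wp_ifZero, wp_skip, Basic.Ok, Basic.exec, huj, el,
      State.setReg_reg, ne_eq, reduceCtorEq, not_false_eq_true, Function.update_of_ne,
      Function.update_self, State.setReg_arr, State.tick_reg, State.tick_arr, h2]
    have hreg : ∀ r, r ∉ [Reg.r0, .r1, .r5] → ∀ v, Function.update u.reg .r5 v r = s.reg r := by
      intro r hr v
      have h5 := h1 r hr
      simp at hr
      simp [hr, h5]
    refine ⟨hk, fun ha => ⟨hk, fun ho => ⟨True.intro, ⟨?_, True.intro, h3, ?_⟩, True.intro, ?_⟩,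
      fun ho => ⟨⟨?_, True.intro, h3, ?_⟩, ?_, ?_⟩⟩, fun ha => ⟨⟨?_, True.intro, h3, ?_⟩, ?_, ?_⟩⟩
    · intro r hr
      have h5 := h1 r hr
      simp at hr
      simp [hr, h5]
    · simp [List.range_succ, List.filter_append, h4, hp, ha, ho]
    · simp
    · intro r hr
      have h5 := h1 r hr
      simp at hr
      simp [hr, h5]
    · simp [List.range_succ, List.filter_append, h4, hp, ha, ho]
    · simp
    · simp
    · intro r hr
      have h5 := h1 r hr
      simp at hr
      simp [hr, h5]
    · simp [List.range_succ, List.filter_append, h4, hp, ha]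
    · simp
    · simp
  · rintro u ⟨h1, h2, h3, h4⟩ ht
    simp only [wp_basic, Basic.Ok, Basic.exec, true_and]
    refine hK _ h1 h2 rfl ⟨_, by rw [h3], ?_⟩ ?_
    · rw [h4]
      refine isListing_filter_range fun v => ?_
      simp only [hp, decide_eq_true_eq, hA v, hY v]
      simp
    · dsimp only; omega

end

/-! ### Identification of equal premises by partition refinement. -/

/-- Refine the classes of implications by the entries of column `r0`. -/
def refineCmd : Cmd :=
  .basic (.const .r5 1) ;;
  .forUp .r2 .rowNum .r3
    (.basic (.put .tab .zero .r2 .zero) ;; .basic (.put .tab .r5 .r2 .zero)) ;;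
  .forUp .r2 .rowNum .r3
    (.basic (.entry .r6 .r2 .r0) ;; .basic (.get .rep .r7 .zero .r2) ;;
      .basic (.get .tab .r8 .r6 .r7) ;;
      .ifZero .r8
        (.basic (.arithConst .add .r8 .r2 1) ;; .basic (.put .tab .r6 .r7 .r8) ;;
          .basic (.put .rep .zero .r2 .r2))
        (.basic (.arithConst .sub .r8 .r8 1) ;; .basic (.put .rep .zero .r2 .r8)))

/-- Initialize the registers and identify the implications with the same premise. -/
def initCmd : Cmd :=
  .basic (.cols .num) ;; .basic (.arithConst .sub .num .num 1) ;; .basic (.rows .rowNum) ;;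
  .forUp .r0 .num .r1 refineCmd ;; .basic (.const .active 1)

section
variable {W R n m : ℕ} {K : State → Prop} {s : State} {σ : Fin m → Implication (Fin n)}

/-- The array `rep` identifies the implications whose premises agree on the first `x` elements. -/
structure RepAt (σ : Fin m → Implication (Fin n)) (x : ℕ) (f : Arr → ℕ → ℕ → ℕ) : Prop where
  lt : ∀ i : Fin m, f .rep 0 i < m
  iff : ∀ i j : Fin m, f .rep 0 i = f .rep 0 j ↔
    ∀ y : Fin n, y.1 < x → (y ∈ (σ i).premise ↔ y ∈ (σ j).premise)

/-- The registers used by the initialization. -/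
def refineRegs : List Reg := [.r2, .r3, .r5, .r6, .r7, .r8]

/-- The refined class of an implication is determined by the pair of its bit in column `x` and its
old representative. `tab` sends such a pair to one plus the first implication having it, with `0`
for a pair not yet met, and that implication becomes the new representative. -/
theorem wp_refineCmd {x : ℕ} (hx : x < n) (h0 : s.reg .r0 = x) (hz : s.reg .zero = 0)
    (hm : s.reg .rowNum = m) (hnW : n ≤ W) (hmW : m + 1 ≤ W) (hmR : m ≤ R)
    (hrep : RepAt σ x s.arr)
    (hK : ∀ u, Agree refineRegs (fun A _ => A = .tab ∨ A = .rep) s u →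
      RepAt σ (x + 1) u.arr → u.time ≤ s.time + m * 100 + 10 → K u) :
    wp (baseInput σ) W R refineCmd K s := by
  have hcols : (baseInput σ).cols = n + 1 := rfl
  set D := refineRegs with hD
  set E : Arr → ℕ → Prop := fun A _ => A = .tab ∨ A = .rep with hE
  have hWW : 1 ≤ W := by omega
  simp only [refineCmd, wp_seq, wp_basic, Basic.Ok, Basic.exec]
  have a0 : Agree D E s (s.setReg .r5 1 1) :=
    (Agree.refl D E s).setReg (by simp [D, refineRegs]) _ _
  refine ⟨hWW, wp_forUp_agree (D := [.r2, .r3]) (E := fun A _ => A = .tab) (N := m) (c := 16)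
    (J := fun i u => ∀ r < i, u.arr .tab 0 r = 0 ∧ u.arr .tab 1 r = 0)
    (by simp) (by simp) (by simp) (by simp) (by omega) (by omega)
    (by simpa using hm) (fun j u u' h _ hJ => by simpa [h] using hJ) (by simp) ?_ ?_⟩
  · intro i hi u hu hJ hui
    have ez : u.reg .zero = 0 := (hu.reg _ (by simp)).trans (by simpa using hz)
    have e5 : u.reg .r5 = 1 := (hu.reg _ (by simp)).trans (by simp)
    simp only [wp_seq, wp_basic, Basic.Ok, Basic.exec, ez, e5, hui, hcols, State.setArr_reg]
    refine ⟨⟨by omega, by simp⟩, ⟨by omega, by simp⟩,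
      (hu.setArr (by simp) _ _ _).setArr (by simp) _ _ _, fun r hr => ?_, trivial, by simp⟩
    simp only [State.setArr_arr]
    by_cases hri : r = i
    · simp [hri]
    · simpa [hri] using hJ r (by omega)
  intro s1 g1 htab t1
  have a1 := a0.trans (g1.weaken (D' := D) (E' := E) (by simp [D, refineRegs])
    (by simp +contextual [E]))
  set g : ℕ → ℕ := fun i => s.arr .rep 0 i with hg
  set bit : ℕ → ℕ := fun i => (baseInput σ).entry i x with hbit
  have hbit' : ∀ i : Fin m, bit i = if (⟨x, hx⟩ : Fin n) ∈ (σ i).premise then 1 else 0 :=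
    fun i => baseInput_entry_premise σ i ⟨x, hx⟩
  have hbit2 : ∀ i < m, bit i < 2 := fun i hi => by
    have := hbit' ⟨i, hi⟩
    dsimp only at this
    rw [this]; split_ifs <;> omega
  have hgm : ∀ i < m, g i < m := fun i hi => hrep.lt ⟨i, hi⟩
  -- `rep` is overwritten in place, so the invariant separates the implications already treated,
  -- whose representative agrees with the table, from the later ones, which still carry the old
  -- value `g`. The third part says that table entries point to earlier implications with the right
  -- pair.
  refine wp_forUp_agree (D := refineRegs) (E := E) (N := m) (c := 60)
    (J := fun i u => (∀ j < i, u.arr .tab (bit j) (g j) = u.arr .rep 0 j + 1) ∧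
      (∀ j, i ≤ j → u.arr .rep 0 j = g j) ∧
      (∀ b < 2, ∀ r < m, ∀ v, u.arr .tab b r = v + 1 → v < i ∧ bit v = b ∧ g v = r))
    (by simp [refineRegs]) (by simp [refineRegs]) (by simp [refineRegs]) (by simp) (by omega)
    (by omega) ((a1.reg _ (by simp [D, refineRegs])).trans hm)
    (fun j u u' h _ hJ => by simpa only [h] using hJ) ?_ ?_ ?_
  · refine ⟨by simp, fun j _ => g1.arr _ _ _ (by simp), fun b hb r hr v hv => ?_⟩
    have := htab r hr
    have hb' : b = 0 ∨ b = 1 := by omega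
    rcases hb' with rfl | rfl
    · omega
    · omega
  · rintro i hi u hu ⟨h1, h2, h3⟩ hui
    have a2 := a1.trans hu
    have ez : u.reg .zero = 0 := (a2.reg _ (by simp [D, refineRegs])).trans hz
    have e0 : u.reg .r0 = x := (a2.reg _ (by simp [D, refineRegs])).trans h0
    have hent := baseInput_entry_le σ (by omega) i x
    have hb := hbit2 i hi
    have hgi := hgm i hi
    have hbi : (baseInput σ).entry i x = bit i := rfl
    simp only [wp_seq, wp_basic, wp_ifZero, Basic.Ok, Basic.exec, hui, ez, e0,
      State.setReg_reg, ne_eq, reduceCtorEq, not_false_eq_true, Function.update_of_ne,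
      Function.update_self, State.setReg_arr, State.tick_reg, State.tick_arr, State.setArr_reg,
      h2 i le_rfl, hcols, ArithOp.eval, hbi]
    have f0 := ((hu.setReg (d := .r6) (by simp [D, refineRegs]) (bit i) 1).setReg (d := .r7)
      (by simp [D, refineRegs]) (g i) 8).setReg (d := .r8) (by simp [D, refineRegs])
      (u.arr .tab (bit i) (g i)) 8
    refine ⟨by omega, by omega, by omega, fun hv => ⟨⟨hWW, Or.inr (by omega)⟩,
      ⟨by omega, Or.inl (by omega)⟩, ⟨by omega, Or.inl (by omega)⟩,
      (((f0.tick 1).setReg (by simp [D, refineRegs]) _ _).setArr (by simp [E]) _ _ _).setArr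
        (by simp [E]) _ _ _, ⟨?_, ?_, ?_⟩, by simp, by simp⟩,
      fun hv => ⟨⟨hWW, Or.inl (by omega)⟩, ⟨by omega, Or.inl (by omega)⟩,
      (((f0.tick 1).setReg (by simp [D, refineRegs]) _ _).setArr (by simp [E]) _ _ _).tick 1,
      ⟨?_, ?_, ?_⟩, by simp, by simp⟩⟩
    · intro j hj
      simp only [State.setArr_arr, State.setReg_arr, State.tick_arr]
      simp only [reduceCtorEq, false_and, if_false, true_and]
      by_cases hji : j = i
      · simp [hji]
      · have h4 := h1 j (by omega)
        rw [if_neg hji, if_neg, h4]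
        rintro ⟨h5, h6⟩
        rw [h5, h6, hv] at h4
        omega
    · intro j hj
      simp only [State.setArr_arr, State.setReg_arr, State.tick_arr]
      rw [if_neg (by omega), if_neg (by simp)]
      exact h2 j (by omega)
    · intro b hb r hr v
      simp only [State.setArr_arr, State.setReg_arr, State.tick_arr]
      simp only [reduceCtorEq, false_and, if_false, true_and]
      split_ifs with h
      · intro hiv
        obtain ⟨rfl, rfl⟩ := h
        obtain rfl : i = v := by omega
        exact ⟨by omega, rfl, rfl⟩
      · intro hv
        obtain ⟨h4, h5⟩ := h3 b hb r hr v hv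
        exact ⟨by omega, h5⟩
    · intro j hj
      simp only [State.setArr_arr, State.setReg_arr, State.tick_arr]
      simp only [reduceCtorEq, false_and, if_false, true_and]
      by_cases hji : j = i
      · subst hji; rw [if_pos rfl]; omega
      · rw [if_neg hji, h1 j (by omega)]
    · intro j hj
      simp only [State.setArr_arr, State.setReg_arr, State.tick_arr]
      rw [if_neg (by omega)]
      exact h2 j (by omega)
    · intro b hb r hr v
      simp only [State.setArr_arr, State.setReg_arr, State.tick_arr]
      simp only [reduceCtorEq, false_and, if_false]
      intro hv
      obtain ⟨h4, h5⟩ := h3 b hb r hr v hv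
      exact ⟨by omega, h5⟩
  · rintro u hu ⟨h1, h2, h3⟩ ht
    have key : ∀ j < m, u.arr .rep 0 j < m ∧ bit (u.arr .rep 0 j) = bit j ∧
        g (u.arr .rep 0 j) = g j := fun j hj =>
      h3 _ (hbit2 j hj) _ (hgm j hj) _ (h1 j hj)
    refine hK u (a1.trans hu) ⟨fun i => (key i i.2).1, fun i j => ?_⟩ ?_
    · have hiff : u.arr .rep 0 i = u.arr .rep 0 j ↔ bit i = bit j ∧ g i = g j := by
        constructor
        · intro h
          obtain ⟨-, h5, h6⟩ := key i i.2
          obtain ⟨-, h7, h8⟩ := key j j.2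
          rw [← h5, ← h6, ← h7, ← h8, h]
          exact ⟨rfl, rfl⟩
        · rintro ⟨h5, h6⟩
          have h7 := h1 i i.2
          have h8 := h1 j j.2
          rw [h5, h6, h8] at h7
          omega
      rw [hiff, hbit', hbit', show (g i = g j ↔ _) from hrep.iff i j]
      constructor
      · rintro ⟨h5, h6⟩ y hy
        by_cases hyx : y.1 < x
        · exact h6 y hyx
        · obtain rfl : y = ⟨x, hx⟩ := Fin.ext (by simp; omega)
          by_cases hi : (⟨x, hx⟩ : Fin n) ∈ (σ i).premise <;>
            by_cases hj : (⟨x, hx⟩ : Fin n) ∈ (σ j).premise <;> simp_all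
      · intro h5
        exact ⟨by simp [h5 ⟨x, hx⟩ (by simp)], fun y hy => h5 y (by omega)⟩
    · simp at t1 ht; omega

theorem wp_initCmd (hn : 0 < n) (hnW : n + 1 ≤ W) (hmW : m + 1 ≤ W) (hmR : m ≤ R)
    (hK : ∀ u, u.reg .zero = 0 → u.reg .num = n → u.reg .rowNum = m → u.reg .lev = 0 →
      u.reg .vert = 0 → u.reg .active = 1 → RepOk σ u.arr → (∀ v, u.arr .acc 0 v = 0) →
      u.cur = [] → u.out = [] → u.time ≤ n * (m * 100 + 15) + 10 → K u) :
    wp (baseInput σ) W R initCmd K State.initial := by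
  have hcols : (baseInput σ).cols = n + 1 := rfl
  have hrows : (baseInput σ).rows = m := rfl
  set D : List Reg := [.num, .rowNum, .r0, .r1, .r2, .r3, .r5, .r6, .r7, .r8, .active] with hD
  set E : Arr → ℕ → Prop := fun A _ => A = .tab ∨ A = .rep with hE
  simp only [initCmd, wp_seq, wp_basic, Basic.Ok, Basic.exec, hcols, hrows, ArithOp.eval,
    State.setReg_reg, Function.update_self, Nat.add_sub_cancel]
  have a0 := (((Agree.refl D E State.initial).setReg (d := .num) (by simp [D]) (n + 1) 1).setReg
    (d := .num) (by simp [D]) n 2).setReg (d := .rowNum) (by simp [D]) m 1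
  refine ⟨by omega, ⟨by omega, Or.inl (by omega)⟩, by omega, wp_forUp_agree
    (D := [.r0, .r1, .r2, .r3, .r5, .r6, .r7, .r8]) (E := E) (N := n) (c := m * 100 + 10)
    (J := fun x u => RepAt σ x u.arr) (by simp) (by simp) (by simp) (by simp) (by omega) (by omega)
    (by simp) (fun j u u' h _ hJ => by simpa only [h] using hJ)
    ⟨fun i => ?_, by simp [State.initial]⟩ ?_ ?_⟩
  · have := i.2
    simp [State.initial]; omega
  · intro x hx u hu hJ hux
    refine wp_refineCmd hx hux ((hu.reg _ (by simp)).trans (by simp [State.initial]))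
      ((hu.reg _ (by simp)).trans (by simp)) (by omega) hmW hmR hJ fun u' h1 h2 h3 => ?_
    exact ⟨hu.trans (h1.weaken (by simp [refineRegs]) (fun _ _ h => h)), h2,
      (h1.reg _ (by simp [refineRegs])).trans hux, by omega⟩
  · intro u hu hJ ht
    have a1 := a0.trans (hu.weaken (by simp [D]) (fun _ _ h => h))
    simp only [wp_seq, wp_basic, Basic.Ok, Basic.exec]
    refine ⟨by omega, hK _ ?_ ?_ ?_ ?_ ?_ (by simp) ⟨hJ.lt, fun i j => ?_⟩ (fun v => ?_) ?_ ?_ ?_⟩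
    · simpa [State.initial] using a1.reg .zero (by simp [D])
    · simpa using hu.reg .num (by simp)
    · simpa using hu.reg .rowNum (by simp)
    · simpa [State.initial] using a1.reg .lev (by simp [D])
    · simpa [State.initial] using a1.reg .vert (by simp [D])
    · rw [State.setReg_arr, hJ.iff, Finset.ext_iff]
      exact ⟨fun h y => h y y.2, fun h y _ => h y⟩
    · simpa [State.initial] using a1.arr .acc 0 v (by simp [E])
    · exact a1.cur
    · exact a1.out
    · rw [show m * 100 + 10 + 5 = m * 100 + 15 by ring] at ht
      simp [State.initial] at ht ⊢; omega

end

end Ram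

/-! ### Runs of programs -/

section
variable (P : Program) (T : InputTable)

theorem step_out_eq (s : Configuration) : (P.step T s).out = s.out ∨
    (P.step T s).out = s.out ++ [s.cur] := by
  unfold Program.step
  split
  · simp
  · rename_i i _
    cases i <;> simp [Instr.exec, Configuration.set]

theorem iterate_out_prefix (s : Configuration) (t : ℕ) : s.out <+: ((P.step T)^[t] s).out := by
  induction t with
  | zero => exact List.prefix_rfl
  | succ t ih =>
    rw [Function.iterate_succ_apply']
    refine ih.trans ?_
    rcases step_out_eq P T ((P.step T)^[t] s) with h | h <;> simp [h]

theorem iterate_of_halted {s : Configuration} (h : P.Halted s) (t : ℕ) :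
    (P.step T)^[t] s = s := by
  refine Function.iterate_fixed ?_ t
  unfold Program.step
  rw [List.getElem?_eq_none h]

theorem run_add (t u : ℕ) : P.run T (t + u) = (P.step T)^[u] (P.run T t) := by
  rw [add_comm, Program.run, Function.iterate_add_apply]; rfl

theorem run_out_prefix {t u : ℕ} (h : t ≤ u) : (P.run T t).out <+: (P.run T u).out := by
  obtain ⟨v, rfl⟩ := Nat.exists_eq_add_of_le h
  rw [run_add]; exact iterate_out_prefix P T _ v

theorem run_of_halted {t u : ℕ} (h : P.Halted (P.run T t)) (htu : t ≤ u) :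
    P.run T u = P.run T t := by
  obtain ⟨v, rfl⟩ := Nat.exists_eq_add_of_le htu
  rw [run_add]; exact iterate_of_halted P T h v

variable {P T}

theorem out_eq_of_halted {t u : ℕ} (h : P.Halted (P.run T t)) (h' : P.Halted (P.run T u)) :
    (P.run T t).out = (P.run T u).out := by
  rcases le_total t u with htu | htu
  · rw [run_of_halted P T h htu]
  · rw [run_of_halted P T h' htu]

theorem out_prefix_of_halted {t u : ℕ} (h : P.Halted (P.run T u)) :
    (P.run T t).out <+: (P.run T u).out := by
  rcases le_total t u with htu | htu
  · exact run_out_prefix P T htu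
  · rw [run_of_halted P T h htu]

variable {n : ℕ} {L : List (Finset (Fin n))}

/-- Output is append-only, so the output at any time is a prefix of the final one, and the solutions
still to come form a tail of `L`. An emitted solution is the head of this tail. -/
theorem drop_eq_cons_of_output {t u : ℕ} (h : P.Halted (P.run T u))
    (hL : List.Forall₂ IsListing (P.run T u).out L) {l : List ℕ}
    (ho : (P.run T (t + 1)).out = (P.run T t).out ++ [l]) :
    ∃ S, IsListing l S ∧
      L.drop (P.run T t).out.length = S :: L.drop (P.run T (t + 1)).out.length := by
  obtain ⟨r, hr⟩ := out_prefix_of_halted (t := t + 1) h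
  rw [ho] at hr ⊢
  set q := (P.run T t).out.length
  have hlen := hL.length_eq
  rw [← hr] at hlen
  have hq : q < L.length := by rw [← hlen]; simp [q]
  refine ⟨L[q], ?_, by rw [List.drop_eq_getElem_cons hq, List.length_append, List.length_singleton]⟩
  have := List.forall₂_iff_get.1 hL |>.2 q (by rw [← hr]; simp [q]) hq
  simp only [List.get_eq_getElem, ← hr] at this
  simpa [q] using this

theorem drop_eq_nil_of_halted {t u : ℕ} (h : P.Halted (P.run T u))
    (hL : List.Forall₂ IsListing (P.run T u).out L) (ht : P.Halted (P.run T t)) :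
    L.drop (P.run T t).out.length = [] := by
  rw [out_eq_of_halted ht h, hL.length_eq]
  simp

end

namespace Ram

/-! ### The enumeration of meet-irreducible elements -/

/-- Wait for the next event on the current level. -/
def eventCmd (P : Program) : Cmd :=
  .ifZero .lev rootEvent (.basic (.const .r5 1) ;; fillMarks .r5 ;; simulate P)

/-- Wait for the next event on the current level and react to it. -/
def bodyCmd (P : Program) : Cmd :=
  eventCmd P ;;
  .ifZero .event
    (.ifZero .lev (.basic (.const .active 0)) (.basic (.arithConst .sub .lev .lev 1)))
    (.basic (.arith .sub .r5 .num .lev) ;; .ifZero .r5 outputCmd pushLevel)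

/-- Enumerate the meet-irreducible elements, using the program `P` for maximal independent
sets. -/
def mainCmd (P : Program) : Cmd := initCmd ;; .loop .active (bodyCmd P)

section
variable {n m : ℕ} (σ : Fin m → Implication (Fin n)) (P : Program)
  (L : Finset (Fin n) → List (Finset (Fin n)))

/-- The program `P` lists `L Y` for the hypergraph of `Y`, within the given bounds. -/
structure SimData (W S τ : ℕ) : Prop where
  listing : ∀ Y, ∃ t, P.Halted (P.run (subInput σ Y) t) ∧
    List.Forall₂ IsListing (P.run (subInput σ Y) t).out (L Y)
  ne_nil : ∀ Y, L Y ≠ []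
  mem : ∀ Y S, S ∈ L Y ↔ S ∈ maximalIndependentSets (edgesInto (Set.range σ) Y)
  bound : ∀ k acc Y, Stage (Set.range σ) k acc Y → k < n → ∀ t a,
    (P.run (subInput σ Y) t).mem a ≤ W ∧ ((P.run (subInput σ Y) t).mem a ≠ 0 → a < S)
  delay : ∀ k acc Y, Stage (Set.range σ) k acc Y → k < n → P.HasDelay (subInput σ Y) 0 τ
  small : ∀ i ∈ P, Instr.Small W i
  length_le : P.length ≤ W

/-- The level `k + 1` enumerates the hypergraph of `Y`, and the members of `R` remain. -/
structure LevelOk (S : ℕ) (f : Arr → ℕ → ℕ → ℕ) (k : ℕ) (acc Y : Finset (Fin n))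
    (R : List (Finset (Fin n))) : Prop where
  stage : Stage (Set.range σ) k acc Y
  acc : Holds f .acc (k + 1) acc
  table : SubTable (baseInput σ) (subInput σ Y) f (k + 1)
  sim : ∃ t, SimState S (k + 1) (P.run (subInput σ Y) t) f ∧ (P.run (subInput σ Y) t).cur = [] ∧
    R = (L Y).drop (P.run (subInput σ Y) t).out.length

/-- With the current level `k` and the next root `v`, the list of meet-irreducible elements still
to be output is `rem`, and the next output is preceded by at most `pot` events. -/
inductive Pending (S : ℕ) (f : Arr → ℕ → ℕ → ℕ) (v : ℕ) :
    ℕ → List (Finset (Fin n)) → ℕ → Prop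
  | root : Pending S f v 0
      ((((List.finRange n).map fun x => ({x}ᶜ : Finset (Fin n))).drop v).flatMap
        fun S => completions L n (∅ ∪ Sᶜ) Sᶜ) (if v < n then n else n + 1)
  | level {k rem pot acc Y R} (h : Pending S f v k rem pot) (hl : LevelOk σ P L S f k acc Y R)
      (hk : k + 1 ≤ n) : Pending S f v (k + 1)
      ((R.flatMap fun S => completions L (n - (k + 1)) (acc ∪ Sᶜ) Sᶜ) ++ rem)
      (if R = [] then n + 2 + k else n - (k + 1))

variable {σ P L} {W R S τ v k pot : ℕ} {f f' : Arr → ℕ → ℕ → ℕ} {rem : List (Finset (Fin n))}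

theorem SimState.congr {c : Configuration} (h : SimState S k c f)
    (hf : ∀ A i, A ≠ .out → A ≠ .seen → f' A k i = f A k i) : SimState S k c f' where
  bank := bankOk_congr (fun A hA i => hf A i (by rintro rfl; simp at hA) (by rintro rfl; simp at hA)) h.bank
  cell := (cell_congr (fun A hA i => hf A i (by rintro rfl; simp at hA) (by rintro rfl; simp at hA))).trans h.cell
  pc := (hf _ _ (by simp) (by simp)).trans h.pc

theorem SubTable.congr {T H : InputTable} (h : SubTable T H f k)
    (hf : ∀ A i, A = .siz ∨ A = .edg → f' A k i = f A k i) : SubTable T H f' k where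
  rows := (hf _ _ (by simp)).trans h.rows
  entry := fun i x => by rw [h.entry, hf _ _ (by simp)]

theorem LevelOk.congr {acc Y R} (h : LevelOk σ P L S f k acc Y R)
    (hf : ∀ A i, A ≠ .out → A ≠ .seen → f' A (k + 1) i = f A (k + 1) i) : LevelOk σ P L S f' k acc Y R where
  stage := h.stage
  acc := fun v => (hf _ _ (by simp) (by simp)).trans (h.acc v)
  table := h.table.congr fun A i hA => hf A i (by rintro rfl; simp at hA) (by rintro rfl; simp at hA)
  sim := by
    obtain ⟨t, h1, h2⟩ := h.sim
    exact ⟨t, h1.congr hf, h2⟩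

/-- `out` and `seen` are scratch: the marks are rewritten before a simulation resumes, and the flags
are cleared before each use. -/
theorem Pending.congr (h : Pending σ P L S f v k rem pot)
    (hf : ∀ A l i, 1 ≤ l → l ≤ k → A ≠ .out → A ≠ .seen → f' A l i = f A l i) :
    Pending σ P L S f' v k rem pot := by
  induction h with
  | root => exact .root
  | @level k rem pot acc Y R _ hl hk ih =>
    exact .level (ih fun A l i h1 h2 => hf A l i h1 (by omega))
      (hl.congr fun A i => hf A (k + 1) i (by omega) le_rfl) hk

/-- The worst case after an output: climb from level `k` to the root, then descend to level `n`
again. -/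
theorem Pending.le (h : Pending σ P L S f v k rem pot) : k ≤ n ∧ pot ≤ n + 1 + k := by
  cases h with
  | root => exact ⟨by omega, by split_ifs <;> omega⟩
  | level h hl hk => exact ⟨hk, by split_ifs <;> omega⟩

/-- The invariant of the main loop. -/
structure MainInv (σ : Fin m → Implication (Fin n)) (s : State) : Prop where
  zero : s.reg .zero = 0
  num : s.reg .num = n
  rowNum : s.reg .rowNum = m
  rep : RepOk σ s.arr
  acc : ∀ v, s.arr .acc 0 v = 0
  cur : s.cur = []

theorem MainInv.congr {s s' : State} (h : MainInv σ s)
    (hr : ∀ r ∈ [Reg.zero, .num, .rowNum], s'.reg r = s.reg r)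
    (ha : ∀ A ∈ [Arr.rep, .acc], ∀ i, s'.arr A 0 i = s.arr A 0 i) (hc : s'.cur = []) :
    MainInv σ s' where
  zero := (hr _ (by simp)).trans h.zero
  num := (hr _ (by simp)).trans h.num
  rowNum := (hr _ (by simp)).trans h.rowNum
  rep := ⟨fun i => by rw [ha _ (by simp)]; exact h.rep.lt i,
    fun i j => by rw [ha _ (by simp), ha _ (by simp)]; exact h.rep.iff i j⟩
  acc := fun v => (ha _ (by simp) v).trans (h.acc v)
  cur := hc

/-- The situation after an event on the level `k`. -/
def EventPost (σ : Fin m → Implication (Fin n)) (P : Program)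
    (L : Finset (Fin n) → List (Finset (Fin n))) (S k : ℕ) (rem : List (Finset (Fin n)))
    (pot : ℕ) (s' : State) : Prop :=
  (s'.reg .event = 0 ∧ ((k = 0 ∧ rem = []) ∨ ∃ k' pot', k = k' + 1 ∧ pot = n + 2 + k' ∧
    Pending σ P L S s'.arr (s'.reg .vert) k' rem pot')) ∨
  (s'.reg .event = 1 ∧ ∃ acc X rem' pot',
    rem = completions L (n - k) (acc ∪ Xᶜ) Xᶜ ++ rem' ∧ pot = n - k ∧
    Pending σ P L S s'.arr (s'.reg .vert) k rem' pot' ∧ Holds s'.arr .acc k acc ∧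
    Holds s'.arr .out k Xᶜ ∧ Stage (Set.range σ) k (acc ∪ Xᶜ) Xᶜ)

/-- Resuming the simulation on a level takes the next member off its remaining list, or finds the
list exhausted; level `0` does the same with the list of roots. The result is phrased uniformly, so
that the main loop need not distinguish roots from other choices. -/
theorem wp_eventCmd {K : State → Prop} {s : State} (hd : SimData σ P L W S τ) (hn : 0 < n)
    (hnW : n + 1 ≤ W) (hnR : n ≤ R) (hSR : S < R) (hSW : S ≤ W) (hs : MainInv σ s)
    (hp : Pending σ P L S s.arr (s.reg .vert) k rem pot) (hk : s.reg .lev = k)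
    (hK : ∀ s', MainInv σ s' → s'.reg .lev = k → s'.reg .active = s.reg .active →
      s'.out = s.out → s'.time ≤ s.time + n * 13 + (τ + 1) * (612 + 4 * P.length) + 30 →
      EventPost σ P L S k rem pot s' → K s') :
    wp (baseInput σ) W R (eventCmd P) K s := by
  have hcols : (baseInput σ).cols = n + 1 := rfl
  rw [eventCmd, wp_ifZero, hk]
  cases hp with
  | root =>
    refine ⟨fun _ => ?_, fun h => absurd rfl h⟩
    refine wp_rootEvent hk (by omega) hs.zero hs.num (by omega) hnR (by omega) ?_
    intro s' a1 t1 h1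
    refine hK s' (hs.congr (fun r hr => a1.reg r ?_) (fun A hA i => a1.arr A 0 i ?_)
      (a1.cur.trans hs.cur)) ((a1.reg _ (by simp)).trans hk) (a1.reg _ (by simp)) a1.out
      (by simp at t1; omega) ?_
    · fin_cases hr <;> simp
    · fin_cases hA <;> simp
    · simp only [State.tick_reg] at h1
      rcases h1 with ⟨h2, h3, h4⟩ | ⟨h2, h3, h4, h5⟩
      · refine Or.inl ⟨h3, Or.inl ⟨rfl, ?_⟩⟩
        rw [List.drop_eq_nil_of_le (by simpa using h2)]
        rfl
      -- A root is a choice with nothing chosen before, which explains the form `∅ ∪ Sᶜ` in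
      -- `meetIrreducibleList`.
      · refine Or.inr ⟨h3, ∅, {⟨_, h2⟩}ᶜ, _, _, ?_, ?_, by rw [h4]; exact .root, fun x => ?_,
          fun x => ?_, ?_⟩
        · rw [List.drop_eq_getElem_cons (by simpa using h2), List.flatMap_cons]
          simp
        · rw [if_pos h2]; rfl
        · rw [a1.arr _ _ _ (by simp)]
          simpa using hs.acc x
        · rw [h5 x x.2]
          simp only [compl_compl, Finset.mem_singleton, Fin.ext_iff]
          congr
        · simpa using Stage.root (B := Set.range σ) (⟨_, h2⟩ : Fin n)
  | @level k rem pot acc Y Rm hp hl hkn =>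
    refine ⟨fun h => by omega, fun _ => ?_⟩
    obtain ⟨t, hst, hcur, rfl⟩ := hl.sim
    have hHc : (subInput σ Y).cols = n := rfl
    simp only [wp_seq, wp_basic, Basic.Ok, Basic.exec]
    refine ⟨by omega, wp_fillMarks (k := k + 1) (n := n) (by simp) (by simpa using hk) (by omega)
      (by simpa using hs.num) (by omega) hnR (by omega) fun s1 a1 m1 t1 => ?_⟩
    have hctx : SimContext (baseInput σ) (subInput σ Y) W R S (k + 1) s1 :=
      { lev := (a1.reg _ (by simp)).trans (by simpa using hk)
        lt := by omega
        zero := (a1.reg _ (by simp)).trans (by simpa using hs.zero)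
        num := (a1.reg _ (by simp)).trans (by simpa [hHc] using hs.num)
        word := by omega
        space := hSR
        word_space := hSW
        len := hnR
        entry := fun i x => (baseInput_entry_le σ hn i x).trans (by omega)
        table := hl.table.congr fun A i hA => a1.arr A _ i (by rintro ⟨rfl, -⟩; simp at hA) }
    have hdel := (hd.delay k acc Y hl.stage (by omega)).2 t (by omega)
    refine wp_simulate (t₀ := t) hd.small hd.length_le (hd.bound k acc Y hl.stage (by omega))
      hdel hctx (hst.congr fun A i hA _ => a1.arr A _ i (by simp [hA])) ?_ fun s' f2 hr => ?_
    · intro v hv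
      rw [m1 v hv, hcur]
      simp
    have hout : s'.out = s.out := f2.out.trans a1.out
    have hreg : ∀ r, r ∉ [Reg.r0, .r1, .r5] → r ∉ Reg.pc :: simRegs → s'.reg r = s.reg r := by
      intro r h1 h2
      simp at h1
      rw [f2.reg r h2, a1.reg r (by simp [h1])]
      simp [h1]
    have harr : ∀ A l i, l ≤ k → s'.arr A l i = s.arr A l i := by
      intro A l i hlk
      rw [f2.arr _ _ _ (by rintro ⟨-, h⟩; omega), a1.arr _ _ _ (by rintro ⟨-, h⟩; omega)]
      rfl
    have harr' : ∀ A l i, A ∉ simArrs → s'.arr A l i = s.arr A l i := by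
      intro A l i hA
      rw [f2.arr _ _ _ (by tauto), a1.arr _ _ _ (by rintro ⟨rfl, -⟩; simp [simArrs] at hA)]
      rfl
    refine hK (s'.tick 1) (hs.congr (fun r hr => hreg r ?_ ?_) (fun A _ i => harr A 0 i (by omega))
      (f2.cur.trans (a1.cur.trans hs.cur))) ((hreg _ (by simp) (by simp [simRegs])).trans hk)
      (hreg _ (by simp) (by simp [simRegs])) hout ?_ ?_
    · fin_cases hr <;> simp
    · fin_cases hr <;> simp [simRegs]
    · have := f2.time
      simp [hHc] at t1
      simp only [State.tick_time]
      omega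
    · have hv : s'.reg .vert = s.reg .vert := hreg _ (by simp) (by simp [simRegs])
      have hp' : Pending σ P L S s'.arr (s'.reg .vert) k rem pot := by
        rw [hv]
        exact hp.congr fun A l i _ h2 _ _ => harr A l i h2
      obtain ⟨u, hu, hlist⟩ := hd.listing Y
      obtain ⟨t', ht', ho, hr⟩ := hr
      rcases hr with ⟨hh, hst', he⟩ | ⟨ho', hc', hst', he, hm'⟩
      · have := drop_eq_nil_of_halted hu hlist hh
        rw [ho] at this
        rw [this]
        exact Or.inl ⟨he, Or.inr ⟨k, pot, rfl, by simp, by simpa using hp'⟩⟩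
      · obtain ⟨X, hX, hdrop⟩ := drop_eq_cons_of_output hu hlist ho'
        rw [ho] at hdrop
        have hXm : X ∈ maximalIndependentSets (edgesInto (Set.range σ) Y) := by
          rw [← hd.mem]
          exact List.mem_of_mem_drop (hdrop ▸ List.mem_cons_self)
        have hacc : Holds s'.arr .acc (k + 1) acc := fun v => by
          rw [harr' _ _ _ (by simp [simArrs])]; exact hl.acc v
        refine Or.inr ⟨he, acc, X, _, _, ?_, ?_, .level hp' ⟨hl.stage, hacc, hl.table.congr
          fun A i hA => harr' A _ i ?_, t' + 1, hst', hc', rfl⟩ hkn, hacc, fun x => ?_,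
          hl.stage.step hXm⟩
        · rw [hdrop, List.flatMap_cons, List.append_assoc]
        · rw [hdrop]; simp
        · rcases hA with rfl | rfl <;> simp [simArrs]
        · refine (hm' x x.2).trans ?_
          have : (x : ℕ) ∈ (P.run (subInput σ Y) t').cur ↔ x ∈ X := by
            rw [hX.2]
            exact ⟨fun ⟨y, hy, hyx⟩ => Fin.ext hyx ▸ hy, fun h => ⟨x, h, rfl⟩⟩
          simp [this]

/-- The effect of one iteration of the main loop. -/
def BodyPost (σ : Fin m → Implication (Fin n)) (P : Program)
    (L : Finset (Fin n) → List (Finset (Fin n))) (S : ℕ) (rem : List (Finset (Fin n)))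
    (pot : ℕ) (s s' : State) : Prop :=
  (s'.out = s.out ∧ s'.reg .active = 1 ∧ ∃ pot' < pot,
    Pending σ P L S s'.arr (s'.reg .vert) (s'.reg .lev) rem pot') ∨
  (∃ l M rem' pot', s'.out = s.out ++ [l] ∧ IsListing l M ∧ rem = M :: rem' ∧
    s'.reg .active = 1 ∧ Pending σ P L S s'.arr (s'.reg .vert) (s'.reg .lev) rem' pot') ∨
  (rem = [] ∧ s'.out = s.out ∧ s'.reg .active = 0)

/-- An exhausted level is left upwards, or ends the loop on level `0`; a new choice leads one level
down, or to an output on level `n`. Moving up or down decreases the potential. -/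
theorem wp_bodyCmd {K : State → Prop} {s : State} (hd : SimData σ P L W S τ) (hn : 0 < n)
    (hnW : n + 1 ≤ W) (hmW : m + 1 ≤ W) (hnR : n ≤ R) (hmR : m ≤ R) (hSR : S < R) (hSW : S ≤ W)
    (hs : MainInv σ s) (ha : s.reg .active = 1)
    (hp : Pending σ P L S s.arr (s.reg .vert) (s.reg .lev) rem pot)
    (hK : ∀ s', MainInv σ s' → s'.time ≤ s.time + (τ + n + m + 1) * (800 + 4 * P.length) →
      BodyPost σ P L S rem pot s s' → K s') :
    wp (baseInput σ) W R (bodyCmd P) K s := by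
  have hcols : (baseInput σ).cols = n + 1 := rfl
  rw [bodyCmd, wp_seq]
  obtain ⟨k, hk⟩ : ∃ k, s.reg .lev = k := ⟨_, rfl⟩
  rw [hk] at hp
  have hkn := hp.le.1
  -- The first summand pays for the simulated steps, the second for constants, the third for work
  -- linear in `n + m`.
  have hB : (τ + n + m + 1) * (800 + 4 * P.length) = (τ + 1) * (612 + 4 * P.length) +
      (τ + 1) * 188 + (n + m) * (800 + 4 * P.length) := by ring
  have hB' : (n + m) * 800 ≤ (n + m) * (800 + 4 * P.length) :=
    Nat.mul_le_mul_left _ (by omega)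
  refine wp_eventCmd hd hn hnW hnR hSR hSW hs hp hk fun s1 hs1 hk1 ha1 ho1 ht1 hpost => ?_
  rw [ha] at ha1
  rw [wp_ifZero]
  rcases hpost with ⟨he, hpost⟩ | ⟨he, acc, X, rem', pot', hrem, hpot, hp1, hacc, hout, hst⟩
  · refine ⟨fun _ => ?_, fun h => absurd he h⟩
    simp only [wp_ifZero, wp_basic, Basic.Ok, Basic.exec, State.tick_reg, hk1]
    rcases hpost with ⟨rfl, rfl⟩ | ⟨k', pot', rfl, rfl, hp1⟩
    · refine ⟨fun _ => ⟨by omega, hK _ (hs1.congr ?_ (fun _ _ _ => rfl) hs1.cur) ?_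
        (Or.inr (Or.inr ⟨rfl, ho1, by simp⟩))⟩, fun h => absurd rfl h⟩
      · simp
      · simp
        omega
    · refine ⟨fun h => by omega, fun _ => ⟨⟨by omega, Or.inl (by simp [ArithOp.eval])⟩,
        hK _ (hs1.congr ?_ (fun _ _ _ => rfl) hs1.cur) ?_
        (Or.inl ⟨ho1, by simpa using ha1, pot', ?_, ?_⟩)⟩⟩
      · simp
      · simp
        omega
      · have := hp1.le
        omega
      · simpa [ArithOp.eval] using hp1
  · refine ⟨fun h => by omega, fun _ => ?_⟩
    simp only [wp_seq, wp_ifZero, wp_basic, Basic.Ok, Basic.exec, State.tick_reg, hk1, hs1.num,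
      State.setReg_reg, Function.update_self, ArithOp.eval]
    refine ⟨Or.inr (by omega), fun h0 => ?_, fun h0 => ?_⟩
    · obtain rfl : k = n := by omega
      refine wp_outputCmd (k := k) (n := k) (Y := Xᶜ) (A := acc) (by simpa using hk1) (by omega)
        (by simpa using hs1.num) (by omega) (by omega) hs1.cur hout hacc ?_
      rintro u hr hA hc ⟨l, hl, hlist⟩ ht
      have hr' : ∀ r, r ∉ [Reg.r0, .r1, .r5] → u.reg r = s1.reg r := fun r h => by
        rw [hr r h]
        simp at h
        simp [h]
      have hA' : u.arr = s1.arr := hA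
      refine hK _ (hs1.congr (fun r hr => hr' r ?_) (fun A _ i => ?_) hc) ?_
        (Or.inr (Or.inl ⟨l, _, rem', pot', hl.trans (by simp [ho1]), hlist, ?_, ?_, ?_⟩))
      · fin_cases hr <;> simp
      · exact congrFun (congrFun (congrFun hA' A) 0) i
      · simp at ht ⊢
        omega
      · rw [hrem, Nat.sub_self]; rfl
      · exact (hr' _ (by simp)).trans ha1
      · simp only [State.tick_reg, State.tick_arr, hA', hr' .vert (by simp),
          hr' .lev (by simp), hk1]
        exact hp1
    · have hkn' : k < n := by omega
      refine wp_pushLevel (S := S) (k := k) (Y := Xᶜ) (A := acc) (by simpa using hk1) hkn'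
        (by simpa using hs1.zero) (by simpa using hs1.num) (by simpa using hs1.rowNum) hnW hmW
        hmR hnR hs1.rep hout hacc ?_
      intro u a hlu hau htab hsim ht
      have hr' : ∀ r, r ∉ pushRegs → u.reg r = s1.reg r := fun r h => by
        rw [a.reg r h]
        have : r ≠ .r5 := by rintro rfl; simp [pushRegs] at h
        simp [this]
      have hA' : ∀ A l i, l ≠ k + 1 → A ≠ .seen → u.arr A l i = s1.arr A l i := fun A l i h h' =>
        a.arr A l i (by tauto)
      refine hK _ (hs1.congr (fun r hr => hr' r ?_) (fun A hA i => hA' _ _ _ (by omega) ?_)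
        (a.cur.trans hs1.cur)) ?_ (Or.inl ⟨?_, ?_, n - (k + 1), by omega, ?_⟩)
      · fin_cases hr <;> simp [pushRegs]
      · fin_cases hA <;> simp
      · simp at ht ⊢
        omega
      · exact (a.out.trans ho1 : _)
      · exact (hr' _ (by simp [pushRegs])).trans ha1
      · have h1 : Pending σ P L S u.arr (u.reg .vert) k rem' pot' := by
          rw [hr' .vert (by simp [pushRegs])]
          exact hp1.congr fun A l i _ h2 _ h3 => hA' A l i (by omega) h3
        have h2 : LevelOk σ P L S u.arr k (acc ∪ Xᶜ) Xᶜ (L Xᶜ) :=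
          ⟨hst, hau, htab, 0, hsim, rfl, rfl⟩
        -- A freshly entered level has a nonempty list, so the next event there is again a new
        -- choice; without this the potential would jump up on the way down.
        have h3 := Pending.level h1 h2 hkn'
        rw [if_neg (hd.ne_nil _)] at h3
        simp only [State.tick_reg, State.tick_arr, hlu]
        rw [hrem, show n - k = n - (k + 1) + 1 by omega]
        exact h3

end

/-! ### Delay -/

/-- From the configuration `c` the program halts with output `O`. Until it halts or outputs
something `b` units of time pass at most, and later on these times are at most `d`. The memory is
bounded all the time. -/
inductive Delayed (Q : Program) (T : InputTable) (V S d : ℕ) (O : List (List ℕ)) :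
    ℕ → Configuration → Prop
  | halt {b c} (h : Q.Halted c) (hm : MemBound V S c.mem) (ho : c.out = O) : Delayed Q T V S d O b c
  | step {b b' c c' t} (h : Reach Q T V S c c' t) (h' : Delayed Q T V S d O b' c')
      (hb : t + b' ≤ b ∨ (t ≤ b ∧ b' ≤ d ∧ c.out.length < c'.out.length)) :
      Delayed Q T V S d O b c

section
variable {Q : Program} {T : InputTable} {V S d b : ℕ} {O : List (List ℕ)} {c : Configuration}

theorem halted_or_length_lt_of_le {t u : ℕ} {j : ℕ} (htu : t ≤ u)
    (h : Q.Halted ((Q.step T)^[t] c) ∨ j < ((Q.step T)^[t] c).out.length) :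
    Q.Halted ((Q.step T)^[u] c) ∨ j < ((Q.step T)^[u] c).out.length := by
  obtain ⟨v, rfl⟩ := Nat.exists_eq_add_of_le' htu
  rw [Function.iterate_add_apply]
  rcases h with h | h
  · rw [iterate_of_halted Q T h]; exact Or.inl h
  · exact Or.inr (h.trans_le (iterate_out_prefix Q T _ v).length_le)

theorem Delayed.next (h : Delayed Q T V S d O b c) :
    Q.Halted ((Q.step T)^[b] c) ∨ c.out.length < ((Q.step T)^[b] c).out.length := by
  induction h with
  | halt h => rw [iterate_of_halted Q T h]; exact Or.inl h
  | @step b b' c c' t hr _ hb ih =>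
    rcases hb with hb | ⟨hb, -, hlt⟩
    · refine halted_or_length_lt_of_le hb ?_
      rw [add_comm, Function.iterate_add_apply, hr.1]
      refine ih.imp_right fun h => lt_of_le_of_lt ?_ h
      rw [← hr.1]
      exact (iterate_out_prefix Q T c t).length_le
    · exact halted_or_length_lt_of_le hb (Or.inr (by rwa [hr.1]))

/-- The factor `2` arises because `u` may fall inside a block: up to `d` steps complete the block,
whose output may already have been counted at time `u`, and up to `d` more lead to the next output.
-/
theorem Delayed.spec (h : Delayed Q T V S d O b c) (hbd : b ≤ d) (u : ℕ) :
    (Q.Halted ((Q.step T)^[u + 2 * d] c) ∨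
      ((Q.step T)^[u] c).out.length < ((Q.step T)^[u + 2 * d] c).out.length) ∧
    MemBound V S ((Q.step T)^[u] c).mem := by
  induction h generalizing u with
  | halt h hm => rw [iterate_of_halted Q T h, iterate_of_halted Q T h]; exact ⟨Or.inl h, hm⟩
  | @step b b' c c' t hr h' hb ih =>
    have hb' : b' ≤ d := by omega
    rcases le_total t u with htu | htu
    · obtain ⟨v, rfl⟩ := Nat.exists_eq_add_of_le' htu
      rw [show v + t + 2 * d = v + 2 * d + t by omega,
        Function.iterate_add_apply _ (v + 2 * d), Function.iterate_add_apply _ v t, hr.1]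
      exact ih hb' v
    · refine ⟨halted_or_length_lt_of_le (t := b' + t) (by omega) ?_, hr.2 u htu⟩
      rw [Function.iterate_add_apply, hr.1]
      refine h'.next.imp_right fun h => lt_of_le_of_lt ?_ h
      rw [← hr.1]
      obtain ⟨v, rfl⟩ := Nat.exists_eq_add_of_le' htu
      rw [Function.iterate_add_apply]
      exact (iterate_out_prefix Q T _ v).length_le

theorem Delayed.exists_halted (h : Delayed Q T V S d O b c) :
    ∃ t, Q.Halted ((Q.step T)^[t] c) ∧ ((Q.step T)^[t] c).out = O := by
  induction h with
  | halt h hm ho => exact ⟨0, h, ho⟩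
  | @step b b' c c' t hr _ hb ih =>
    obtain ⟨u, h1, h2⟩ := ih
    refine ⟨u + t, ?_⟩
    rw [Function.iterate_add_apply, hr.1]
    exact ⟨h1, h2⟩

end

/-- The bound on the time of an iteration of the main loop. -/
def eventTime (P : Program) (n m τ : ℕ) : ℕ := (τ + n + m + 1) * (800 + 4 * P.length) + 2

/-- The bound on the times between outputs. -/
def gapTime (P : Program) (n m τ : ℕ) : ℕ :=
  n * (m * 100 + 15) + 10 + (2 * n + 2) * eventTime P n m τ + 1

section
variable {n m : ℕ} {σ : Fin m → Implication (Fin n)} {P : Program}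
  {L : Finset (Fin n) → List (Finset (Fin n))} {W R S τ : ℕ}

/-- The recursion is lexicographic: an iteration with an output shortens the list of remaining
solutions, any other one that continues lowers the potential. A gap therefore has at most `pot + 1`
iterations, and `pot` is at most `2 * n + 1` after an output by `Pending.le`. -/
theorem delayed_loop {Q : Program} {p : ℕ} (hd : SimData σ P L W S τ) (hn : 0 < n)
    (hnW : n + 1 ≤ W) (hmW : m + 1 ≤ W) (hnR : n ≤ R) (hmR : m ≤ R) (hSR : S < R) (hSW : S ≤ W)
    (hQ : CodeAt Q p ((Cmd.loop .active (bodyCmd P)).compile p))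
    (hlen : Q.length = p + (Cmd.loop .active (bodyCmd P)).size)
    (rem : List (Finset (Fin n))) (pot : ℕ) (s : State) (c : Configuration) (hc : c.pc = p)
    (hrep : Represents (n + 1) c s) (hbd : s.Bounded (n + 1) W R)
    (hmem : MemBound (wordBound (n + 1) W) (spaceBound (n + 1) R) c.mem) (hs : MainInv σ s)
    (ha : s.reg .active = 1)
    (hp : Pending σ P L S s.arr (s.reg .vert) (s.reg .lev) rem pot) :
    ∃ ls, List.Forall₂ IsListing ls rem ∧
      Delayed Q (baseInput σ) (wordBound (n + 1) W) (spaceBound (n + 1) R) (gapTime P n m τ)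
        (c.out ++ ls) ((pot + 1) * eventTime P n m τ + 1) c := by
  have hw : 0 < (baseInput σ).cols := Nat.succ_pos n
  set B := eventTime P n m τ with hB
  have hBpos : 0 < B := by rw [hB, eventTime]; omega
  obtain ⟨N, hN⟩ : ∃ N, rem.length = N := ⟨_, rfl⟩
  induction N using Nat.strong_induction_on generalizing rem pot s c with
  | _ N ihN =>
  induction pot using Nat.strong_induction_on generalizing s c with
  | _ pot ihpot =>
  obtain ⟨s', hex, hs', ht', hpost⟩ := wp_bodyCmd (K := fun s' => MainInv σ s' ∧
    s'.time ≤ (s.tick 1).time + (τ + n + m + 1) * (800 + 4 * P.length) ∧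
    BodyPost σ P L S rem pot (s.tick 1) s') hd hn hnW hmW hnR hmR hSR hSW
    (s := s.tick 1) (hs.congr (fun _ _ => rfl) (fun _ _ _ => rfl) hs.cur) ha hp
    fun s' h1 h2 h3 => ⟨h1, h2, h3⟩
  rw [Cmd.compile] at hQ
  have e1 : (Instr.jumpZero (regCell .active) (p + (bodyCmd P).size + 2)).exec (baseInput σ) c =
      { c with pc := p + 1 } := by simp [Instr.exec, hrep.reg, ha, hc]
  have r1 := Reach.single (T := baseInput σ) (c := c)
    (i := .jumpZero (regCell .active) (p + (bodyCmd P).size + 2))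
    (by rw [hc]; exact hQ.head) hmem (by rw [e1]; exact hmem)
  rw [e1] at r1
  obtain ⟨c2, r2, h2, hb2, p2, t2⟩ := Exec.reach (Q := Q) hex hw { c with pc := p + 1 }
    (hrep.tick 1 _) (hbd.tick 1) hmem hQ.tail.left
  have hj := hQ.tail.right.head
  rw [Cmd.length_compile] at hj
  have r3 := Reach.single (T := baseInput σ) (c := c2) (i := .jump p) (by rw [p2]; exact hj)
    r2.right r2.right
  have r := (r1.trans r2).trans r3
  have hrep' : Represents (n + 1) ((Instr.jump p).exec (baseInput σ) c2) (s'.tick 1) :=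
    h2.tick 1 p
  have hbd' : (s'.tick 1).Bounded (n + 1) W R := hb2.tick 1
  have hs'' : MainInv σ (s'.tick 1) := hs'.congr (fun _ _ => rfl) (fun _ _ _ => rfl) hs'.cur
  have hout : c.out = s.out := hrep.out
  have hout' : ((Instr.jump p).exec (baseInput σ) c2).out = s'.out := hrep'.out
  generalize hT : 1 + (s'.time - (s.tick 1).time) + 1 = t at r
  have htB : t ≤ B := by
    rw [hB, eventTime]
    omega
  have hpB : B ≤ (pot + 1) * B + 1 := by nlinarith
  rcases hpost with ⟨ho, ha', pot', hlt, hp'⟩ | ⟨l, M, rem', pot', ho, hl, rfl, ha', hp'⟩ |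
    ⟨rfl, ho, ha'⟩
  · obtain ⟨ls, h1, h3⟩ := ihpot pot' hlt (s'.tick 1) _ rfl hrep' hbd' r.right hs'' ha' hp'
    rw [hout', ho, State.tick_out, ← hout] at h3
    refine ⟨ls, h1, .step r h3 (Or.inl ?_)⟩
    have : (pot' + 1 + 1) * B ≤ (pot + 1) * B := Nat.mul_le_mul_right _ (by omega)
    rw [add_mul, one_mul] at this
    omega
  · obtain ⟨ls, h1, h3⟩ := ihN rem'.length (by simp [← hN]) rem' pot' (s'.tick 1) _ rfl hrep'
      hbd' r.right hs'' ha' hp' rfl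
    rw [hout', ho, State.tick_out, ← hout, List.append_assoc, List.singleton_append] at h3
    refine ⟨l :: ls, .cons hl h1, .step r h3 (Or.inr ⟨htB.trans hpB, ?_, ?_⟩)⟩
    · have := hp'.le
      have h4 : (pot' + 1) * B ≤ (2 * n + 2) * B := Nat.mul_le_mul_right _ (by omega)
      rw [gapTime, ← hB]
      omega
    · rw [hout', ho, hout]
      simp
  · refine ⟨[], .nil, ?_⟩
    have e4 : (Instr.jumpZero (regCell .active) (p + (bodyCmd P).size + 2)).exec (baseInput σ)
        ((Instr.jump p).exec (baseInput σ) c2) =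
        { (Instr.jump p).exec (baseInput σ) c2 with pc := p + (bodyCmd P).size + 2 } := by
      have := hrep'.reg .active
      simp only [State.tick_reg, ha'] at this
      simp only [Instr.exec] at this ⊢
      simp [this]
    have r4 := Reach.single (T := baseInput σ) (c := (Instr.jump p).exec (baseInput σ) c2)
      hQ.head r.right (e4 ▸ r.right)
    rw [e4] at r4
    refine .step (b' := 0) (r.trans r4) (.halt ?_ r.right ?_) (Or.inl ?_)
    · rw [Program.Halted, hlen, Cmd.size]
      exact le_of_eq (by simp only; omega)
    · rw [List.append_nil, hout]
      exact hout'.trans ho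
    · have : B ≤ (pot + 1) * B := Nat.le_mul_of_pos_left _ (by omega)
      omega

/-- The compiled program enumerates the meet-irreducible elements, with bounded delay, words and
space. -/
theorem mainCmd_spec (hd : SimData σ P L W S τ) (hn : 0 < n)
    (hnW : n + 1 ≤ W) (hmW : m + 1 ≤ W) (hnR : n ≤ R) (hmR : m ≤ R) (hSR : S < R) (hSW : S ≤ W) :
    (∃ t, Program.Halted ((mainCmd P).compile 0)
        (Program.run ((mainCmd P).compile 0) (baseInput σ) t) ∧
      List.Forall₂ IsListing (Program.run ((mainCmd P).compile 0) (baseInput σ) t).out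
        (meetIrreducibleList L)) ∧
    Program.HasDelay ((mainCmd P).compile 0) (baseInput σ) 0 (2 * gapTime P n m τ) ∧
    ∀ t, MemBound (wordBound (n + 1) W) (spaceBound (n + 1) R)
      (Program.run ((mainCmd P).compile 0) (baseInput σ) t).mem := by
  set Q : Program := (mainCmd P).compile 0 with hQ
  have hw : 0 < (baseInput σ).cols := Nat.succ_pos n
  have hcode : CodeAt Q 0 ((mainCmd P).compile 0) := fun j _ => by rw [zero_add]
  obtain ⟨u, hex, hinv, hl, hv, ha, ho, ht⟩ := wp_initCmd (R := R) (W := W) (σ := σ)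
    (K := fun u => MainInv σ u ∧ u.reg .lev = 0 ∧ u.reg .vert = 0 ∧ u.reg .active = 1 ∧
      u.out = [] ∧ u.time ≤ n * (m * 100 + 15) + 10) hn hnW hmW hmR
    fun u h1 h2 h3 h4 h5 h6 h7 h8 h9 h10 h11 => ⟨⟨h1, h2, h3, h7, h8, h9⟩, h4, h5, h6, h10, h11⟩
  have hm0 : MemBound (wordBound (n + 1) W) (spaceBound (n + 1) R) Configuration.initial.mem :=
    fun a => ⟨Nat.zero_le _, fun h => absurd rfl h⟩
  obtain ⟨c, r, hrep, hbd, hpc, -⟩ := Exec.reach (Q := Q) hex hw Configuration.initial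
    ⟨fun _ => rfl, fun _ _ _ _ => rfl, rfl, rfl⟩
    ⟨fun _ => Nat.zero_le _, fun _ _ _ _ => Nat.zero_le _, fun _ _ _ _ h => absurd rfl h⟩ hm0
    hcode.left
  have hloop := hcode.right
  rw [Cmd.length_compile, zero_add] at hloop
  have hpc' : c.pc = initCmd.size := by
    rw [hpc]
    exact Nat.zero_add _
  obtain ⟨ls, h1, h2⟩ := delayed_loop hd hn hnW hmW hnR hmR hSR hSW hloop
    (by rw [hQ, Cmd.length_compile]; rfl) _ _ u c hpc' hrep hbd r.right hinv ha
    (by rw [hl, hv]; exact .root)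
  have hco : c.out = [] := hrep.out.trans ho
  rw [hco, List.nil_append] at h2
  -- The initialization is charged to the time before the first output, so no preprocessing phase is
  -- needed.
  have hdel : Delayed Q (baseInput σ) (wordBound (n + 1) W) (spaceBound (n + 1) R)
      (gapTime P n m τ) ls (gapTime P n m τ) Configuration.initial := by
    refine .step r h2 (Or.inl ?_)
    have : ((if 0 < n then n else n + 1) + 1) * eventTime P n m τ ≤
        (2 * n + 2) * eventTime P n m τ := Nat.mul_le_mul_right _ (by rw [if_pos hn]; omega)
    simp only [State.initial]
    rw [gapTime]
    omega
  refine ⟨?_, ⟨rfl, fun t _ => (hdel.spec le_rfl t).1⟩, fun t => (hdel.spec le_rfl t).2⟩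
  obtain ⟨t, h3, h4⟩ := hdel.exists_halted
  refine ⟨t, h3, ?_⟩
  rw [Program.run, h4]
  exact h1

end

theorem Instr.Small.mono {W W' : ℕ} (h : W ≤ W') {i : Instr} (hi : Instr.Small W i) :
    Instr.Small W' i := by
  cases i <;> simp only [Instr.Small] at hi ⊢ <;> omega

/-- The constants in the text of the simulated program become words of the simulating one, so they
enter the word bound; they are independent of the input. -/
theorem exists_small (P : Program) :
    ∃ κ, P.length ≤ κ ∧ ∀ i ∈ P, Instr.Small κ i := by
  induction P with
  | nil => exact ⟨0, by simp, by simp⟩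
  | cons i P ih =>
    obtain ⟨κ, h1, h2⟩ := ih
    obtain ⟨μ, hμ⟩ : ∃ μ, Instr.Small μ i := by
      cases i with
      | const d c => exact ⟨d + c, by omega, by omega⟩
      | arith o d a b => exact ⟨d + a + b, by omega, by omega, by omega⟩
      | load d a => exact ⟨d + a, by omega, by omega⟩
      | store a b => exact ⟨a + b, by omega, by omega⟩
      | jump l => exact ⟨l, le_rfl⟩
      | jumpZero a l => exact ⟨a + l, by omega, by omega⟩
      | rows d => exact ⟨d, le_rfl⟩
      | cols d => exact ⟨d, le_rfl⟩
      | entry d a b => exact ⟨d + a + b, by omega, by omega, by omega⟩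
      | write a => exact ⟨a, le_rfl⟩
      | emit => exact ⟨0, trivial⟩
    refine ⟨κ + μ + 1, by simp; omega, fun j hj => ?_⟩
    rcases List.mem_cons.1 hj with rfl | hj
    · exact hμ.mono (by omega)
    · exact (h2 j hj).mono (by omega)

end Ram

theorem Program.HasDelay.mono {P : Program} {T : InputTable} {p d d' : ℕ} (h : P.HasDelay T p d)
    (hd : d ≤ d') : P.HasDelay T p d' :=
  ⟨h.1, fun t ht => Ram.halted_or_length_lt_of_le (by omega) (h.2 t ht)⟩

theorem Program.Halted.run_mono {P : Program} {T : InputTable} {t u : ℕ}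
    (h : P.Halted (P.run T t)) (htu : t ≤ u) : P.Halted (P.run T u) := by
  rwa [run_of_halted P T h htu]

theorem Program.Halted.hasDelay {P : Program} {T : InputTable} {d : ℕ}
    (h : P.Halted (P.run T d)) : P.HasDelay T 0 d :=
  ⟨rfl, fun _ _ => Or.inl (h.run_mono (by omega))⟩

/-- A program halts in time at most the delay times the number of outputs plus one. -/
theorem Program.HasDelay.halted {P : Program} {T : InputTable} {d t : ℕ} (h : P.HasDelay T 0 d)
    (ht : P.Halted (P.run T t)) :
    P.Halted (P.run T (((P.run T t).out.length + 1) * d)) := by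
  have key : ∀ j, P.Halted (P.run T (j * d)) ∨ j ≤ (P.run T (j * d)).out.length := by
    intro j
    induction j with
    | zero => exact Or.inr (Nat.zero_le _)
    | succ j ih =>
      rw [add_mul, one_mul]
      rcases ih with ih | ih
      · exact Or.inl (ih.run_mono (by omega))
      · exact (h.2 (j * d) (Nat.zero_le _)).imp_right fun h => by omega
  refine (key _).resolve_right fun h' => ?_
  have := (out_prefix_of_halted (t := ((P.run T t).out.length + 1) * d) ht).length_le
  omega

/-! ### Choice of the bounds for the two complexity statements. -/

namespace Ram

section
variable {n m : ℕ} {σ : Fin m → Implication (Fin n)} {P : Program} {W R S τ κ : ℕ}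

/-- Enumeration of meet-irreducible elements by a program for maximal independent sets. -/
theorem enumerates_meetIrreducibles (hσ : IsRankedInstance σ)
    (hE : ∀ Y, P.Enumerates (subInput σ Y) (maximalIndependentSets (edgesInto (Set.range σ) Y)))
    (hB : ∀ k acc Y, Stage (Set.range σ) k acc Y → k < n → ∀ t a,
      (P.run (subInput σ Y) t).mem a ≤ W ∧ ((P.run (subInput σ Y) t).mem a ≠ 0 → a < S))
    (hD : ∀ k acc Y, Stage (Set.range σ) k acc Y → k < n → P.HasDelay (subInput σ Y) 0 τ)
    (hP : ∀ i ∈ P, Instr.Small W i) (hPW : P.length ≤ W) (hnW : n + 1 ≤ W) (hmW : m + 1 ≤ W)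
    (hnR : n ≤ R) (hmR : m ≤ R) (hSR : S < R) (hSW : S ≤ W) :
    (∃ t, Program.Halted ((mainCmd P).compile 0)
        (Program.run ((mainCmd P).compile 0) (baseInput σ) t) ∧
      (Program.run ((mainCmd P).compile 0) (baseInput σ) t).out.length =
        (meetIrreducibles (Set.range σ)).ncard) ∧
    Program.Enumerates ((mainCmd P).compile 0) (baseInput σ) (meetIrreducibles (Set.range σ)) ∧
    Program.HasDelay ((mainCmd P).compile 0) (baseInput σ) 0 (2 * gapTime P n m τ) ∧
    ∀ t, MemBound (wordBound (n + 1) W) (spaceBound (n + 1) R)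
      (Program.run ((mainCmd P).compile 0) (baseInput σ) t).mem := by
  choose t ht L hnd hL hlist using hE
  have hd : SimData σ P L W S τ :=
    { listing := fun Y => ⟨t Y, ht Y, hlist Y⟩
      ne_nil := fun Y => by
        obtain ⟨X, hX⟩ := maximalIndependentSets_edgesInto_nonempty hσ.standard Y
        exact List.ne_nil_of_mem ((hL Y X).2 hX)
      mem := hL
      bound := hB
      delay := hD
      small := hP
      length_le := hPW }
  obtain ⟨⟨u, h1, h2⟩, h3, h4⟩ := mainCmd_spec hd hσ.nonempty hnW hmW hnR hmR hSR hSW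
  have hnd' := nodup_meetIrreducibleList hσ.ranked hL hnd
  have hmem := fun M => mem_meetIrreducibleList hσ.ranked hL (M := M)
  refine ⟨⟨u, h1, ?_⟩, ⟨u, h1, _, hnd', hmem, h2⟩, h3, h4⟩
  classical
  rw [h2.length_eq, ← List.toFinset_card_of_nodup hnd', ← Set.ncard_coe_finset]
  congr 1
  ext M
  simpa using hmem M

/-- As `X ≥ 2`, a constant factor can be moved into the exponent by `a ≤ 2 ^ a`, so the word length
stays logarithmic. The number `59 = 35 + 12 * 2` collects the constants of `wordBound`. -/
theorem wordBound_le {X a : ℕ} (hX : 2 ≤ X) (hn : n + 1 ≤ X) (hW : W ≤ X ^ a + κ) :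
    wordBound (n + 1) W ≤ X ^ (a + 1 + (59 + 12 * κ)) := by
  have h1 : 1 ≤ X ^ a := Nat.one_le_pow _ _ (by omega)
  have h2 : W + 1 ≤ X ^ a * (κ + 2) := by
    have : κ ≤ X ^ a * κ := Nat.le_mul_of_pos_left _ h1
    rw [mul_add]
    omega
  have h3 : (W + 1) * (n + 1) ≤ X ^ (a + 1) * (κ + 2) := by
    calc (W + 1) * (n + 1) ≤ X ^ a * (κ + 2) * X := Nat.mul_le_mul h2 hn
      _ = X ^ (a + 1) * (κ + 2) := by ring
  have h4 : 1 ≤ X ^ (a + 1) := Nat.one_le_pow _ _ (by omega)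
  calc wordBound (n + 1) W ≤ X ^ (a + 1) * (59 + 12 * κ) := by
        rw [wordBound]
        nlinarith
    _ ≤ X ^ (a + 1) * X ^ (59 + 12 * κ) :=
        Nat.mul_le_mul_left _ ((Nat.lt_two_pow_self).le.trans (Nat.pow_le_pow_left hX _))
    _ = X ^ (a + 1 + (59 + 12 * κ)) := (pow_add ..).symm

/-- The exponent `a + 1` in place of `a` makes the bound at least `X` even for `a = 0`. -/
theorem self_le_pow_succ_add {X : ℕ} (hX : 2 ≤ X) (a κ : ℕ) :
    X ≤ X ^ (a + 1) + κ ∧ X ^ a ≤ X ^ (a + 1) + κ := by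
  have h1 : X ^ 1 ≤ X ^ (a + 1) := Nat.pow_le_pow_right (by omega) (by omega)
  have h2 : X ^ a ≤ X ^ (a + 1) := Nat.pow_le_pow_right (by omega) (by omega)
  rw [pow_one] at h1
  omega

end

theorem enumeratesMeetIrreducibles_mainCmd {P : Program} {f g : ℕ → ℕ} (hf : Monotone f)
    (hg : Monotone g) {cf cg : ℕ} (hcf : ∀ N, N ≤ cf * f N) (hcg : ∀ N, N ≤ cg * g N)
    (hP : EnumeratesMIS P f g) : EnumeratesMeetIrreducibles ((mainCmd P).compile 0) f g := by
  obtain ⟨c, hP⟩ := hP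
  obtain ⟨κ, hκ, hsmall⟩ := exists_small P
  set e := (cf + 2) * (800 + 4 * P.length) + 2 with he
  refine ⟨2 * (100 * cf + 26 + 4 * e) + (24 * cg + 71), c + 1 + 1 + (59 + 12 * κ),
    fun n m σ hσ => ?_⟩
  have hn := hσ.nonempty
  set N := n + m with hN
  set C := 2 * (100 * cf + 26 + 4 * e) + (24 * cg + 71) with hC
  have hf1 : 1 ≤ f N := by
    by_contra h
    have := hcf N
    rw [show f N = 0 by omega] at this
    omega
  have hg1 : 1 ≤ g N := by
    by_contra h
    have := hcg N
    rw [show g N = 0 by omega] at this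
    omega
  set X := N + g N + 2 with hX
  have hle : ∀ Y, n + edgeCount σ Y ≤ N := fun Y => by
    have := edgeCount_le σ Y
    omega
  have hQ := fun Y => hP n _ (edgeOf σ Y) (edgeOf_injective σ Y)
  have hXW := self_le_pow_succ_add (X := X) (by omega) c κ
  obtain ⟨-, h1, h2, h3⟩ := enumerates_meetIrreducibles (P := P) (W := X ^ (c + 1) + κ)
    (R := g N + N + 1) (S := g N) (τ := f N) hσ
    (fun Y => by rw [← range_edgeOf]; exact (hQ Y).1)
    (fun k acc Y _ _ t a => by
      obtain ⟨h1, h2⟩ := (hQ Y).2.2 t a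
      have hgle := hg (hle Y)
      have h3 : (n + edgeCount σ Y + g (n + edgeCount σ Y) + 2) ^ c ≤ X ^ c :=
        Nat.pow_le_pow_left (by have := hle Y; omega) _
      exact ⟨h1.trans (h3.trans hXW.2), fun h => (h2 h).trans_le hgle⟩)
    (fun k acc Y _ _ => (hQ Y).2.1.mono (hf (hle Y)))
    (fun i hi => (hsmall i hi).mono (by omega)) (by omega) (by omega) (by omega) (by omega)
    (by omega) (by omega) (by omega)
  have hgn : g N ≤ n * g N := Nat.le_mul_of_pos_left _ hn
  have hng : 1 ≤ n * g N := hg1.trans hgn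
  have hCs : (24 * cg + 71) * (n * g N) ≤ C * (n * g N) := Nat.mul_le_mul_right _ (by omega)
  have hspace : spaceBound (n + 1) (g N + N + 1) ≤ C * (n * g N) := by
    refine le_trans ?_ hCs
    have h4 : g N + N + 1 ≤ (cg + 2) * g N := by
      have := hcg N
      rw [add_mul]
      omega
    have h5 : (g N + N + 1) * (n + 1) ≤ (cg + 2) * g N * (2 * n) :=
      Nat.mul_le_mul h4 (by omega)
    have h6 : (cg + 2) * g N * (2 * n) = (2 * cg + 4) * (n * g N) := by ring
    rw [spaceBound]
    nlinarith
  -- Preprocessing time `0` suffices: the initialization takes time of order `n * (m + 1)`, which is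
  -- `O(n * f N)` because `m ≤ N ≤ cf * f N` and `f N ≥ 1`.
  refine ⟨h1, ⟨0, Nat.zero_le _, h2.mono ?_⟩, fun t a => ?_⟩
  · have hfn : f N ≤ n * f N := Nat.le_mul_of_pos_left _ hn
    have hNf := hcf N
    have h4 : eventTime P n m (f N) ≤ e * f N := by
      have h5 : f N + n + m + 1 ≤ (cf + 2) * f N := by
        rw [add_mul]
        omega
      have h6 := Nat.mul_le_mul_right (800 + 4 * P.length) h5
      have h7 : e * f N = (cf + 2) * f N * (800 + 4 * P.length) + 2 * f N := by ring
      rw [eventTime, h7]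
      omega
    have h5 : (2 * n + 2) * eventTime P n m (f N) ≤ 4 * n * (e * f N) :=
      Nat.mul_le_mul (by omega) h4
    have h6 : 4 * n * (e * f N) = 4 * e * (n * f N) := by ring
    have h7 : n * (m * 100 + 15) ≤ n * ((100 * cf + 15) * f N) :=
      Nat.mul_le_mul_left _ (by rw [add_mul, mul_assoc]; omega)
    have h8 : n * ((100 * cf + 15) * f N) = (100 * cf + 15) * (n * f N) := by ring
    have h9 : 2 * gapTime P n m (f N) ≤ 2 * (100 * cf + 26 + 4 * e) * (n * f N) := by
      rw [gapTime]
      have : 1 ≤ n * f N := hf1.trans hfn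
      nlinarith
    exact h9.trans (Nat.mul_le_mul_right _ (by omega))
  · have hsp : g N ≤ C * (n * g N) :=
      hgn.trans (Nat.le_mul_of_pos_left _ (by omega))
    refine ⟨((h3 t a).1.trans (wordBound_le (X := N + C * (n * g N) + 2) (a := c + 1) (κ := κ)
      (by omega) (by omega) (Nat.add_le_add_right (Nat.pow_le_pow_left (by omega) _) _))),
      fun h => ((h3 t a).2 h).trans_le hspace⟩

/-- With `l = log₂ (N + 2) ≥ 1`, the logarithm of the product is at most `K + 3 * l + 6 + 3 * c₀ * l
^ c₀`; all these powers of `l` are dominated by one with a large enough exponent. -/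
theorem IsQuasiPolynomial.const_mul_pow {G : ℕ → ℕ} {c₀ : ℕ}
    (hG : ∀ N, G N = 2 ^ (c₀ * Nat.log 2 (N + 2) ^ c₀)) (K : ℕ) :
    IsQuasiPolynomial fun N => K * (N + G N + 2) ^ 3 := by
  refine ⟨K + 9 + 3 * c₀, fun N => ?_⟩
  set l := Nat.log 2 (N + 2) with hl
  have hl1 : 1 ≤ l := Nat.log_pos (by omega) (by omega)
  have h1 : N + 2 ≤ 2 ^ (l + 1) := (Nat.lt_pow_succ_log_self (by omega) _).le
  have h2 : N + G N + 2 ≤ 2 ^ (l + 2 + c₀ * l ^ c₀) := by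
    have h3 : 2 ^ (l + 2 + c₀ * l ^ c₀) = 2 ^ (l + 1) * 2 ^ (c₀ * l ^ c₀) * 2 := by ring
    have h4 : 1 ≤ 2 ^ (l + 1) := Nat.one_le_two_pow
    have h5 : 1 ≤ 2 ^ (c₀ * l ^ c₀) := Nat.one_le_two_pow
    have := hG N
    rw [← hl] at this
    rw [h3, this]
    nlinarith
  have hpow : ∀ a, a ≤ K + 9 + 3 * c₀ → l ^ a ≤ l ^ (K + 9 + 3 * c₀) := fun a ha =>
    Nat.pow_le_pow_right hl1 ha
  have hp0 := hpow 0 (by omega)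
  have hp1 := hpow 1 (by omega)
  have hp2 := Nat.mul_le_mul_left (3 * c₀) (hpow c₀ (by omega))
  rw [pow_zero] at hp0
  rw [pow_one] at hp1
  calc K * (N + G N + 2) ^ 3 ≤ 2 ^ K * (2 ^ (l + 2 + c₀ * l ^ c₀)) ^ 3 :=
        Nat.mul_le_mul Nat.lt_two_pow_self.le (Nat.pow_le_pow_left h2 _)
    _ = 2 ^ (K + 3 * l + 6 + 3 * c₀ * l ^ c₀) := by rw [← pow_mul, ← pow_add]; congr 1; ring
    _ ≤ 2 ^ ((K + 9 + 3 * c₀) * l ^ (K + 9 + 3 * c₀)) :=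
        Nat.pow_le_pow_right (by omega) (by nlinarith)

theorem enumeratesMeetIrreducibles_mainCmd_quasiPolynomial {P : Program}
    (hP : EnumeratesMISInQuasiPolynomialTime P) :
    EnumeratesMeetIrreduciblesInQuasiPolynomialTime ((mainCmd P).compile 0) := by
  obtain ⟨F, ⟨c₀, hF⟩, c, hP⟩ := hP
  obtain ⟨κ, hκ, hsmall⟩ := exists_small P
  -- The given bound `F` need not be monotone. The explicit majorant `G` is, so that it also covers
  -- all the smaller hypergraphs met.
  obtain ⟨G, hG⟩ : ∃ G : ℕ → ℕ, ∀ N, G N = 2 ^ (c₀ * Nat.log 2 (N + 2) ^ c₀) := ⟨_, fun _ => rfl⟩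
  have hGm : Monotone G := fun a b hab => by
    rw [hG, hG]
    exact Nat.pow_le_pow_right (by omega) (Nat.mul_le_mul_left _
      (Nat.pow_le_pow_left (Nat.log_mono_right (by omega)) _))
  have hFG : ∀ {a b}, a ≤ b → F a ≤ G b := fun {a b} hab =>
    ((hF a).trans_eq (hG a).symm).trans (hGm hab)
  set e := 2 * (800 + 4 * P.length) + 1 with he
  set K := 2 * (126 + 2 * e) + 47 with hK
  refine ⟨_, IsQuasiPolynomial.const_mul_pow hG K, c + 1 + 1 + (59 + 12 * κ),
    fun n m σ hσ N hN => ?_⟩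
  have hn := hσ.nonempty
  set X := N + G N + 2 with hX
  have hQ := fun Y => hP n _ (edgeOf σ Y) (edgeOf_injective σ Y) _ rfl
  -- The output-sensitive size of each hypergraph met during the search is at most that of the whole
  -- instance. This is only available for sets `Y` that really occur, hence the restriction to
  -- `Stage`.
  have hle : ∀ k acc Y, Stage (Set.range σ) k acc Y → k < n →
      n + edgeCount σ Y + (maximalIndependentSets (Set.range (edgeOf σ Y))).ncard ≤ N := by
    intro k acc Y h hk
    have h1 := edgeCount_le σ Y
    have h2 := ncard_maximalIndependentSets_le hσ.ranked hσ.standard h (by simpa using hk)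
    rw [range_edgeOf]
    omega
  have hXW := self_le_pow_succ_add (X := X) (by omega) c κ
  obtain ⟨⟨t, h0, hlen⟩, h1, h2, h3⟩ := enumerates_meetIrreducibles (P := P)
    (W := X ^ (c + 1) + κ) (R := G N + n + m + 1) (S := G N) (τ := G N) hσ
    (fun Y => by rw [← range_edgeOf]; exact (hQ Y).1)
    (fun k acc Y h hk t a => by
      obtain ⟨h1, h2⟩ := (hQ Y).2.2 t a
      have hNY := hle k acc Y h hk
      have hFY := hFG hNY
      exact ⟨h1.trans ((Nat.pow_le_pow_left (by omega) _).trans hXW.2),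
        fun h => (h2 h).trans_le hFY⟩)
    (fun k acc Y h hk => ((hQ Y).2.1.run_mono (hFG (hle k acc Y h hk))).hasDelay)
    (fun i hi => (hsmall i hi).mono (by omega)) (by omega) (by omega) (by omega) (by omega)
    (by omega) (by omega) (by omega)
  have hX2 : 2 ≤ X := by omega
  have hXX : 2 * X ≤ X ^ 2 := by rw [sq]; exact Nat.mul_le_mul_right _ hX2
  have hX3 : X ^ 2 ≤ X ^ 3 := Nat.pow_le_pow_right (by omega) (by omega)
  have hnX : n + 1 ≤ X := by omega
  refine ⟨h1, (h2.halted h0).run_mono ?_, fun t a => ⟨?_, fun h => ((h3 t a).2 h).trans_le ?_⟩⟩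
  · have h4 : eventTime P n m (G N) ≤ e * X := by
      have := Nat.mul_le_mul_right (800 + 4 * P.length)
        (show G N + n + m + 1 ≤ 2 * X by omega)
      have h5 : e * X = 2 * X * (800 + 4 * P.length) + X := by ring
      rw [eventTime, h5]
      omega
    have h5 : (2 * n + 2) * eventTime P n m (G N) ≤ 2 * X * (e * X) :=
      Nat.mul_le_mul (by omega) h4
    have h6 : 2 * X * (e * X) = 2 * e * X ^ 2 := by ring
    have h7 : n * (m * 100 + 15) ≤ X * (100 * X + 15) := Nat.mul_le_mul (by omega) (by omega)
    have h8 : gapTime P n m (G N) ≤ (126 + 2 * e) * X ^ 2 := by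
      rw [gapTime]
      nlinarith
    have h9 : (meetIrreducibles (Set.range σ)).ncard + 1 ≤ X := by omega
    rw [hlen]
    -- At most `X` gaps, each of length quadratic in `X`: this is the origin of the cube.
    calc _ ≤ X * (2 * ((126 + 2 * e) * X ^ 2)) := Nat.mul_le_mul h9 (Nat.mul_le_mul_left _ h8)
      _ = 2 * (126 + 2 * e) * X ^ 3 := by ring
      _ ≤ K * X ^ 3 := Nat.mul_le_mul_right _ (by omega)
  · have hKX : X ≤ K * X ^ 3 := by nlinarith
    exact (h3 t a).1.trans (wordBound_le (X := N + K * X ^ 3 + 2) (a := c + 1) (κ := κ)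
      (by omega) (by omega) (Nat.add_le_add_right (Nat.pow_le_pow_left (by omega) _) _))
  · have h4 : (G N + n + m + 1) * (n + 1) ≤ 2 * X * X := Nat.mul_le_mul (by omega) hnX
    rw [spaceBound]
    nlinarith

end Ram

theorem theorem4 :
    (∀ f g : ℕ → ℕ, Monotone f → Monotone g →
      (∃ c : ℕ, ∀ N, N ≤ c * f N) → (∃ c : ℕ, ∀ N, N ≤ c * g N) →
      (∃ P : Program, EnumeratesMIS P f g) →
      ∃ Q : Program, EnumeratesMeetIrreducibles Q f g) ∧
    ((∃ P : Program, EnumeratesMISInQuasiPolynomialTime P) →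
      ∃ Q : Program, EnumeratesMeetIrreduciblesInQuasiPolynomialTime Q) :=
  ⟨fun _ _ hf hg ⟨_, hcf⟩ ⟨_, hcg⟩ ⟨_, hP⟩ =>
      ⟨_, Ram.enumeratesMeetIrreducibles_mainCmd hf hg hcf hcg hP⟩,
    fun ⟨_, hP⟩ => ⟨_, Ram.enumeratesMeetIrreducibles_mainCmd_quasiPolynomial hP⟩⟩
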